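/- Let $\mathbb F_q$ be a finite field with $q$ elements, $\mathbb R_\infty=\mathbb F_q((1/\theta))$, $\mathbb C_\infty$ the completion of an algebraic closure of $\mathbb R_\infty$, and $n\ge 0$ an integer. Let $\mathbb C_\infty[T,\tau]$ be the ring of non-commutative polynomials with $Ta=aT$, $T\tau=\tau T$, $\tau a=a^q\tau$ for $a\in\mathbb C_\infty$. For $x\in\mathbb C_\infty^n$ write $x^{(k)}$ for $x$ with all coordinates raised to the power $q^k$. A *T-motive* of dimension $n$ and rank $r$ is a left $\mathbb C_\infty[T,\tau]$-module $M$ that is free of rank $n$ over $\mathbb C_\infty[\tau]$, free of rank $r$ over $\mathbb C_\infty[T]$, and satisfies $(T-\theta)^mM\subset\tau M$ for some $m$. For $A\in M_n(\mathbb C_\infty)$ let $M(A)$ be the left $\mathbb C_\infty[T,\tau]$-module with generators $e_*=(e_1,\dots,e_n)^t$ and defining relations $Te_*=\theta e_*+A\tau e_*+\tau^2e_*$. Put $\mathrm{Lie}(M)=\mathrm{Hom}_{\mathbb C_\infty}(M/\tau M,\mathbb C_\infty)$ and $E(M)=\mathrm{Hom}_{\mathbb C_\infty[\tau]}(M,\mathbb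 C_\infty)$, where $\tau$ acts on $\mathbb C_\infty$ by $x\mapsto x^q$; $T$ acts on both through $M$. For $M=M(A)$ evaluation at $e_1,\dots,e_n$ identifies both with $\mathbb C_\infty^n$. The exponential of $M(A)$ is the map $\mathrm{Exp}:\mathrm{Lie}(M(A))\to E(M(A))$ that commutes with $T$ and is given in these coordinates by an everywhere convergent series $\mathrm{Exp}(z)=\sum_{k\ge0}C_kz^{(k)}$, $C_k\in M_n(\mathbb C_\infty)$, $C_0=E_n$. The lattice of $M(A)$ is $L(M(A))=\ker\mathrm{Exp}\subset\mathbb C_\infty^n$. A *lattice* of rank $r$ in $\mathbb C_\infty^n$ is a free $\mathbb F_q[\theta]$-submodule of rank $r$ that spans $\mathbb C_\infty^n$ over $\mathbb C_\infty$ and whose $\mathbb R_\infty$-span has dimension $r$ over $\mathbb R_\infty$. If $l_1,\dots,l_{2n}$ is an $\mathbb F_q[\theta]$-basis of a lattice of rank $2n$ and $l_1,\dots,l_n$ is a $\mathbb C_\infty$-basis of $\mathbb C_\infty^n$, its *Siegel matrix* is the matrix $Z=(z_{ij})\in M_n(\mathbb C_\infty)$ with $l_{n+i}=\sum_jz_{ij}l_j$.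 Let $S_3\subset M_n(\mathbb C_\infty)$ be the set of all Siegel matrices so obtained, and for $Z\in M_n(\mathbb C_\infty)$ let $\mathfrak L(Z)$ be the $\mathbb F_q[\theta]$-span of the standard basis vectors and the rows of $Z$. Fix $\omega\in\mathbb F_{q^2}\setminus\mathbb F_q$, let $L_0=\mathfrak L(\omega E_n)$, let $l_{0,i}$ be the $i$-th standard basis vector and $l_{0,n+i}=\omega l_{0,i}$ ($1\le i\le n$). **Proposition 2.2.** Every $M(A)$ is a T-motive of dimension $n$ and rank $2n$. There is $y\in\mathbb C_\infty^*$ with $y^{-1}L(M(0))=L_0$. For every such $y$ there are open neighbourhoods $\mathfrak U_1\subset M_n(\mathbb C_\infty)$ of $0$ and $\mathfrak U_3\subset S_3$ of $\omega E_n$ (open in $M_n(\mathbb C_\infty)$) and a map $\mu_{13}:\mathfrak U_1\to\mathfrak U_3$ such that: 1. (Commutativity of the diagram of matrices, T-motives, Siegel matrices and lattices.) For every $A\in\mathfrak U_1$, $L(M(A))$ is a lattice of rank $2n$, and it equals $\mathfrak L(\mu_{13}(A))$ up to a $\mathbb C_\infty$-linear automorphism of $\mathbb C_\infty^n$. 2.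 For every $A\in\mathfrak U_1$ the lattice $y^{-1}L(M(A))$ has an $\mathbb F_q[\theta]$-basis $l_1(A),\dots,l_{2n}(A)$ such that $l_1(A),\dots,l_n(A)$ is a $\mathbb C_\infty$-basis of $\mathbb C_\infty^n$ and the Siegel matrix of this basis is $\mu_{13}(A)$. This basis is the one close to the basis $l_{0,1},\dots,l_{0,2n}$ of $L_0$: there is $\rho>0$, independent of $A$, such that for all $A\in\mathfrak U_1$ and all $i$ the vector $l_i(A)$ is the only element of $y^{-1}L(M(A))$ at distance less than $\rho$ from $l_{0,i}$; and $l_i(A)\to l_{0,i}$ as $A\to0$. -/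

import Mathlib

open Filter Topology

noncomputable section

/-! ## The field `C∞` -/

/-- The local field `F((1/θ))`, realised as Laurent series in the variable `1/θ`. -/
abbrev RInf (F : Type*) [Field F] : Type _ := LaurentSeries F

/-- The valuation of `F((1/θ))` as a real absolute value, normalised by `|θ| = #F`. -/
instance RInf.rankOne (F : Type*) [Field F] [Fintype F] :
    (Valued.v : Valuation (RInf F) (WithZero (Multiplicative ℤ))).RankOne where
  hom' := (WithZeroMulInt.toNNReal (e := (Fintype.card F : NNReal))
      (by simp [Fintype.card_ne_zero])).comp MonoidWithZeroHom.ValueGroup₀.embedding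
  strictMono' := (WithZeroMulInt.toNNReal_strictMono
      (by exact_mod_cast Fintype.one_lt_card)).comp
        MonoidWithZeroHom.ValueGroup₀.embedding_strictMono
  exists_val_nontrivial := by
    refine ⟨HahnSeries.single 1 1, ?_, ?_⟩
    · have h := LaurentSeries.valuation_single_zpow F 1
      rw [h]; simp
    · have h := LaurentSeries.valuation_single_zpow F 1
      rw [h]
      intro h1
      have h2 : WithZero.log (WithZero.exp (-1 : ℤ)) = WithZero.log 1 := by rw [h1]
      simp at h2

instance RInf.nontriviallyNormedField (F : Type*) [Field F] [Fintype F] :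
    NontriviallyNormedField (RInf F) :=
  Valued.toNontriviallyNormedField (RInf F) (WithZero (Multiplicative ℤ))

instance RInf.isUltrametricDist (F : Type*) [Field F] [Fintype F] :
    IsUltrametricDist (RInf F) :=
  IsUltrametricDist.isUltrametricDist_of_forall_norm_add_le_max_norm
    (Valued.isNonarchimedean_norm (RInf F) (WithZero (Multiplicative ℤ)))

/-- The algebraic closure of `F((1/θ))`. -/
def RInfAlgCl (F : Type*) [Field F] : Type _ := AlgebraicClosure (RInf F)

instance RInfAlgCl.field (F : Type*) [Field F] : Field (RInfAlgCl F) :=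
  inferInstanceAs (Field (AlgebraicClosure (RInf F)))

instance RInfAlgCl.algebra (F : Type*) [Field F] : Algebra (RInf F) (RInfAlgCl F) :=
  inferInstanceAs (Algebra (RInf F) (AlgebraicClosure (RInf F)))

instance RInfAlgCl.isAlgClosure (F : Type*) [Field F] : IsAlgClosure (RInf F) (RInfAlgCl F) :=
  inferInstanceAs (IsAlgClosure (RInf F) (AlgebraicClosure (RInf F)))

instance RInfAlgCl.isAlgebraic (F : Type*) [Field F] :
    Algebra.IsAlgebraic (RInf F) (RInfAlgCl F) :=
  IsAlgClosure.isAlgebraic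

/-- The unique extension of the absolute value of `F((1/θ))` to its algebraic closure. -/
instance RInfAlgCl.normedField (F : Type*) [Field F] [Fintype F] : NormedField (RInfAlgCl F) :=
  spectralNorm.normedField (RInf F) (RInfAlgCl F)

instance RInfAlgCl.normedAlgebra (F : Type*) [Field F] [Fintype F] :
    NormedAlgebra (RInf F) (RInfAlgCl F) :=
  spectralNorm.normedAlgebra (RInf F) (RInfAlgCl F)

/-- `C∞`, the completion of the algebraic closure of `F((1/θ))`. -/
def CInf (F : Type*) [Field F] [Fintype F] : Type _ := UniformSpace.Completion (RInfAlgCl F)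

section CInf

variable (F : Type*) [Field F] [Fintype F]

instance CInf.normedField : NormedField (CInf F) :=
  inferInstanceAs (NormedField (UniformSpace.Completion (RInfAlgCl F)))

instance CInf.completeSpace : CompleteSpace (CInf F) :=
  inferInstanceAs (CompleteSpace (UniformSpace.Completion (RInfAlgCl F)))

instance CInf.normedAlgebra : NormedAlgebra (RInf F) (CInf F) :=
  inferInstanceAs (NormedAlgebra (RInf F) (UniformSpace.Completion (RInfAlgCl F)))

instance CInf.algebra : Algebra F (CInf F) :=
  ((algebraMap (RInf F) (CInf F)).comp (HahnSeries.C : F →+* RInf F)).toAlgebra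

/-- The element `θ` of `C∞`. -/
def CInf.theta : CInf F := algebraMap (RInf F) (CInf F) (HahnSeries.single (-1) 1)

/-- The ring `F[θ]`, as a subring of `C∞`. -/
abbrev ZInf : Subalgebra F (CInf F) := Algebra.adjoin F {CInf.theta F}

/-- The `q`-Frobenius action on `C∞`, `q = #F`: the generator of `ℕ` acts by `x ↦ x ^ q`. -/
instance CInf.frobeniusAction : MulSemiringAction (Multiplicative ℕ) (CInf F) where
  smul k x := x ^ (Fintype.card F ^ k.toAdd)
  one_smul x := by
    change x ^ (Fintype.card F ^ 0) = x
    simp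
  mul_smul j k x := by
    change x ^ (Fintype.card F ^ (j.toAdd + k.toAdd))
      = (x ^ (Fintype.card F ^ k.toAdd)) ^ (Fintype.card F ^ j.toAdd)
    rw [← pow_mul, ← pow_add, add_comm]
  smul_zero k := by
    change (0 : CInf F) ^ (Fintype.card F ^ k.toAdd) = 0
    exact zero_pow (pow_ne_zero _ Fintype.card_ne_zero)
  smul_one k := one_pow _
  smul_add k x y := by
    change (x + y) ^ (Fintype.card F ^ k.toAdd)
      = x ^ (Fintype.card F ^ k.toAdd) + y ^ (Fintype.card F ^ k.toAdd)
    have h := map_add ((FiniteField.frobeniusAlgHom F (CInf F)) ^ k.toAdd) x y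
    simpa [AlgHom.coe_pow, FiniteField.coe_frobeniusAlgHom, pow_iterate] using h
  smul_mul k x y := mul_pow _ _ _

/-! ## T-motives -/

/-- The Anderson ring `C∞[T, τ]`: skew polynomials in `τ` over `C∞[T]`, where `τ` acts on the
coefficients in `C∞` as the `q`-Frobenius and fixes `T`. -/
def AndersonRing : Type _ := SkewPolynomial (Polynomial (CInf F))

instance AndersonRing.ring : Ring (AndersonRing F) :=
  inferInstanceAs (Ring (SkewPolynomial (Polynomial (CInf F))))

/-- The inclusion of `C∞` into the Anderson ring. -/
def AndersonRing.const : CInf F →+* AndersonRing F :=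
  (SkewPolynomial.CRingHom (R := Polynomial (CInf F))).comp Polynomial.C

/-- The element `T` of the Anderson ring. -/
def AndersonRing.T : AndersonRing F := SkewPolynomial.C (Polynomial.X : Polynomial (CInf F))

/-- The element `τ` of the Anderson ring. -/
def AndersonRing.tau : AndersonRing F := SkewPolynomial.X (R := Polynomial (CInf F))

theorem AndersonRing.T_mul_const (a : CInf F) :
    T F * const F a = const F a * T F := by
  have h : (SkewPolynomial.C Polynomial.X : SkewPolynomial (Polynomial (CInf F)))
      * SkewPolynomial.C (Polynomial.C a)
      = SkewPolynomial.C (Polynomial.C a) * SkewPolynomial.C Polynomial.X := by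
    rw [← SkewPolynomial.C_mul, ← SkewPolynomial.C_mul, mul_comm]
  exact h

theorem AndersonRing.T_mul_tau : T F * tau F = tau F * T F := by
  have h : (SkewPolynomial.C Polynomial.X : SkewPolynomial (Polynomial (CInf F)))
      * SkewPolynomial.X = SkewPolynomial.X * SkewPolynomial.C Polynomial.X := by
    simp only [SkewPolynomial.X, SkewPolynomial.C_mul_monomial, SkewPolynomial.monomial_mul_C]
    simp [SkewPolynomial.φ]
  exact h

theorem AndersonRing.tau_mul_const (a : CInf F) :
    tau F * const F a = const F (a ^ Fintype.card F) * tau F := by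
  have ha : (Multiplicative.ofAdd 1 : Multiplicative ℕ) • a = a ^ Fintype.card F := by
    change a ^ (Fintype.card F ^ 1) = _
    simp
  have h : (SkewPolynomial.X : SkewPolynomial (Polynomial (CInf F)))
      * SkewPolynomial.C (Polynomial.C a)
      = SkewPolynomial.C (Polynomial.C (a ^ Fintype.card F)) * SkewPolynomial.X := by
    simp only [SkewPolynomial.X, SkewPolynomial.C_mul_monomial, SkewPolynomial.monomial_mul_C]
    simp [SkewPolynomial.φ, Polynomial.smul_C, ha]
  exact h

/-- The subring `C∞[T]` of the Anderson ring. -/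
def AndersonRing.polyT : Subring (AndersonRing F) :=
  Subring.closure (Set.range (const F) ∪ {T F})

/-- The subring `C∞[τ]` of the Anderson ring. -/
def AndersonRing.polyTau : Subring (AndersonRing F) :=
  Subring.closure (Set.range (const F) ∪ {tau F})

/-- The left module `M` over the Anderson ring is a T-motive of dimension `n` and rank `r`. -/
structure IsTMotive (n r : ℕ) (M : Type*) [AddCommGroup M] [Module (AndersonRing F) M] :
    Prop where
  free_tau : Nonempty (Module.Basis (Fin n) (AndersonRing.polyTau F) M)
  free_T : Nonempty (Module.Basis (Fin r) (AndersonRing.polyT F) M)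
  /-- some power of `T - θ` annihilates `M / τM` -/
  nilpotent : ∃ m : ℕ, ∀ x : M, ∃ y : M,
    (AndersonRing.T F - AndersonRing.const F (CInf.theta F)) ^ m • x = AndersonRing.tau F • y

variable {F}

/-- The relation `T eᵢ - (θ eᵢ + ∑ⱼ Aᵢⱼ τ eⱼ + τ² eᵢ)` in the free module on `e₁, …, eₙ`. -/
def motiveRelation {n : ℕ} (A : Matrix (Fin n) (Fin n) (CInf F)) (i : Fin n) :
    Fin n → AndersonRing F :=
  Pi.single i (AndersonRing.T F)
    - (Pi.single i (AndersonRing.const F (CInf.theta F))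
      + ∑ j, Pi.single j (AndersonRing.const F (A i j) * AndersonRing.tau F)
      + Pi.single i (AndersonRing.tau F ^ 2))

/-- `M(A)`: the module over the Anderson ring with generators `e₁, …, eₙ` (the column `e`) and
the defining relations `T e = θ e + A τ e + τ² e`. -/
abbrev Motive {n : ℕ} (A : Matrix (Fin n) (Fin n) (CInf F)) : Type _ :=
  (Fin n → AndersonRing F) ⧸
    Submodule.span (AndersonRing F) (Set.range (motiveRelation A))

/-- The generators `e₁, …, eₙ` of `M(A)`. -/
def Motive.e {n : ℕ} (A : Matrix (Fin n) (Fin n) (CInf F)) (i : Fin n) : Motive A :=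
  Submodule.Quotient.mk (Pi.single i 1)

/-! ## The lattice of a T-motive -/

section Exponential

variable (F) (M : Type*) [AddCommGroup M] [Module (AndersonRing F) M]

/-- `E(M) = Hom_{C∞[τ]}(M, C∞)`, where `τ` acts on `C∞` as the `q`-Frobenius: the `C∞`-points of
the Anderson T-module of `M`. -/
def TPoints : AddSubgroup (M →+ CInf F) where
  carrier := {f | (∀ a m, f (AndersonRing.const F a • m) = a * f m) ∧
    ∀ m, f (AndersonRing.tau F • m) = f m ^ Fintype.card F}
  zero_mem' := ⟨by simp, by simp⟩
  add_mem' {f g} hf hg := by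
    refine ⟨fun a m => ?_, fun m => ?_⟩
    · simp [hf.1, hg.1, mul_add]
    · have h := map_add (FiniteField.frobeniusAlgHom F (CInf F)) (f m) (g m)
      simp only [FiniteField.coe_frobeniusAlgHom] at h
      simp [hf.2, hg.2, h]
  neg_mem' {f} hf := by
    refine ⟨fun a m => ?_, fun m => ?_⟩
    · simp [hf.1]
    · have h := map_neg (FiniteField.frobeniusAlgHom F (CInf F)) (f m)
      simp only [FiniteField.coe_frobeniusAlgHom] at h
      simp [hf.2, h]

/-- `Lie(M) = Hom_{C∞}(M / τM, C∞)`, the tangent space at `0` of the T-module `E(M)`. -/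
def TLie : Submodule (CInf F) (M →+ CInf F) where
  carrier := {f | (∀ a m, f (AndersonRing.const F a • m) = a * f m) ∧
    ∀ m, f (AndersonRing.tau F • m) = 0}
  zero_mem' := ⟨by simp, by simp⟩
  add_mem' {f g} hf hg :=
    ⟨fun a m => by simp [hf.1, hg.1, mul_add], fun m => by simp [hf.2, hg.2]⟩
  smul_mem' c f hf :=
    ⟨fun a m => by simp [hf.1, mul_left_comm], fun m => by simp [hf.2]⟩

variable {F} {M}

/-- The action of `T` on `E(M)`: `(T f)(m) = f (T m)`. -/
def TPoints.T (f : TPoints F M) : TPoints F M :=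
  ⟨(f : M →+ CInf F).comp (DistribSMul.toAddMonoidHom M (AndersonRing.T F)), by
    refine ⟨fun a m => ?_, fun m => ?_⟩
    · change f.1 (AndersonRing.T F • AndersonRing.const F a • m) = a * f.1 (AndersonRing.T F • m)
      rw [← mul_smul, AndersonRing.T_mul_const, mul_smul, f.2.1]
    · change f.1 (AndersonRing.T F • AndersonRing.tau F • m) = f.1 (AndersonRing.T F • m) ^ Fintype.card F
      rw [← mul_smul, AndersonRing.T_mul_tau, mul_smul, f.2.2]⟩

/-- The action of `T` on `Lie(M)`: `(T f)(m) = f (T m)`. -/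
def TLie.T (f : TLie F M) : TLie F M :=
  ⟨(f : M →+ CInf F).comp (DistribSMul.toAddMonoidHom M (AndersonRing.T F)), by
    refine ⟨fun a m => ?_, fun m => ?_⟩
    · change f.1 (AndersonRing.T F • AndersonRing.const F a • m) = a * f.1 (AndersonRing.T F • m)
      rw [← mul_smul, AndersonRing.T_mul_const, mul_smul, f.2.1]
    · change f.1 (AndersonRing.T F • AndersonRing.tau F • m) = 0
      rw [← mul_smul, AndersonRing.T_mul_tau, mul_smul, f.2.2]⟩

/-- `Exp : Lie(M) → E(M)` is the exponential map of `M`: it commutes with `T` and, in the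
coordinates `z ↦ (z(e₁), …, z(eₙ))` on `Lie(M)` and `E(M)` given by a `C∞[τ]`-basis `e` of `M`, it
is an everywhere convergent series `z ↦ ∑ₖ Cₖ z^(k)` with `C₀ = 1`, where `z^(k)` is `z` with all
coordinates raised to the power `q ^ k`. -/
structure IsExponential {n : ℕ} (e : Fin n → M) (Exp : TLie F M → TPoints F M) : Prop where
  series : ∃ C : ℕ → Matrix (Fin n) (Fin n) (CInf F), C 0 = 1 ∧ ∀ (z : TLie F M) (i : Fin n),
    HasSum (fun k : ℕ => ∑ j, C k i j * (z : M →+ CInf F) (e j) ^ (Fintype.card F ^ k))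
      ((Exp z : M →+ CInf F) (e i))
  equivariant : ∀ z : TLie F M, Exp (TLie.T z) = TPoints.T (Exp z)

/-- The lattice of `M`, that is the kernel of the exponential map of `M`, in the coordinates on
`Lie(M)` given by a `C∞[τ]`-basis `e` of `M`. -/
def tLattice {n : ℕ} (e : Fin n → M) : Set (Fin n → CInf F) :=
  {v | ∃ Exp : TLie F M → TPoints F M, IsExponential e Exp ∧
    ∃ z : TLie F M, (∀ i, (z : M →+ CInf F) (e i) = v i) ∧ Exp z = 0}

end Exponential

/-- The lattice of `M(A)`, in the coordinates given by the generators `e₁, …, eₙ`. -/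
def motiveLattice {n : ℕ} (A : Matrix (Fin n) (Fin n) (CInf F)) : Set (Fin n → CInf F) :=
  tLattice (Motive.e A)

/-! ## Lattices and Siegel matrices -/

/-- The vectors `b` form an `F[θ]`-basis of `L`. -/
def IsZBasis {n : ℕ} {ι : Type*} (b : ι → Fin n → CInf F) (L : Set (Fin n → CInf F)) : Prop :=
  LinearIndependent (ZInf F) b ∧
    (Submodule.span (ZInf F) (Set.range b) : Set (Fin n → CInf F)) = L

/-- `L` is a lattice of rank `r` in `C∞ⁿ`: a free `F[θ]`-submodule of rank `r` which generates
`C∞ⁿ` over `C∞` and whose `F((1/θ))`-linear envelope has dimension `r` over `F((1/θ))`. -/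
structure IsLattice {n : ℕ} (r : ℕ) (L : Set (Fin n → CInf F)) : Prop where
  free : ∃ b : Fin r → Fin n → CInf F, IsZBasis b L
  span_eq_top : Submodule.span (CInf F) L = ⊤
  finrank_envelope : Module.finrank (RInf F) (Submodule.span (RInf F) L) = r

/-- Two lattices agree up to a `C∞`-linear automorphism of the ambient space. -/
def LatticeEquiv {n : ℕ} (L L' : Set (Fin n → CInf F)) : Prop :=
  ∃ g : (Fin n → CInf F) ≃ₗ[CInf F] (Fin n → CInf F), g '' L = L'

/-- `Z` is the Siegel matrix of the family `b` (with `b (inl i)` the first `n` vectors and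
`b (inr i)` the last `n`): the first `n` vectors are a `C∞`-basis of `C∞ⁿ`, and the rows of `Z`
are the coordinates of the last `n` vectors in that basis. -/
def IsSiegelMatrixOf {n : ℕ} (b : Fin n ⊕ Fin n → Fin n → CInf F)
    (Z : Matrix (Fin n) (Fin n) (CInf F)) : Prop :=
  LinearIndependent (CInf F) (fun i => b (Sum.inl i)) ∧
    Submodule.span (CInf F) (Set.range fun i => b (Sum.inl i)) = ⊤ ∧
    ∀ i, b (Sum.inr i) = ∑ j, Z i j • b (Sum.inl j)

/-- The set of `n × n` Siegel matrices, i.e. of Siegel matrices of bases of lattices of rank `2n`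
in `C∞ⁿ`. -/
def siegelMatrices (F : Type*) [Field F] [Fintype F] (n : ℕ) :
    Set (Matrix (Fin n) (Fin n) (CInf F)) :=
  {Z | ∃ (L : Set (Fin n → CInf F)) (b : Fin n ⊕ Fin n → Fin n → CInf F),
    IsLattice (2 * n) L ∧ IsZBasis b L ∧ IsSiegelMatrixOf b Z}

/-- The standard basis vectors of `C∞ⁿ`, followed by the rows of `Z`. -/
def siegelBasis {n : ℕ} (Z : Matrix (Fin n) (Fin n) (CInf F)) :
    Fin n ⊕ Fin n → Fin n → CInf F :=
  Sum.elim (fun i => Pi.single i 1) (fun i => Z i)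

/-- The lattice `𝔏(Z)` corresponding to the Siegel matrix `Z`. -/
def siegelLattice {n : ℕ} (Z : Matrix (Fin n) (Fin n) (CInf F)) : Set (Fin n → CInf F) :=
  Submodule.span (ZInf F) (Set.range (siegelBasis Z))

/-- The lattice of `M(A)` in the coordinates of `C∞ⁿ` rescaled by `y`. -/
def scaledMotiveLattice {n : ℕ} (y : CInf F) (A : Matrix (Fin n) (Fin n) (CInf F)) :
    Set (Fin n → CInf F) :=
  {v | y • v ∈ motiveLattice A}

/-- Rescaling by the number `y ≠ 0` identifies the lattice of `M(0)` with `L₀ = 𝔏(ω Eₙ)`. -/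
def IsNormalization (n : ℕ) (ω y : CInf F) : Prop :=
  y ≠ 0 ∧ scaledMotiveLattice y (0 : Matrix (Fin n) (Fin n) (CInf F))
    = siegelLattice (ω • (1 : Matrix (Fin n) (Fin n) (CInf F)))

end CInf

end

noncomputable section

/-! ## Facts about `C∞` -/

namespace CInf

variable {F : Type*} [Field F] [Fintype F]

/-! Write q for the number of elements of F, t = q^(1/(q²-1)) for the absolute value of the nonzero
solutions of θx + x^(q²) = 0 (`torsionRadius`), and R = qt (`periodRadius`).

`M(A)` has C∞[τ]-basis e, and C∞[T]-basis e, τe because τ²e = (T - θ)e - Aτe. Independence is a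
degree descent on the multipliers of the defining relations, in T for the first basis and in τ for
the second.

The coefficients of the exponential satisfy (θ^(q^k) - θ)C_k = A C_{k-1}^(1) + C_{k-2}^(2). When the
entries of A have absolute value at most 1, this recursion bounds C_k independently of A. On every
ball of radius less than R, Exp is then the identity plus a contraction, so it preserves norms and
is onto the open ball of radius R (`norm_expMap`, `exists_expMap_eq`). In particular there are no
nonzero periods shorter than R. If the entries of A are bounded by ε ≤ 1, then Exp_A and Exp_0
differ by at most ε‖z‖ on the closed ball of radius R (`norm_expMap_sub_expMap_zero_le`). Since the
lattice is defined through any exponential, uniqueness of Exp is also needed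
(`isExponential_apply`).

Periods of length at most R generate the whole lattice over F[θ] (`mem_of_expMap_eq_zero`). If v is
a period, Exp(v/θ) is a T-torsion point, hence has a logarithm w of length at most t. Then θw is a
period of length at most R, and v/θ - w is a period that is shorter than v as long as ‖v‖ > R.

For A = 0 the exponential is coordinatewise and linear over the field with q² elements, and the
T-torsion in each coordinate is a line over that field. This gives L(M(0)) = yL₀ with |y| = R
(`exists_normalization`).

For maxNorm A = ε < 1 the lattice is a perturbation of this one. Each period y l_{0,i} of `M(0)` is
corrected by a vector of length at most εR to a period of `M(A)` (`exists_near_basis`). The vectors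
l_{0,i} are orthonormal over R∞ in the nonarchimedean sense, and this survives perturbations smaller
than 1. Hence the corrected vectors are independent, they have a Siegel matrix close to ωE_n, and
comparison of short periods shows that they generate the lattice (`expKer_eq_span`). Two periods in
the same ball of radius 1, after division by y, differ by a period shorter than R and so coincide.
-/

instance isUltrametricDist : IsUltrametricDist (CInf F) :=
  IsUltrametricDist.of_normedAlgebra (RInf F)

theorem add_pow_card_pow (x y : CInf F) (k : ℕ) :
    (x + y) ^ (Fintype.card F ^ k) = x ^ (Fintype.card F ^ k) + y ^ (Fintype.card F ^ k) :=
  smul_add (Multiplicative.ofAdd k) x y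

/-- The `k`-th power of the `q`-Frobenius of `C∞`. -/
def frob (k : ℕ) : CInf F →+* CInf F :=
  MulSemiringAction.toRingHom (Multiplicative ℕ) (CInf F) (Multiplicative.ofAdd k)

theorem frob_apply (k : ℕ) (x : CInf F) : frob k x = x ^ (Fintype.card F ^ k) := rfl

theorem algebraMap_eq (a : F) :
    algebraMap F (CInf F) a = algebraMap (RInf F) (CInf F) (HahnSeries.C a) := rfl

theorem card_ge_two : 2 ≤ Fintype.card F := Fintype.one_lt_card

theorem norm_eq_one_of_pow_eq_self {x : CInf F} {m : ℕ} (hm : 2 ≤ m) (hx : x ^ m = x)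
    (h0 : x ≠ 0) : ‖x‖ = 1 := by
  have h2 := congrArg norm hx
  rw [norm_pow] at h2
  rcases lt_trichotomy ‖x‖ 1 with h | h | h
  · exact absurd h2 (ne_of_lt (pow_lt_self_of_lt_one₀ (norm_pos_iff.2 h0) h hm))
  · exact h
  · exact absurd h2 (ne_of_gt (lt_self_pow₀ h hm))

theorem norm_theta : ‖theta F‖ = Fintype.card F := by
  rw [theta, norm_algebraMap', Valued.toNormedField.norm_def]
  have h : (Valued.v (HahnSeries.single (-1) 1 : RInf F)) = WithZero.exp 1 :=
    LaurentSeries.valuation_single_zpow F (-1)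
  change ((WithZeroMulInt.toNNReal (e := (Fintype.card F : NNReal)) (by simp)
    (MonoidWithZeroHom.ValueGroup₀.embedding _) : NNReal) : ℝ) = _
  rw [Valuation.embedding_restrict, h]
  rw [WithZeroMulInt.toNNReal_neg_apply _ WithZero.exp_ne_zero]
  change (((Fintype.card F : NNReal) ^ (1 : ℤ) : NNReal) : ℝ) = _
  simp

theorem one_lt_norm_theta : 1 < ‖theta F‖ := by
  rw [norm_theta]; exact_mod_cast card_ge_two

theorem theta_ne_zero : theta F ≠ 0 := norm_pos_iff.1 (by linarith [one_lt_norm_theta (F := F)])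

/-- The residue field of F((1/θ)) is F, and the constant term is the residue. -/
theorem exists_const_norm_sub_lt_one (a : RInf F) (ha : ‖a‖ ≤ 1) :
    ∃ c : F, ‖a - HahnSeries.C c‖ < 1 := by
  refine ⟨a.coeff 0, ?_⟩
  rw [Valued.toNormedField.norm_le_one_iff] at ha
  rw [Valued.toNormedField.norm_lt_one_iff]
  refine lt_of_le_of_lt (b := WithZero.exp (-1 : ℤ)) ?_ ?_
  · rw [LaurentSeries.valuation_le_iff_coeff_lt_eq_zero]
    intro n hn
    rcases (Int.lt_add_one_iff.1 (by simpa using hn) : n ≤ 0).lt_or_eq with h | rfl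
    · have := (LaurentSeries.valuation_le_iff_coeff_lt_eq_zero F (D := 0)).1 (by simpa using ha) n h
      simp [this, HahnSeries.C_apply, h.ne]
    · simp
  · rw [← WithZero.exp_zero]
    exact WithZero.exp_lt_exp.2 (by norm_num)

/-! ### Constants of the quadratic extension and orthogonality of 1, ω -/

section Omega

variable {ω : CInf F}

theorem norm_omega (hω : ω ^ (Fintype.card F ^ 2) = ω) (hω' : ω ^ Fintype.card F ≠ ω) :
    ‖ω‖ = 1 := by
  refine norm_eq_one_of_pow_eq_self ?_ hω ?_
  · exact (card_ge_two (F := F)).trans (Nat.le_self_pow (by norm_num) _)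
  · rintro rfl
    exact hω' (zero_pow Fintype.card_ne_zero)

theorem omega_ne_algebraMap (hω' : ω ^ Fintype.card F ≠ ω) (c : F) : algebraMap F _ c ≠ ω := by
  rintro rfl
  exact hω' (by rw [← map_pow, FiniteField.pow_card])

theorem algebraMap_add_mul_omega_pow (hω : ω ^ (Fintype.card F ^ 2) = ω) (a b : F) :
    (algebraMap F _ a + algebraMap F _ b * ω) ^ (Fintype.card F ^ 2)
      = algebraMap F _ a + algebraMap F _ b * ω := by
  rw [add_pow_card_pow, mul_pow, hω, ← map_pow, ← map_pow, FiniteField.pow_card_pow,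
    FiniteField.pow_card_pow]

theorem norm_algebraMap_add_omega (hω : ω ^ (Fintype.card F ^ 2) = ω)
    (hω' : ω ^ Fintype.card F ≠ ω) (c : F) : ‖algebraMap F _ c + ω‖ = 1 := by
  refine norm_eq_one_of_pow_eq_self (m := Fintype.card F ^ 2) ?_ ?_ ?_
  · exact (card_ge_two (F := F)).trans (Nat.le_self_pow (by norm_num) _)
  · simpa using algebraMap_add_mul_omega_pow hω c 1
  · intro h
    refine omega_ne_algebraMap hω' (-c) ?_
    rw [map_neg]
    exact (eq_neg_of_add_eq_zero_right h).symm

/-- Modulo elements of absolute value less than 1, a is a constant c in F. The sum c + ω is fixed by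
x ↦ x^(q²) and is nonzero because ω is not in F, so it has absolute value 1. -/
theorem norm_add_omega (hω : ω ^ (Fintype.card F ^ 2) = ω) (hω' : ω ^ Fintype.card F ≠ ω)
    (a : RInf F) (ha : ‖a‖ ≤ 1) : ‖algebraMap _ _ a + ω‖ = 1 := by
  obtain ⟨c, hc⟩ := exists_const_norm_sub_lt_one a ha
  have h1 : algebraMap _ _ a + ω
      = (algebraMap F (CInf F) c + ω) + algebraMap (RInf F) _ (a - HahnSeries.C c) := by
    rw [map_sub, algebraMap_eq]; ring
  have h2 := norm_algebraMap_add_omega hω hω' c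
  rw [h1, IsUltrametricDist.norm_add_eq_max_of_norm_ne_norm, h2, norm_algebraMap', max_eq_left hc.le]
  rw [h2, norm_algebraMap']
  exact hc.ne'

/-- `1, ω` is an orthogonal system over `F((1/θ))`. -/
theorem norm_add_mul_omega (hω : ω ^ (Fintype.card F ^ 2) = ω) (hω' : ω ^ Fintype.card F ≠ ω)
    (a b : RInf F) :
    ‖algebraMap _ _ a + algebraMap _ _ b * ω‖ = max ‖a‖ ‖b‖ := by
  rcases lt_or_ge ‖b‖ ‖a‖ with h | h
  · have h3 : ‖algebraMap (RInf F) (CInf F) b * ω‖ = ‖b‖ := by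
      rw [norm_mul, norm_omega hω hω', norm_algebraMap', mul_one]
    rw [IsUltrametricDist.norm_add_eq_max_of_norm_ne_norm, h3, norm_algebraMap']
    rw [h3, norm_algebraMap']
    exact h.ne'
  -- No strict inequality is available here, so b is factored out and a/b, of absolute value at most
  -- 1, is compared with ω.
  · rcases eq_or_ne b 0 with rfl | hb
    · simp at h
      simp [h]
    · have hb' : algebraMap (RInf F) (CInf F) b ≠ 0 := by simpa using hb
      have h1 : algebraMap (RInf F) (CInf F) a + algebraMap _ _ b * ω
          = algebraMap _ _ b * (algebraMap _ _ (a / b) + ω) := by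
        rw [map_div₀]; field_simp
      rw [h1, norm_mul, norm_add_omega hω hω', norm_algebraMap', max_eq_right h, mul_one]
      rw [norm_div]
      exact div_le_one_of_le₀ h (norm_nonneg _)

/-- The elements `a + b ω` with `a, b ∈ F` are the elements of the field with `q²` elements. -/
theorem exists_eq_add_mul_omega (hω : ω ^ (Fintype.card F ^ 2) = ω)
    (hω' : ω ^ Fintype.card F ≠ ω) {x : CInf F} (hx : x ^ (Fintype.card F ^ 2) = x) :
    ∃ a b : F, x = algebraMap F _ a + algebraMap F _ b * ω := by
  classical
  have hq : 1 < Fintype.card F ^ 2 := Nat.one_lt_pow (by norm_num) Fintype.one_lt_card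
  -- Counting: P has at most q² roots, and the q² elements a + bω are distinct roots, so they are
  -- all of them.
  set P : Polynomial (CInf F) := Polynomial.X ^ (Fintype.card F ^ 2) - Polynomial.X with hP
  have hP0 : P ≠ 0 := FiniteField.X_pow_card_sub_X_ne_zero _ hq
  have hdeg : P.natDegree = Fintype.card F ^ 2 := FiniteField.X_pow_card_sub_X_natDegree_eq _ hq
  have hroot : ∀ z : CInf F, z ∈ P.roots.toFinset ↔ z ^ (Fintype.card F ^ 2) = z := by
    intro z
    rw [Multiset.mem_toFinset, Polynomial.mem_roots hP0]
    simp [hP, Polynomial.IsRoot, sub_eq_zero]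
  set f : F × F → CInf F := fun p => algebraMap F _ p.1 + algebraMap F _ p.2 * ω with hf
  have hinj : Function.Injective f := by
    rintro ⟨a, b⟩ ⟨a', b'⟩ h
    simp only [hf] at h
    by_cases hb : b = b'
    · subst hb
      simpa using h
    · exfalso
      refine omega_ne_algebraMap hω' ((a' - a) / (b - b')) ?_
      have hb' : algebraMap F (CInf F) b - algebraMap F (CInf F) b' ≠ 0 := by
        rw [sub_ne_zero]
        exact fun h => hb ((algebraMap F (CInf F)).injective h)
      rw [map_div₀, map_sub, map_sub, div_eq_iff hb']
      linear_combination -h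
  have hsub : Finset.univ.image f ⊆ P.roots.toFinset := by
    intro z hz
    obtain ⟨p, -, rfl⟩ := Finset.mem_image.1 hz
    exact (hroot _).2 (algebraMap_add_mul_omega_pow hω _ _)
  have hcard : P.roots.toFinset.card ≤ (Finset.univ.image f).card := by
    rw [Finset.card_image_of_injective _ hinj, Finset.card_univ, Fintype.card_prod, ← sq, ← hdeg]
    exact (Multiset.toFinset_card_le _).trans (Polynomial.card_roots' P)
  have := (Finset.eq_of_subset_of_card_le hsub hcard).symm ▸ (hroot x).2 hx
  obtain ⟨p, -, rfl⟩ := Finset.mem_image.1 this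
  exact ⟨p.1, p.2, rfl⟩

end Omega

/-! ### Roots in C∞ obtained from the dense algebraically closed subfield -/

instance isAlgClosed_algCl : IsAlgClosed (RInfAlgCl F) := IsAlgClosure.isAlgClosed (RInf F)

variable (F) in
/-- The embedding of the algebraic closure of `F((1/θ))` into its completion. -/
def ofAlgCl : RInfAlgCl F →+* CInf F := UniformSpace.Completion.coeRingHom

theorem denseRange_ofAlgCl : DenseRange (ofAlgCl F) := UniformSpace.Completion.denseRange_coe

theorem ofAlgCl_algebraMap (a : RInf F) :
    ofAlgCl F (algebraMap _ _ a) = algebraMap (RInf F) (CInf F) a := rfl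

theorem exists_pow_eq_neg_theta : ∃ x : CInf F, x ^ (Fintype.card F ^ 2 - 1) = -theta F := by
  have hq : 1 < Fintype.card F ^ 2 := Nat.one_lt_pow (by norm_num) Fintype.one_lt_card
  obtain ⟨z, hz⟩ := IsAlgClosed.exists_pow_nat_eq
    (-algebraMap (RInf F) (RInfAlgCl F) (HahnSeries.single (-1) 1))
    (n := Fintype.card F ^ 2 - 1) (by omega)
  refine ⟨ofAlgCl F z, ?_⟩
  rw [← map_pow, hz, map_neg, ofAlgCl_algebraMap, theta]

theorem norm_sub_pow_card (x y : CInf F) :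
    ‖x - y‖ ^ Fintype.card F = ‖x ^ Fintype.card F - y ^ Fintype.card F‖ := by
  have := map_sub (frob (F := F) 1) x y
  simp only [frob_apply, pow_one] at this
  rw [← this, norm_pow]

/-- `C∞` is perfect. -/
theorem exists_pow_card_eq (x : CInf F) : ∃ y : CInf F, y ^ Fintype.card F = x := by
  have hx : x ∈ closure (Set.range (ofAlgCl F)) := denseRange_ofAlgCl x
  obtain ⟨u, hu, hlim⟩ := mem_closure_iff_seq_limit.1 hx
  have hroot : ∀ k, ∃ w : CInf F, w ^ Fintype.card F = u k := by
    intro k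
    obtain ⟨z, hz⟩ := hu k
    obtain ⟨w, hw⟩ := IsAlgClosed.exists_pow_nat_eq z (n := Fintype.card F) Fintype.card_pos
    exact ⟨ofAlgCl F w, by rw [← map_pow, hw, hz]⟩
  choose w hw using hroot
  -- The roots inherit the Cauchy property from u because |x - y|^q = |x^q - y^q|.
  have hcau : CauchySeq w := by
    rw [Metric.cauchySeq_iff]
    intro ε hε
    obtain ⟨N, hN⟩ := Metric.cauchySeq_iff.1 hlim.cauchySeq (ε ^ Fintype.card F) (by positivity)
    refine ⟨N, fun m hm k hk => ?_⟩
    have := hN m hm k hk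
    rw [dist_eq_norm, ← hw, ← hw, ← norm_sub_pow_card] at this
    rw [dist_eq_norm]
    exact lt_of_pow_lt_pow_left₀ _ hε.le this
  obtain ⟨y, hy⟩ := cauchySeq_tendsto_of_complete hcau
  refine ⟨y, tendsto_nhds_unique ?_ hlim⟩
  have := hy.pow (Fintype.card F)
  simpa only [hw] using this

end CInf


/-! ## The Anderson ring -/

namespace AndersonRing

variable {F : Type*} [Field F] [Fintype F]

theorem const_mul_T_pow_mul_tau_pow (c : CInf F) (j k : ℕ) :
    const F c * T F ^ j * tau F ^ k
      = SkewPolynomial.monomial k (Polynomial.monomial j c) := by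
  have h : SkewPolynomial.C (Polynomial.C c) * (SkewPolynomial.C Polynomial.X) ^ j
      * SkewPolynomial.X ^ k = SkewPolynomial.monomial k (Polynomial.monomial j c) := by
    rw [← SkewPolynomial.C_pow, ← SkewPolynomial.C_mul, SkewPolynomial.C_mul_X_pow_eq_monomial,
      Polynomial.C_mul_X_pow_eq_monomial]
  exact h

/-- Monomials generate the ring additively. The rules for `pairing` and `coeff` are all reduced to
monomials in this way. -/
theorem addHom_ext {N : Type*} [AddCommGroup N] {f g : AndersonRing F →+ N}
    (h : ∀ c j k, f (const F c * T F ^ j * tau F ^ k) = g (const F c * T F ^ j * tau F ^ k)) :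
    f = g := by
  refine SkewMonoidAlgebra.addHom_ext fun k p => ?_
  induction p using Polynomial.induction_on' with
  | add p p' hp hp' =>
    rw [SkewMonoidAlgebra.single_add]
    exact (f.map_add _ _).trans ((congrArg₂ _ hp hp').trans (g.map_add _ _).symm)
  | monomial j c =>
    have := h c j k.toAdd
    rw [const_mul_T_pow_mul_tau_pow] at this
    exact this

/-- The pairing of an element `∑ cⱼₖ Tʲ τᵏ` of the Anderson ring with a family `w`, that is
`∑ cⱼₖ wⱼₖ`. -/
def pairing (w : ℕ → ℕ → CInf F) : AndersonRing F →+ CInf F :=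
  (Finsupp.liftAddHom fun k : Multiplicative ℕ =>
    (Polynomial.lsum (R := CInf F) fun j => LinearMap.mulRight (CInf F) (w j k.toAdd)).toAddMonoidHom).comp
    (SkewMonoidAlgebra.coeffAddEquiv (k := Polynomial (CInf F)) (G := Multiplicative ℕ)).toAddMonoidHom

theorem pairing_mono (w : ℕ → ℕ → CInf F) (c : CInf F) (j k : ℕ) :
    pairing w (const F c * T F ^ j * tau F ^ k) = c * w j k := by
  rw [const_mul_T_pow_mul_tau_pow]
  change Finsupp.liftAddHom _ (Finsupp.single _ _) = _
  rw [Finsupp.liftAddHom_apply_single]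
  simp [Polynomial.lsum_apply, Polynomial.sum_monomial_index]

theorem tau_pow_mul_const (a : CInf F) (k : ℕ) :
    tau F ^ k * const F a = const F (a ^ (Fintype.card F ^ k)) * tau F ^ k := by
  induction k generalizing a with
  | zero => simp
  | succ k ih =>
    rw [pow_succ, mul_assoc, tau_mul_const, ← mul_assoc, ih, mul_assoc, ← pow_mul, ← pow_succ']

theorem commute_T_const (a : CInf F) : Commute (T F) (const F a) := T_mul_const F a

theorem commute_T_tau : Commute (T F) (tau F) := T_mul_tau F

theorem mono_mul_T (c : CInf F) (j k : ℕ) :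
    const F c * T F ^ j * tau F ^ k * T F = const F c * T F ^ (j + 1) * tau F ^ k := by
  rw [mul_assoc, ← (commute_T_tau.pow_right k).eq, ← mul_assoc, mul_assoc (const F c), ← pow_succ]

theorem mono_mul_const (c a : CInf F) (j k : ℕ) :
    const F c * T F ^ j * tau F ^ k * const F a
      = const F (c * a ^ (Fintype.card F ^ k)) * T F ^ j * tau F ^ k := by
  rw [mul_assoc, tau_pow_mul_const, ← mul_assoc, mul_assoc (const F c),
    ((commute_T_const _).pow_left j).eq, ← mul_assoc, ← map_mul]

theorem mono_mul_tau (c : CInf F) (j k : ℕ) :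
    const F c * T F ^ j * tau F ^ k * tau F = const F c * T F ^ j * tau F ^ (k + 1) := by
  rw [mul_assoc, ← pow_succ]

theorem const_mul_mono (a c : CInf F) (j k : ℕ) :
    const F a * (const F c * T F ^ j * tau F ^ k) = const F (a * c) * T F ^ j * tau F ^ k := by
  simp only [map_mul, mul_assoc]

theorem tau_mul_mono (c : CInf F) (j k : ℕ) :
    tau F * (const F c * T F ^ j * tau F ^ k)
      = const F (c ^ Fintype.card F) * T F ^ j * tau F ^ (k + 1) := by
  rw [mul_assoc, ← mul_assoc, tau_mul_const, mul_assoc, ← mul_assoc (tau F),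
    ← (commute_T_tau.pow_left j).eq, mul_assoc, ← pow_succ', mul_assoc]

theorem pairing_mul_T (w : ℕ → ℕ → CInf F) (r : AndersonRing F) :
    pairing w (r * T F) = pairing (fun j k => w (j + 1) k) r := by
  have : (pairing w).comp (AddMonoidHom.mulRight (T F)) = pairing (fun j k => w (j + 1) k) :=
    addHom_ext fun c j k => by simp [mono_mul_T, pairing_mono]
  exact DFunLike.congr_fun this r

theorem pairing_mul_tau (w : ℕ → ℕ → CInf F) (r : AndersonRing F) :
    pairing w (r * tau F) = pairing (fun j k => w j (k + 1)) r := by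
  have : (pairing w).comp (AddMonoidHom.mulRight (tau F)) = pairing (fun j k => w j (k + 1)) :=
    addHom_ext fun c j k => by simp [mono_mul_tau, pairing_mono]
  exact DFunLike.congr_fun this r

theorem pairing_mul_const (w : ℕ → ℕ → CInf F) (a : CInf F) (r : AndersonRing F) :
    pairing w (r * const F a) = pairing (fun j k => a ^ (Fintype.card F ^ k) * w j k) r := by
  have : (pairing w).comp (AddMonoidHom.mulRight (const F a))
      = pairing (fun j k => a ^ (Fintype.card F ^ k) * w j k) :=
    addHom_ext fun c j k => by
      rw [AddMonoidHom.comp_apply, AddMonoidHom.mulRight_apply, mono_mul_const, pairing_mono,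
        pairing_mono, mul_assoc]
  exact DFunLike.congr_fun this r

theorem pairing_const_mul (w : ℕ → ℕ → CInf F) (a : CInf F) (r : AndersonRing F) :
    pairing w (const F a * r) = a * pairing w r := by
  have : (pairing w).comp (AddMonoidHom.mulLeft (const F a))
      = (AddMonoidHom.mulLeft a).comp (pairing w) :=
    addHom_ext fun c j k => by
      rw [AddMonoidHom.comp_apply, AddMonoidHom.coe_mulLeft, const_mul_mono, pairing_mono,
        AddMonoidHom.comp_apply, pairing_mono, AddMonoidHom.coe_mulLeft, mul_assoc]
  exact DFunLike.congr_fun this r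

/-- Frobenius-compatible families of values are those that give points of E(M). -/
theorem pairing_tau_mul {w : ℕ → ℕ → CInf F} (hw : ∀ j k, w j (k + 1) = w j k ^ Fintype.card F)
    (r : AndersonRing F) : pairing w (tau F * r) = pairing w r ^ Fintype.card F := by
  have : (pairing w).comp (AddMonoidHom.mulLeft (tau F))
      = (CInf.frob (F := F) 1).toAddMonoidHom.comp (pairing w) :=
    addHom_ext fun c j k => by
      rw [AddMonoidHom.comp_apply, AddMonoidHom.coe_mulLeft, tau_mul_mono, pairing_mono, hw,
        AddMonoidHom.comp_apply, pairing_mono]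
      simp [CInf.frob_apply, mul_pow]
  simpa [CInf.frob_apply] using DFunLike.congr_fun this r

/-- The counterpart for Lie(M), whose elements kill τM. -/
theorem pairing_tau_mul_of_zero {w : ℕ → ℕ → CInf F} (hw : ∀ j k, w j (k + 1) = 0)
    (r : AndersonRing F) : pairing w (tau F * r) = 0 := by
  have : (pairing w).comp (AddMonoidHom.mulLeft (tau F)) = 0 :=
    addHom_ext fun c j k => by
      rw [AddMonoidHom.comp_apply, AddMonoidHom.coe_mulLeft, tau_mul_mono, pairing_mono, hw,
        mul_zero, AddMonoidHom.zero_apply]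
  exact DFunLike.congr_fun this r

theorem pairing_add (w w' : ℕ → ℕ → CInf F) (r : AndersonRing F) :
    pairing (fun j k => w j k + w' j k) r = pairing w r + pairing w' r := by
  have : pairing (fun j k => w j k + w' j k) = pairing w + pairing w' :=
    addHom_ext fun c j k => by simp [pairing_mono, mul_add]
  exact DFunLike.congr_fun this r

theorem pairing_const_mul_family (a : CInf F) (w : ℕ → ℕ → CInf F) (r : AndersonRing F) :
    pairing (fun j k => a * w j k) r = a * pairing w r := by
  have : pairing (fun j k => a * w j k) = (AddMonoidHom.mulLeft a).comp (pairing w) :=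
    addHom_ext fun c j k => by simp [pairing_mono, mul_left_comm]
  exact DFunLike.congr_fun this r

theorem pairing_sum {ι : Type*} (s : Finset ι) (w : ι → ℕ → ℕ → CInf F) (r : AndersonRing F) :
    pairing (fun j k => ∑ i ∈ s, w i j k) r = ∑ i ∈ s, pairing (w i) r := by
  have : pairing (fun j k => ∑ i ∈ s, w i j k) = ∑ i ∈ s, pairing (w i) :=
    addHom_ext fun c j k => by simp [pairing_mono, Finset.mul_sum]
  simpa using DFunLike.congr_fun this r

theorem pairing_zero (r : AndersonRing F) : pairing (fun _ _ => (0 : CInf F)) r = 0 := by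
  have : pairing (fun _ _ => (0 : CInf F)) = 0 :=
    addHom_ext fun c j k => by simp [pairing_mono]
  exact DFunLike.congr_fun this r

/-- The coefficient of `Tʲ τᵏ`. -/
def coeff (j k : ℕ) : AndersonRing F →+ CInf F :=
  pairing fun j' k' => if j' = j ∧ k' = k then 1 else 0

theorem coeff_mono (c : CInf F) (j k j' k' : ℕ) :
    coeff j k (const F c * T F ^ j' * tau F ^ k') = if j' = j ∧ k' = k then c else 0 := by
  simp [coeff, pairing_mono]

theorem coeff_mul_T (j k : ℕ) (r : AndersonRing F) : coeff (j + 1) k (r * T F) = coeff j k r := by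
  simp [coeff, pairing_mul_T]

theorem coeff_mul_tau (j k : ℕ) (r : AndersonRing F) :
    coeff j (k + 1) (r * tau F) = coeff j k r := by
  simp [coeff, pairing_mul_tau]

theorem coeff_zero_mul_tau (j : ℕ) (r : AndersonRing F) : coeff j 0 (r * tau F) = 0 := by
  simp [coeff, pairing_mul_tau, pairing_zero]

theorem coeff_zero_mul_T (k : ℕ) (r : AndersonRing F) : coeff 0 k (r * T F) = 0 := by
  simp [coeff, pairing_mul_T, pairing_zero]

theorem coeff_mul_const (j k : ℕ) (r : AndersonRing F) (a : CInf F) :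
    coeff j k (r * const F a) = a ^ (Fintype.card F ^ k) * coeff j k r := by
  rw [coeff, pairing_mul_const, ← pairing_const_mul_family]
  congr 2
  funext j' k'
  by_cases h : j' = j ∧ k' = k
  · simp [h]
  · simp [h]

theorem coeff_eq (j k : ℕ) (r : AndersonRing F) :
    coeff j k r = (SkewPolynomial.coeff r k).coeff j := by
  let f : AndersonRing F →+ CInf F :=
    (Polynomial.lcoeff (CInf F) j).toAddMonoidHom.comp
      ((Finsupp.applyAddHom (Multiplicative.ofAdd k)).comp
        (SkewMonoidAlgebra.coeffAddEquiv (k := Polynomial (CInf F))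
          (G := Multiplicative ℕ)).toAddMonoidHom)
  have : coeff j k = f := addHom_ext fun c j' k' => by
    rw [coeff_mono]
    change _ = (SkewPolynomial.coeff (const F c * T F ^ j' * tau F ^ k') k).coeff j
    rw [const_mul_T_pow_mul_tau_pow, SkewPolynomial.coeff_monomial]
    by_cases h : k' = k <;> by_cases h' : j' = j <;> simp [h, h', Polynomial.coeff_monomial]
  exact DFunLike.congr_fun this r

theorem eq_zero_of_coeff {r : AndersonRing F} (h : ∀ j k, coeff j k r = 0) : r = 0 := by
  refine SkewMonoidAlgebra.ext fun k => Polynomial.ext fun j => ?_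
  exact (coeff_eq j k.toAdd r).symm.trans (h j k.toAdd)

theorem closure_mono :
    AddSubgroup.closure (Set.range fun p : CInf F × ℕ × ℕ =>
      const F p.1 * T F ^ p.2.1 * tau F ^ p.2.2) = ⊤ := by
  set S := AddSubgroup.closure (Set.range fun p : CInf F × ℕ × ℕ =>
      const F p.1 * T F ^ p.2.1 * tau F ^ p.2.2)
  have : QuotientAddGroup.mk' S = 0 := addHom_ext fun c j k => by
    rw [AddMonoidHom.zero_apply, QuotientAddGroup.mk'_apply, QuotientAddGroup.eq_zero_iff]
    exact AddSubgroup.subset_closure ⟨(c, j, k), rfl⟩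
  rw [eq_top_iff]
  intro r _
  rw [← QuotientAddGroup.eq_zero_iff]
  exact DFunLike.congr_fun this r

/-- Supplies the starting point of the descents on the degree in T and in τ. -/
theorem exists_bound (r : AndersonRing F) :
    ∃ N, ∀ j k, (N ≤ j ∨ N ≤ k) → coeff j k r = 0 := by
  have hr : r ∈ AddSubgroup.closure (Set.range fun p : CInf F × ℕ × ℕ =>
      const F p.1 * T F ^ p.2.1 * tau F ^ p.2.2) := by rw [closure_mono]; trivial
  induction hr using AddSubgroup.closure_induction with
  | mem x hx =>
    obtain ⟨⟨c, j', k'⟩, rfl⟩ := hx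
    refine ⟨j' + k' + 1, fun j k h => ?_⟩
    change coeff j k (const F c * T F ^ j' * tau F ^ k') = 0
    rw [coeff_mono, if_neg]
    omega
  | zero => exact ⟨0, by simp⟩
  | add x y _ _ hx hy =>
    obtain ⟨N, hN⟩ := hx
    obtain ⟨N', hN'⟩ := hy
    refine ⟨max N N', fun j k h => ?_⟩
    rw [map_add, hN j k (by omega), hN' j k (by omega), add_zero]
  | neg x _ hx =>
    obtain ⟨N, hN⟩ := hx
    exact ⟨N, fun j k h => by rw [map_neg, hN j k h, neg_zero]⟩

/-- The elements of degree less than `J` in `T`. -/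
def degTLT (J : ℕ) : AddSubgroup (AndersonRing F) where
  carrier := {r | ∀ j k, J ≤ j → coeff j k r = 0}
  zero_mem' := by simp
  add_mem' {x y} hx hy j k h := by rw [map_add, hx j k h, hy j k h, add_zero]
  neg_mem' {x} hx j k h := by rw [map_neg, hx j k h, neg_zero]

/-- The elements of degree less than `K` in `τ`. -/
def degTauLT (K : ℕ) : AddSubgroup (AndersonRing F) where
  carrier := {r | ∀ j k, K ≤ k → coeff j k r = 0}
  zero_mem' := by simp
  add_mem' {x y} hx hy j k h := by rw [map_add, hx j k h, hy j k h, add_zero]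
  neg_mem' {x} hx j k h := by rw [map_neg, hx j k h, neg_zero]

theorem degTLT_mul_const {J : ℕ} {r : AndersonRing F} (h : r ∈ degTLT J) (a : CInf F) :
    r * const F a ∈ degTLT J := fun j k hj => by rw [coeff_mul_const, h j k hj, mul_zero]

theorem degTLT_mul_tau {J : ℕ} {r : AndersonRing F} (h : r ∈ degTLT J) :
    r * tau F ∈ degTLT J := by
  intro j k hj
  cases k with
  | zero => exact coeff_zero_mul_tau j r
  | succ k => rw [coeff_mul_tau, h j k hj]

theorem mem_degTLT_of_mul_T {J : ℕ} {r : AndersonRing F} (h : r * T F ∈ degTLT (J + 1)) :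
    r ∈ degTLT J := fun j k hj => by rw [← coeff_mul_T, h _ k (by omega)]

theorem degTauLT_mul_const {K : ℕ} {r : AndersonRing F} (h : r ∈ degTauLT K) (a : CInf F) :
    r * const F a ∈ degTauLT K := fun j k hk => by rw [coeff_mul_const, h j k hk, mul_zero]

theorem degTauLT_mul_T {K : ℕ} {r : AndersonRing F} (h : r ∈ degTauLT K) :
    r * T F ∈ degTauLT K := by
  intro j k hk
  cases j with
  | zero => exact coeff_zero_mul_T k r
  | succ j => rw [coeff_mul_T, h j k hk]

theorem degTauLT_mul_tau {K : ℕ} {r : AndersonRing F} (h : r ∈ degTauLT K) :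
    r * tau F ∈ degTauLT (K + 1) := by
  intro j k hk
  cases k with
  | zero => omega
  | succ k => rw [coeff_mul_tau, h j k (by omega)]

theorem mem_degTauLT_of_mul_tau {K : ℕ} {r : AndersonRing F} (h : r * tau F ∈ degTauLT (K + 1)) :
    r ∈ degTauLT K := fun j k hk => by rw [← coeff_mul_tau, h j _ (by omega)]

theorem degTLT_mono {J J' : ℕ} (h : J ≤ J') : degTLT (F := F) J ≤ degTLT J' :=
  fun _ hr j k hj => hr j k (h.trans hj)

theorem degTauLT_mono {K K' : ℕ} (h : K ≤ K') : degTauLT (F := F) K ≤ degTauLT K' :=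
  fun _ hr j k hk => hr j k (h.trans hk)

theorem one_mem_degTLT : (1 : AndersonRing F) ∈ degTLT 1 := by
  intro j k hj
  have := coeff_mono (F := F) 1 j k 0 0
  simp only [map_one, pow_zero, mul_one] at this
  rw [this, if_neg (by omega)]

theorem one_mem_degTauLT : (1 : AndersonRing F) ∈ degTauLT 1 := by
  intro j k hj
  have := coeff_mono (F := F) 1 j k 0 0
  simp only [map_one, pow_zero, mul_one] at this
  rw [this, if_neg (by omega)]

theorem mul_mem_degTLT_of_mem_polyTau {J : ℕ} {r p : AndersonRing F} (hr : r ∈ degTLT J)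
    (hp : p ∈ polyTau F) : r * p ∈ degTLT J := by
  induction hp using Subring.closure_induction generalizing r with
  | mem x hx =>
    rcases hx with ⟨a, rfl⟩ | rfl
    · exact degTLT_mul_const hr a
    · exact degTLT_mul_tau hr
  | zero => simp [zero_mem]
  | one => simpa using hr
  | add x y _ _ hx hy => rw [mul_add]; exact add_mem (hx hr) (hy hr)
  | neg x _ hx => rw [mul_neg]; exact neg_mem (hx hr)
  | mul x y _ _ hx hy => rw [← mul_assoc]; exact hy (hx hr)

theorem mul_mem_degTauLT_of_mem_polyT {K : ℕ} {r p : AndersonRing F} (hr : r ∈ degTauLT K)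
    (hp : p ∈ polyT F) : r * p ∈ degTauLT K := by
  induction hp using Subring.closure_induction generalizing r with
  | mem x hx =>
    rcases hx with ⟨a, rfl⟩ | rfl
    · exact degTauLT_mul_const hr a
    · exact degTauLT_mul_T hr
  | zero => simp [zero_mem]
  | one => simpa using hr
  | add x y _ _ hx hy => rw [mul_add]; exact add_mem (hx hr) (hy hr)
  | neg x _ hx => rw [mul_neg]; exact neg_mem (hx hr)
  | mul x y _ _ hx hy => rw [← mul_assoc]; exact hy (hx hr)

theorem mem_degTLT_of_mem_polyTau {p : AndersonRing F} (hp : p ∈ polyTau F) : p ∈ degTLT 1 := by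
  simpa using mul_mem_degTLT_of_mem_polyTau one_mem_degTLT hp

theorem mem_degTauLT_of_mem_polyT {p : AndersonRing F} (hp : p ∈ polyT F) : p ∈ degTauLT 1 := by
  simpa using mul_mem_degTauLT_of_mem_polyT one_mem_degTauLT hp

theorem eq_zero_of_mem_degTLT {r : AndersonRing F} (h : r ∈ degTLT 0) : r = 0 :=
  eq_zero_of_coeff fun j k => h j k (Nat.zero_le _)

theorem eq_zero_of_mem_degTauLT {r : AndersonRing F} (h : r ∈ degTauLT 0) : r = 0 :=
  eq_zero_of_coeff fun j k => h j k (Nat.zero_le _)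

theorem subring_eq_top {S : Subring (AndersonRing F)} (hc : ∀ a, const F a ∈ S) (hT : T F ∈ S)
    (hτ : tau F ∈ S) : S = ⊤ := by
  rw [eq_top_iff]
  intro r _
  have hr : r ∈ AddSubgroup.closure (Set.range fun p : CInf F × ℕ × ℕ =>
      const F p.1 * T F ^ p.2.1 * tau F ^ p.2.2) := by rw [closure_mono]; trivial
  refine (AddSubgroup.closure_le S.toAddSubgroup).2 ?_ hr
  rintro _ ⟨⟨c, j, k⟩, rfl⟩
  exact S.mul_mem (S.mul_mem (hc c) (S.pow_mem hT j)) (S.pow_mem hτ k)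

/-- An additive subgroup of a module over the Anderson ring stable under `C∞`, `T` and `τ` is
stable under the Anderson ring. -/
theorem smul_mem_of_stable {M : Type*} [AddCommGroup M] [Module (AndersonRing F) M]
    (S : AddSubgroup M) (hc : ∀ a, ∀ m ∈ S, const F a • m ∈ S) (hT : ∀ m ∈ S, T F • m ∈ S)
    (hτ : ∀ m ∈ S, tau F • m ∈ S) (r : AndersonRing F) {m : M} (hm : m ∈ S) : r • m ∈ S := by
  let R : Subring (AndersonRing F) :=
    { carrier := {r | ∀ m ∈ S, r • m ∈ S}
      mul_mem' := fun {x y} hx hy m hm => by rw [mul_smul]; exact hx _ (hy _ hm)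
      one_mem' := fun m hm => by simpa using hm
      add_mem' := fun {x y} hx hy m hm => by rw [add_smul]; exact add_mem (hx _ hm) (hy _ hm)
      zero_mem' := fun m hm => by simp [zero_mem]
      neg_mem' := fun {x} hx m hm => by rw [neg_smul]; exact neg_mem (hx _ hm) }
  have : R = ⊤ := subring_eq_top hc hT hτ
  exact (this ▸ Subring.mem_top r : r ∈ R) m hm

end AndersonRing


/-! ## `M(A)` is a T-motive -/

namespace Motive

open AndersonRing

variable {F : Type*} [Field F] [Fintype F] {n : ℕ} (A : Matrix (Fin n) (Fin n) (CInf F))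

theorem mk_eq_sum (v : Fin n → AndersonRing F) :
    (Submodule.Quotient.mk v : Motive A) = ∑ i, v i • e A i := by
  have hv : v = ∑ i, v i • Pi.single i (1 : AndersonRing F) := by
    funext l
    simp [Finset.sum_apply, Pi.single_apply]
  conv_lhs => rw [hv]
  rw [← Submodule.mkQ_apply, map_sum]
  exact Finset.sum_congr rfl fun i _ => rfl

theorem T_smul_e (i : Fin n) :
    T F • e A i = const F (CInf.theta F) • e A i + ∑ j, const F (A i j) • tau F • e A j
      + tau F ^ 2 • e A i := by
  have h : (Submodule.Quotient.mk (motiveRelation A i) : Motive A) = 0 :=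
    (Submodule.Quotient.mk_eq_zero _).2 (Submodule.subset_span ⟨i, rfl⟩)
  have hs : ∀ (i : Fin n) (r : AndersonRing F),
      (Submodule.Quotient.mk (Pi.single i r) : Motive A) = r • e A i := by
    intro i r
    rw [mk_eq_sum, Finset.sum_eq_single i]
    · simp
    · intro j _ hj
      simp [hj]
    · simp
  rw [motiveRelation, ← Submodule.mkQ_apply, map_sub, map_add, map_add, map_sum] at h
  simp only [Submodule.mkQ_apply, hs] at h
  simpa only [mul_smul] using sub_eq_zero.1 h

/-- A vanishing element is a combination of the relations with multipliers b. Read coordinatewise,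
the equation has one term that raises the degree in T (the left side) and one that raises the degree
in τ by two, and either can serve as leading term. -/
theorem exists_of_mk_eq_zero {v : Fin n → AndersonRing F}
    (h : (Submodule.Quotient.mk v : Motive A) = 0) :
    ∃ b : Fin n → AndersonRing F, ∀ l, b l * T F
      = v l + b l * const F (CInf.theta F) + ∑ i, b i * const F (A i l) * tau F
        + b l * tau F * tau F := by
  rw [Submodule.Quotient.mk_eq_zero, Submodule.mem_span_range_iff_exists_fun] at h
  obtain ⟨b, hb⟩ := h
  refine ⟨b, fun l => ?_⟩
  have hl := congrFun hb l
  have hcomp : ∀ i, (b i • motiveRelation A i) l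
      = Pi.single (M := fun _ => AndersonRing F) i (b i * T F) l
        - (Pi.single (M := fun _ => AndersonRing F) i (b i * const F (CInf.theta F)) l
          + b i * const F (A i l) * tau F
          + Pi.single (M := fun _ => AndersonRing F) i (b i * tau F * tau F) l) := by
    intro i
    have hA : (∑ j, Pi.single j (const F (A i j) * tau F) : Fin n → AndersonRing F) l
        = const F (A i l) * tau F := by
      simp [Finset.sum_apply, Pi.single_apply]
    simp only [motiveRelation, Pi.smul_apply, Pi.sub_apply, Pi.add_apply, hA, smul_eq_mul]
    by_cases h : i = l
    · subst h
      simp only [Pi.single_eq_same]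
      noncomm_ring
    · simp [Ne.symm h, mul_assoc]
  rw [Finset.sum_apply] at hl
  simp only [hcomp, Finset.sum_sub_distrib, Finset.sum_add_distrib, Finset.sum_pi_single,
    Finset.mem_univ, if_true] at hl
  rw [← hl]
  abel

/-- In the relation b T = g + (terms of the same T-degree as b), the coefficients g have degree 0 in
T. A nonzero b would give the left side a larger T-degree than the right side, so b = 0 and then g =
0. -/
theorem linearIndependent_polyTau : LinearIndependent (polyTau F) (e A) := by
  rw [Fintype.linearIndependent_iff]
  intro g hg
  have hmk : (Submodule.Quotient.mk (fun i => (g i : AndersonRing F)) : Motive A) = 0 := by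
    rw [mk_eq_sum]
    exact hg
  obtain ⟨b, hb⟩ := exists_of_mk_eq_zero A hmk
  have hstep : ∀ J, (∀ l, b l ∈ degTLT (J + 1)) → ∀ l, b l ∈ degTLT J := by
    intro J hJ l
    apply mem_degTLT_of_mul_T
    rw [hb l]
    refine add_mem (add_mem (add_mem ?_ ?_) (sum_mem fun i _ => ?_)) ?_
    · exact degTLT_mono (by omega) (mem_degTLT_of_mem_polyTau (g l).2)
    · exact degTLT_mul_const (hJ l) _
    · exact degTLT_mul_tau (degTLT_mul_const (hJ i) _)
    · exact degTLT_mul_tau (degTLT_mul_tau (hJ l))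
  choose N hN using fun l => exists_bound (b l)
  have hall : ∀ J, (∀ l, b l ∈ degTLT J) → ∀ l, b l ∈ degTLT 0 := by
    intro J
    induction J with
    | zero => exact id
    | succ J ih => exact fun h => ih (hstep J h)
  have h0 : ∀ l, b l = 0 := fun l => eq_zero_of_mem_degTLT
    (hall (∑ l, N l) (fun l j k hj => hN l j k
      (Or.inl ((Finset.single_le_sum (f := N) (fun _ _ => Nat.zero_le _) (Finset.mem_univ l)).trans hj))) l)
  intro i
  have := hb i
  simp only [h0, zero_mul, Finset.sum_const_zero, add_zero] at this
  exact Subtype.ext this.symm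

theorem commute_T_of_mem_polyTau {r : AndersonRing F} (hr : r ∈ polyTau F) :
    Commute (T F) r := by
  induction hr using Subring.closure_induction with
  | mem x hx =>
    rcases hx with ⟨a, rfl⟩ | rfl
    · exact commute_T_const a
    · exact commute_T_tau
  | zero => exact Commute.zero_right _
  | one => exact Commute.one_right _
  | add x y _ _ hx hy => exact hx.add_right hy
  | neg x _ hx => exact hx.neg_right
  | mul x y _ _ hx hy => exact hx.mul_right hy

theorem exists_tau_mul_eq {r : AndersonRing F} (hr : r ∈ polyT F) :
    ∃ r' ∈ polyT F, tau F * r = r' * tau F := by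
  induction hr using Subring.closure_induction with
  | mem x hx =>
    rcases hx with ⟨a, rfl⟩ | rfl
    · exact ⟨_, Subring.subset_closure (Or.inl ⟨_, rfl⟩), tau_mul_const F a⟩
    · exact ⟨T F, Subring.subset_closure (Or.inr rfl), (T_mul_tau F).symm⟩
  | zero => exact ⟨0, zero_mem _, by simp⟩
  | one => exact ⟨1, one_mem _, by simp⟩
  | add x y _ _ hx hy =>
    obtain ⟨x', hx', hx⟩ := hx
    obtain ⟨y', hy', hy⟩ := hy
    exact ⟨x' + y', add_mem hx' hy', by rw [mul_add, add_mul, hx, hy]⟩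
  | neg x _ hx =>
    obtain ⟨x', hx', hx⟩ := hx
    exact ⟨-x', neg_mem hx', by rw [mul_neg, neg_mul, hx]⟩
  | mul x y _ _ hx hy =>
    obtain ⟨x', hx', hx⟩ := hx
    obtain ⟨y', hy', hy⟩ := hy
    exact ⟨x' * y', mul_mem hx' hy', by rw [← mul_assoc, hx, mul_assoc, hy, mul_assoc]⟩

theorem const_mem_polyTau (a : CInf F) : const F a ∈ polyTau F :=
  Subring.subset_closure (Or.inl ⟨a, rfl⟩)

theorem tau_mem_polyTau : tau F ∈ polyTau F := Subring.subset_closure (Or.inr rfl)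

theorem const_mem_polyT (a : CInf F) : const F a ∈ polyT F :=
  Subring.subset_closure (Or.inl ⟨a, rfl⟩)

theorem T_mem_polyT : T F ∈ polyT F := Subring.subset_closure (Or.inr rfl)

/-- A `C∞`, `T` and `τ`-stable additive subgroup containing the generators is everything. -/
theorem mem_of_stable (S : AddSubgroup (Motive A)) (hc : ∀ a, ∀ m ∈ S, const F a • m ∈ S)
    (hT : ∀ m ∈ S, T F • m ∈ S) (hτ : ∀ m ∈ S, tau F • m ∈ S) (he : ∀ i, e A i ∈ S)
    (m : Motive A) : m ∈ S := by
  induction m using Submodule.Quotient.induction_on with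
  | H v =>
    rw [mk_eq_sum]
    exact sum_mem fun i _ => smul_mem_of_stable S hc hT hτ _ (he i)

theorem span_polyTau : Submodule.span (polyTau F) (Set.range (e A)) = ⊤ := by
  set S := Submodule.span (polyTau F) (Set.range (e A)) with hS
  have hsm : ∀ r ∈ polyTau F, ∀ m ∈ S, r • m ∈ S := fun r hr m hm => S.smul_mem ⟨r, hr⟩ hm
  have he : ∀ i, e A i ∈ S := fun i => Submodule.subset_span ⟨i, rfl⟩
  rw [eq_top_iff]
  intro m _
  refine mem_of_stable A S.toAddSubgroup (fun a => hsm _ (const_mem_polyTau a)) ?_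
    (hsm _ tau_mem_polyTau) he m
  intro m hm
  change m ∈ S at hm
  change T F • m ∈ S
  induction hm using Submodule.span_induction with
  | mem x hx =>
    obtain ⟨i, rfl⟩ := hx
    rw [T_smul_e]
    refine add_mem (add_mem ?_ (sum_mem fun j _ => ?_)) ?_
    · exact hsm _ (const_mem_polyTau _) _ (he i)
    · exact hsm _ (const_mem_polyTau _) _ (hsm _ tau_mem_polyTau _ (he j))
    · exact hsm _ (pow_mem tau_mem_polyTau 2) _ (he i)
  | zero => simp
  | add x y _ _ hx hy => rw [smul_add]; exact add_mem hx hy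
  | smul r x _ hx =>
    have : T F • r • x = r • T F • x := by
      rw [Subring.smul_def, Subring.smul_def, ← mul_smul, (commute_T_of_mem_polyTau r.2).eq,
        mul_smul]
    rw [this]
    exact S.smul_mem _ hx

/-- The vectors `e₁, …, eₙ, τe₁, …, τeₙ`. -/
def eTau : Fin n ⊕ Fin n → Motive A := Sum.elim (e A) (fun i => tau F • e A i)

/-- The same descent in the τ-degree, now with b τ² as leading term. The coefficients contribute
degree at most 1 in τ, hence b = 0. The two families of coefficients then separate by their
τ-degree. -/
theorem linearIndependent_polyT : LinearIndependent (polyT F) (eTau A) := by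
  rw [Fintype.linearIndependent_iff]
  intro g hg
  have hmk : (Submodule.Quotient.mk (fun i => (g (Sum.inl i) : AndersonRing F)
      + (g (Sum.inr i) : AndersonRing F) * tau F) : Motive A) = 0 := by
    rw [mk_eq_sum, ← hg, Fintype.sum_sum_type, ← Finset.sum_add_distrib]
    refine Finset.sum_congr rfl fun i _ => ?_
    rw [add_smul, mul_smul]
    rfl
  obtain ⟨b, hb⟩ := exists_of_mk_eq_zero A hmk
  have hstep : ∀ K, (∀ l, b l ∈ degTauLT (K + 1)) → ∀ l, b l ∈ degTauLT K := by
    intro K hK l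
    apply mem_degTauLT_of_mul_tau
    apply mem_degTauLT_of_mul_tau
    have hbl : b l * tau F * tau F = b l * T F - ((g (Sum.inl l) : AndersonRing F)
        + (g (Sum.inr l) : AndersonRing F) * tau F) - b l * const F (CInf.theta F)
        - ∑ i, b i * const F (A i l) * tau F := by
      rw [hb l]; abel
    rw [hbl]
    refine sub_mem (sub_mem (sub_mem ?_ (add_mem ?_ ?_)) ?_) (sum_mem fun i _ => ?_)
    · exact degTauLT_mono (by omega) (degTauLT_mul_T (hK l))
    · exact degTauLT_mono (by omega) (mem_degTauLT_of_mem_polyT (g _).2)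
    · exact degTauLT_mono (by omega) (degTauLT_mul_tau (mem_degTauLT_of_mem_polyT (g _).2))
    · exact degTauLT_mono (by omega) (degTauLT_mul_const (hK l) _)
    · exact degTauLT_mul_tau (degTauLT_mul_const (hK i) _)
  choose N hN using fun l => exists_bound (b l)
  have hall : ∀ J, (∀ l, b l ∈ degTauLT J) → ∀ l, b l ∈ degTauLT 0 := by
    intro J
    induction J with
    | zero => exact id
    | succ J ih => exact fun h => ih (hstep J h)
  have h0 : ∀ l, b l = 0 := fun l => eq_zero_of_mem_degTauLT
    (hall (∑ l, N l) (fun l j k hj => hN l j k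
      (Or.inr ((Finset.single_le_sum (f := N) (fun _ _ => Nat.zero_le _) (Finset.mem_univ l)).trans hj))) l)
  have key : ∀ i, (g (Sum.inl i) : AndersonRing F) + (g (Sum.inr i) : AndersonRing F) * tau F = 0 := by
    intro i
    have := hb i
    simp only [h0, zero_mul, Finset.sum_const_zero, add_zero] at this
    exact this.symm
  have hr : ∀ i, (g (Sum.inr i) : AndersonRing F) = 0 := fun i => by
    refine eq_zero_of_coeff fun j k => ?_
    rw [← coeff_mul_tau, eq_neg_of_add_eq_zero_right (key i), map_neg,
      mem_degTauLT_of_mem_polyT (g (Sum.inl i)).2 j (k + 1) (by omega), neg_zero]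
  rintro (i | i)
  · have := key i
    rw [hr, zero_mul, add_zero] at this
    exact Subtype.ext this
  · exact Subtype.ext (hr i)

theorem span_polyT : Submodule.span (polyT F) (Set.range (eTau A)) = ⊤ := by
  set S := Submodule.span (polyT F) (Set.range (eTau A)) with hS
  have hsm : ∀ r ∈ polyT F, ∀ m ∈ S, r • m ∈ S := fun r hr m hm => S.smul_mem ⟨r, hr⟩ hm
  have he : ∀ i, e A i ∈ S := fun i => Submodule.subset_span ⟨Sum.inl i, rfl⟩
  have he' : ∀ i, tau F • e A i ∈ S := fun i => Submodule.subset_span ⟨Sum.inr i, rfl⟩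
  rw [eq_top_iff]
  intro m _
  refine mem_of_stable A S.toAddSubgroup (fun a => hsm _ (const_mem_polyT a))
    (hsm _ T_mem_polyT) ?_ he m
  intro m hm
  change m ∈ S at hm
  change tau F • m ∈ S
  induction hm using Submodule.span_induction with
  | mem x hx =>
    obtain ⟨i | i, rfl⟩ := hx
    · exact he' i
    · change tau F • tau F • e A i ∈ S
      have : tau F • tau F • e A i = T F • e A i - const F (CInf.theta F) • e A i
          - ∑ j, const F (A i j) • tau F • e A j := by
        rw [T_smul_e, sq, mul_smul]; abel
      rw [this]
      refine sub_mem (sub_mem ?_ ?_) (sum_mem fun j _ => ?_)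
      · exact hsm _ T_mem_polyT _ (he i)
      · exact hsm _ (const_mem_polyT _) _ (he i)
      · exact hsm _ (const_mem_polyT _) _ (he' j)
  | zero => simp
  | add x y _ _ hx hy => rw [smul_add]; exact add_mem hx hy
  | smul r x _ hx =>
    obtain ⟨r', hr', h⟩ := exists_tau_mul_eq r.2
    have : tau F • r • x = r' • tau F • x := by
      rw [Subring.smul_def, ← mul_smul, h, mul_smul]
    rw [this]
    exact hsm _ hr' _ hx

/-- The subgroup `τ M` of a module over the Anderson ring. -/
def tauImage (M : Type*) [AddCommGroup M] [Module (AndersonRing F) M] : AddSubgroup M where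
  carrier := {m | ∃ y, m = tau F • y}
  zero_mem' := ⟨0, (smul_zero _).symm⟩
  add_mem' := by
    rintro _ _ ⟨y, rfl⟩ ⟨y', rfl⟩
    exact ⟨y + y', (smul_add _ _ _).symm⟩
  neg_mem' := by
    rintro _ ⟨y, rfl⟩
    exact ⟨-y, (smul_neg _ _).symm⟩

/-! ### Stability of τM and the action of T - θ modulo τM -/

section tauImage

variable {M : Type*} [AddCommGroup M] [Module (AndersonRing F) M]

theorem tau_smul_mem_tauImage (y : M) : tau F • y ∈ tauImage (F := F) M := ⟨y, rfl⟩

/-- This needs C∞ to be perfect: aτ = τ a^(1/q). -/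
theorem const_smul_mem_tauImage (a : CInf F) {m : M} (hm : m ∈ tauImage (F := F) M) :
    const F a • m ∈ tauImage (F := F) M := by
  obtain ⟨y, rfl⟩ := hm
  obtain ⟨b, rfl⟩ := CInf.exists_pow_card_eq a
  exact ⟨const F b • y, by rw [← mul_smul, ← mul_smul, tau_mul_const]⟩

theorem T_smul_mem_tauImage {m : M} (hm : m ∈ tauImage (F := F) M) :
    T F • m ∈ tauImage (F := F) M := by
  obtain ⟨y, rfl⟩ := hm
  exact ⟨T F • y, by rw [← mul_smul, ← mul_smul, T_mul_tau]⟩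

variable (M) in
/-- The preimage of `τ M` under `T - θ`. -/
def tauPreimage : AddSubgroup M where
  carrier := {m | T F • m - const F (CInf.theta F) • m ∈ tauImage (F := F) M}
  zero_mem' := by simp [zero_mem]
  add_mem' := by
    intro x y hx hy
    have : T F • (x + y) - const F (CInf.theta F) • (x + y)
      = (T F • x - const F (CInf.theta F) • x) + (T F • y - const F (CInf.theta F) • y) := by
      rw [smul_add, smul_add]; abel
    rw [Set.mem_ofPred_eq, this]
    exact add_mem hx hy
  neg_mem' := by
    intro x hx
    have : T F • (-x) - const F (CInf.theta F) • (-x)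
      = -(T F • x - const F (CInf.theta F) • x) := by
      rw [smul_neg, smul_neg]; abel
    rw [Set.mem_ofPred_eq, this]
    exact neg_mem hx

theorem mem_tauPreimage {m : M} : m ∈ tauPreimage (F := F) M ↔
    T F • m - const F (CInf.theta F) • m ∈ tauImage (F := F) M := Iff.rfl

theorem const_smul_mem_tauPreimage (a : CInf F) {m : M} (hm : m ∈ tauPreimage (F := F) M) :
    const F a • m ∈ tauPreimage (F := F) M := by
  rw [mem_tauPreimage] at hm ⊢
  have : T F • const F a • m - const F (CInf.theta F) • const F a • m
      = const F a • (T F • m - const F (CInf.theta F) • m) := by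
    rw [smul_sub, ← mul_smul, ← mul_smul, ← mul_smul, ← mul_smul, T_mul_const, ← map_mul,
      ← map_mul, mul_comm a]
  rw [this]
  exact const_smul_mem_tauImage a hm

theorem T_smul_mem_tauPreimage {m : M} (hm : m ∈ tauPreimage (F := F) M) :
    T F • m ∈ tauPreimage (F := F) M := by
  rw [mem_tauPreimage] at hm ⊢
  have : T F • T F • m - const F (CInf.theta F) • T F • m
      = T F • (T F • m - const F (CInf.theta F) • m) := by
    rw [smul_sub, ← mul_smul (T F) (const F _), T_mul_const, mul_smul]
  rw [this]
  exact T_smul_mem_tauImage hm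

theorem tau_smul_mem_tauPreimage (m : M) : tau F • m ∈ tauPreimage (F := F) M := by
  rw [mem_tauPreimage, ← mul_smul, T_mul_tau, mul_smul]
  exact sub_mem (tau_smul_mem_tauImage _) (const_smul_mem_tauImage _ (tau_smul_mem_tauImage _))

end tauImage

/-- The preimage of τM under T - θ is stable under C∞, T and τ, and it contains the generators
because (T - θ)e = Aτe + τ²e. Hence the first power of T - θ suffices. -/
theorem exists_T_sub_theta_smul_eq (x : Motive A) :
    ∃ y, (T F - const F (CInf.theta F)) • x = tau F • y := by
  rw [sub_smul]
  refine mem_of_stable A (tauPreimage (Motive A)) (fun a m => const_smul_mem_tauPreimage a)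
    (fun m => T_smul_mem_tauPreimage) (fun m _ => tau_smul_mem_tauPreimage m) (fun i => ?_) x
  have : T F • e A i - const F (CInf.theta F) • e A i
      = ∑ j, const F (A i j) • tau F • e A j + tau F • tau F • e A i := by
    rw [T_smul_e, sq, mul_smul]; abel
  rw [mem_tauPreimage, this]
  exact add_mem (sum_mem fun j _ => const_smul_mem_tauImage _ (tau_smul_mem_tauImage _))
    (tau_smul_mem_tauImage _)

theorem isTMotive : IsTMotive F n (2 * n) (Motive A) where
  free_tau := ⟨Module.Basis.mk (linearIndependent_polyTau A) (span_polyTau A).ge⟩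
  free_T := ⟨(Module.Basis.mk (linearIndependent_polyT A) (span_polyT A).ge).reindex
    (finSumFinEquiv.trans (finCongr (two_mul n).symm))⟩
  nilpotent := ⟨1, fun x => by simpa using exists_T_sub_theta_smul_eq A x⟩

/-! ### Coordinates on `Lie(M(A))` and `E(M(A))` -/

/-- An additive subgroup of `M(A)` stable under `C∞` and `τ` and containing the generators is
everything. -/
theorem mem_of_tau_stable (S : AddSubgroup (Motive A)) (hc : ∀ a, ∀ m ∈ S, const F a • m ∈ S)
    (hτ : ∀ m ∈ S, tau F • m ∈ S) (he : ∀ i, e A i ∈ S) (m : Motive A) : m ∈ S := by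
  have hsm : ∀ r ∈ polyTau F, ∀ m ∈ S, r • m ∈ S := by
    intro r hr
    induction hr using Subring.closure_induction with
    | mem x hx =>
      rcases hx with ⟨a, rfl⟩ | rfl
      · exact hc a
      · exact hτ
    | zero => intro m _; rw [zero_smul]; exact zero_mem S
    | one => intro m hm; rwa [one_smul]
    | add x y _ _ hx hy => intro m hm; rw [add_smul]; exact add_mem (hx m hm) (hy m hm)
    | neg x _ hx => intro m hm; rw [neg_smul]; exact neg_mem (hx m hm)
    | mul x y _ _ hx hy => intro m hm; rw [mul_smul]; exact hx _ (hy m hm)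
  have hm : m ∈ Submodule.span (polyTau F) (Set.range (e A)) := by rw [span_polyTau]; trivial
  induction hm using Submodule.span_induction with
  | mem x hx => obtain ⟨i, rfl⟩ := hx; exact he i
  | zero => exact zero_mem S
  | add x y _ _ hx hy => exact add_mem hx hy
  | smul r x _ hx => exact hsm r r.2 x hx

/-- The condition on a family `wᵢⱼₖ` under which `Tʲ τᵏ eᵢ ↦ wᵢⱼₖ` extends to `M(A)`. -/
def IsCompatible (w : Fin n → ℕ → ℕ → CInf F) : Prop :=
  ∀ i j k, w i (j + 1) k = CInf.theta F ^ (Fintype.card F ^ k) * w i j k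
    + ∑ l, A i l ^ (Fintype.card F ^ k) * w l j (k + 1) + w i j (k + 2)

/-- The additive map on the free module with `Tʲ τᵏ eᵢ ↦ wᵢⱼₖ`. -/
def freeFunctional (w : Fin n → ℕ → ℕ → CInf F) : (Fin n → AndersonRing F) →+ CInf F :=
  ∑ i, (pairing (w i)).comp (Pi.evalAddMonoidHom (fun _ => AndersonRing F) i)

theorem freeFunctional_apply (w : Fin n → ℕ → ℕ → CInf F) (v : Fin n → AndersonRing F) :
    freeFunctional w v = ∑ i, pairing (w i) (v i) := by
  simp [freeFunctional]

variable {A}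

/-- `IsCompatible` is the relation Te = θe + Aτe + τ²e multiplied on the left by T^j τ^k, with the
constants moved past τ^k. -/
theorem freeFunctional_smul_relation {w : Fin n → ℕ → ℕ → CInf F} (hw : IsCompatible A w)
    (r : AndersonRing F) (i : Fin n) : freeFunctional w (r • motiveRelation A i) = 0 := by
  have hs : ∀ (l : Fin n) (x : AndersonRing F),
      freeFunctional w (r • Pi.single l x) = pairing (w l) (r * x) := by
    intro l x
    rw [freeFunctional_apply, Finset.sum_eq_single l]
    · simp
    · intro j _ hj
      simp [hj]
    · simp
  rw [motiveRelation, smul_sub, smul_add, smul_add, Finset.smul_sum, map_sub, map_add, map_add,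
    map_sum]
  simp only [hs, sq, ← mul_assoc, pairing_mul_T, pairing_mul_tau, pairing_mul_const]
  rw [sub_eq_zero, ← pairing_sum, ← pairing_add, ← pairing_add]
  congr 1
  refine congrArg pairing ?_
  funext j k
  exact hw i j k

/-- The additive map on `M(A)` with `Tʲ τᵏ eᵢ ↦ wᵢⱼₖ`. -/
def functional {w : Fin n → ℕ → ℕ → CInf F} (hw : IsCompatible A w) : Motive A →+ CInf F :=
  QuotientAddGroup.lift (Submodule.span (AndersonRing F) (Set.range (motiveRelation A))).toAddSubgroup
    (freeFunctional w) fun v hv => by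
      obtain ⟨b, rfl⟩ := (Submodule.mem_span_range_iff_exists_fun _).1 hv
      rw [AddMonoidHom.mem_ker, map_sum]
      exact Finset.sum_eq_zero fun i _ => freeFunctional_smul_relation hw _ _

theorem functional_mk {w : Fin n → ℕ → ℕ → CInf F} (hw : IsCompatible A w)
    (v : Fin n → AndersonRing F) :
    functional hw (Submodule.Quotient.mk v) = ∑ i, pairing (w i) (v i) :=
  (QuotientAddGroup.lift_mk _ _ _).trans (freeFunctional_apply w v)

theorem functional_e {w : Fin n → ℕ → ℕ → CInf F} (hw : IsCompatible A w) (i : Fin n) :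
    functional hw (e A i) = w i 0 0 := by
  have h1 : pairing (w i) 1 = w i 0 0 := by
    simpa using pairing_mono (w i) 1 0 0
  rw [e, functional_mk, Finset.sum_eq_single i]
  · simpa using h1
  · intro j _ hj
    simp [hj]
  · simp

theorem functional_const_smul {w : Fin n → ℕ → ℕ → CInf F} (hw : IsCompatible A w)
    (a : CInf F) (m : Motive A) : functional hw (const F a • m) = a * functional hw m := by
  induction m using Submodule.Quotient.induction_on with
  | H v =>
    rw [← Submodule.Quotient.mk_smul, functional_mk, functional_mk, Finset.mul_sum]
    exact Finset.sum_congr rfl fun i _ => pairing_const_mul _ _ _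

variable (A) in
/-- The endomorphism `x ↦ θ x + A x⁽¹⁾ + x⁽²⁾` of `C∞ⁿ`, which is the action of `T` on `E(M(A))`. -/
def tAct (x : Fin n → CInf F) : Fin n → CInf F := fun i =>
  CInf.theta F * x i + ∑ l, A i l * x l ^ Fintype.card F + x i ^ (Fintype.card F ^ 2)

theorem exists_tPoints (x : Fin n → CInf F) :
    ∃ f : TPoints F (Motive A), ∀ i, (f : Motive A →+ CInf F) (e A i) = x i := by
  -- On a point of E the values are forced: T acts by `tAct` and τ by Frobenius.
  have hw : IsCompatible A fun i j k => ((tAct A)^[j] x) i ^ (Fintype.card F ^ k) := by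
    intro i j k
    simp only [Function.iterate_succ_apply']
    set y := (tAct A)^[j] x
    rw [tAct, ← CInf.frob_apply, map_add, map_add, map_mul, map_sum]
    simp only [CInf.frob_apply, mul_pow, ← pow_mul, ← pow_succ', ← pow_add, add_comm 2]
  refine ⟨⟨functional hw, functional_const_smul hw, fun m => ?_⟩, fun i => ?_⟩
  · induction m using Submodule.Quotient.induction_on with
    | H v =>
      rw [← Submodule.Quotient.mk_smul, functional_mk, functional_mk]
      have := map_sum (CInf.frob (F := F) 1) (fun i => pairing (fun j k =>
        ((tAct A)^[j] x) i ^ (Fintype.card F ^ k)) (v i)) Finset.univ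
      simp only [CInf.frob_apply, pow_one] at this
      rw [this]
      refine Finset.sum_congr rfl fun i _ => pairing_tau_mul (fun j k => ?_) _
      rw [pow_succ, pow_mul]
  · exact (functional_e hw i).trans (by simp)

theorem exists_tLie (z : Fin n → CInf F) :
    ∃ f : TLie F (Motive A), ∀ i, (f : Motive A →+ CInf F) (e A i) = z i := by
  -- On Lie, τ is killed, so only θ remains of the action of T.
  have hw : IsCompatible A fun i j k => if k = 0 then CInf.theta F ^ j * z i else 0 := by
    intro i j k
    by_cases hk : k = 0
    · subst hk
      simp [pow_succ']
      ring
    · simp [hk]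
  refine ⟨⟨functional hw, functional_const_smul hw, fun m => ?_⟩, fun i => ?_⟩
  · induction m using Submodule.Quotient.induction_on with
    | H v =>
      rw [← Submodule.Quotient.mk_smul, functional_mk]
      exact Finset.sum_eq_zero fun i _ => pairing_tau_mul_of_zero (fun j k => by simp) _
  · exact (functional_e hw i).trans (by simp)

theorem tPoints_ext {f g : TPoints F (Motive A)}
    (h : ∀ i, (f : Motive A →+ CInf F) (e A i) = (g : Motive A →+ CInf F) (e A i)) : f = g := by
  refine Subtype.ext (AddMonoidHom.ext fun m => ?_)
  refine mem_of_tau_stable A (AddMonoidHom.eqLocus f.1 g.1) ?_ ?_ h m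
  · intro a m hm
    change f.1 _ = g.1 _
    rw [f.2.1, g.2.1, show f.1 m = g.1 m from hm]
  · intro m hm
    change f.1 _ = g.1 _
    rw [f.2.2, g.2.2, show f.1 m = g.1 m from hm]

theorem tLie_ext {f g : TLie F (Motive A)}
    (h : ∀ i, (f : Motive A →+ CInf F) (e A i) = (g : Motive A →+ CInf F) (e A i)) : f = g := by
  refine Subtype.ext (AddMonoidHom.ext fun m => ?_)
  refine mem_of_tau_stable A (AddMonoidHom.eqLocus f.1 g.1) ?_ ?_ h m
  · intro a m hm
    change f.1 _ = g.1 _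
    rw [f.2.1, g.2.1, show f.1 m = g.1 m from hm]
  · intro m hm
    change f.1 _ = g.1 _
    rw [f.2.2, g.2.2]

theorem tPoints_T_e (f : TPoints F (Motive A)) (i : Fin n) :
    (TPoints.T f : Motive A →+ CInf F) (e A i)
      = tAct A (fun i => (f : Motive A →+ CInf F) (e A i)) i := by
  change f.1 (T F • e A i) = _
  rw [T_smul_e, map_add, map_add, map_sum, sq, mul_smul, f.2.1, f.2.2, f.2.2, tAct]
  simp only [f.2.1, f.2.2, sq, pow_mul]

theorem tLie_T_e (f : TLie F (Motive A)) (i : Fin n) :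
    (TLie.T f : Motive A →+ CInf F) (e A i)
      = CInf.theta F * (f : Motive A →+ CInf F) (e A i) := by
  change f.1 (T F • e A i) = _
  rw [T_smul_e, map_add, map_add, map_sum, sq, mul_smul, f.2.1, f.2.2]
  simp only [f.2.1, f.2.2]
  simp

end Motive


/-! ## The exponential of `M(A)` for `A` in the unit polydisc -/

section NormEstimates

set_option linter.unusedSectionVars false

theorem norm_pi_sum_mul_le {F : Type*} [Field F] [Fintype F] {ι : Type*} (s : Finset ι)
    (a b : ι → CInf F) {α β : ℝ} (hα : 0 ≤ α) (hβ : 0 ≤ β) (ha : ∀ i ∈ s, ‖a i‖ ≤ α)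
    (hb : ∀ i ∈ s, ‖b i‖ ≤ β) : ‖∑ i ∈ s, a i * b i‖ ≤ α * β := by
  refine IsUltrametricDist.norm_sum_le_of_forall_le_of_nonneg (by positivity) fun i hi => ?_
  rw [norm_mul]
  exact mul_le_mul (ha i hi) (hb i hi) (norm_nonneg _) hα

variable (F : Type*) [Field F] [Fintype F]

/-- The absolute value `q^(1/(q²-1))` of the nonzero `T`-torsion points of `E(M(0))`. -/
def torsionRadius : ℝ := (Fintype.card F : ℝ) ^ (((Fintype.card F ^ 2 - 1 : ℕ) : ℝ)⁻¹)

/-- The absolute value of the shortest periods of `M(0)`. -/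
def periodRadius : ℝ := Fintype.card F * torsionRadius F

variable {F}

theorem one_lt_card_real : 1 < (Fintype.card F : ℝ) := by exact_mod_cast Fintype.one_lt_card

theorem card_pos_real : 0 < (Fintype.card F : ℝ) := zero_lt_one.trans one_lt_card_real

theorem one_lt_card_sq : 1 < Fintype.card F ^ 2 := Nat.one_lt_pow (by norm_num) Fintype.one_lt_card

theorem torsionRadius_pow : torsionRadius F ^ (Fintype.card F ^ 2 - 1) = Fintype.card F := by
  refine Real.rpow_inv_natCast_pow (Nat.cast_nonneg _) ?_
  have := one_lt_card_sq (F := F)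
  omega

theorem torsionRadius_nonneg : 0 ≤ torsionRadius F := Real.rpow_nonneg (Nat.cast_nonneg _) _

theorem one_lt_torsionRadius : 1 < torsionRadius F := by
  by_contra! h
  have := pow_le_one₀ (n := Fintype.card F ^ 2 - 1) torsionRadius_nonneg h
  rw [torsionRadius_pow] at this
  linarith [one_lt_card_real (F := F)]

theorem torsionRadius_pos : 0 < torsionRadius F := zero_lt_one.trans one_lt_torsionRadius

theorem torsionRadius_le_card : torsionRadius F ≤ Fintype.card F := by
  conv_rhs => rw [← torsionRadius_pow]
  refine le_self_pow₀ one_lt_torsionRadius.le ?_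
  have := one_lt_card_sq (F := F)
  omega

theorem periodRadius_pos : 0 < periodRadius F := mul_pos card_pos_real torsionRadius_pos

theorem torsionRadius_lt_periodRadius : torsionRadius F < periodRadius F :=
  lt_mul_of_one_lt_left torsionRadius_pos one_lt_card_real

variable (F) in
/-- The bound for the coefficients of the exponential. -/
def expBound (k : ℕ) : ℝ := (((Fintype.card F : ℝ) ^ (Fintype.card F ^ k))⁻¹) ^ ((k + 1) / 2)

theorem expBound_nonneg (k : ℕ) : 0 ≤ expBound F k := by unfold expBound; positivity

/-- The bound is a q^k-th power, so the k-th term of the series is controlled by one base r q^(-m)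
with m = ⌊(k+1)/2⌋. The base tends to 0, whence convergence everywhere. -/
theorem expBound_mul_pow (k : ℕ) (r : ℝ) :
    expBound F k * r ^ (Fintype.card F ^ k)
      = (r * ((Fintype.card F : ℝ)⁻¹) ^ ((k + 1) / 2)) ^ (Fintype.card F ^ k) := by
  rw [expBound, mul_pow, ← inv_pow, ← pow_mul, ← pow_mul, mul_comm, mul_comm (Fintype.card F ^ k)]

theorem inv_card_pow_le_one (k : ℕ) : ((Fintype.card F : ℝ) ^ k)⁻¹ ≤ 1 :=
  inv_le_one_of_one_le₀ (one_le_pow₀ one_lt_card_real.le)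

theorem expBound_rec (k : ℕ) :
    ((Fintype.card F : ℝ) ^ (Fintype.card F ^ (k + 2)))⁻¹ * expBound F k ^ (Fintype.card F ^ 2)
      = expBound F (k + 2) := by
  have h : expBound F k ^ (Fintype.card F ^ 2)
      = (((Fintype.card F : ℝ) ^ (Fintype.card F ^ (k + 2)))⁻¹) ^ ((k + 1) / 2) := by
    simp only [expBound, inv_pow, ← pow_mul]
    congr 2
    ring
  rw [h, expBound, ← pow_succ']
  congr 1
  omega

/-- The exponent of `expBound` is dictated by the C_{k-2} term of the recursion. The A-term has
exponent ⌊(k+2)/2⌋ + 1 ≥ ⌊(k+3)/2⌋ and so never spoils it. -/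
theorem expBound_rec_succ_le (k : ℕ) :
    ((Fintype.card F : ℝ) ^ (Fintype.card F ^ (k + 2)))⁻¹ * expBound F (k + 1) ^ Fintype.card F
      ≤ expBound F (k + 2) := by
  have h : expBound F (k + 1) ^ Fintype.card F
      = (((Fintype.card F : ℝ) ^ (Fintype.card F ^ (k + 2)))⁻¹) ^ ((k + 2) / 2) := by
    simp only [expBound, inv_pow, ← pow_mul]
    congr 2
    ring
  rw [h, expBound, ← pow_succ']
  refine pow_le_pow_of_le_one (by positivity) (inv_card_pow_le_one _) ?_
  omega

variable (F) in
/-- The contraction factor of `z ↦ Exp z - z` on the ball of radius `r`. -/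
def contraction (r : ℝ) : ℝ := max 1 (r / Fintype.card F) ^ (Fintype.card F ^ 2 - 1) / Fintype.card F

theorem contraction_nonneg (r : ℝ) : 0 ≤ contraction F r := by unfold contraction; positivity

/-- R is exactly the threshold: R/q = t and t^(q²-1) = q. -/
theorem contraction_le_one {r : ℝ} (hr : r ≤ periodRadius F) : contraction F r ≤ 1 := by
  rw [contraction, div_le_one card_pos_real]
  conv_rhs => rw [← torsionRadius_pow]
  refine pow_le_pow_left₀ (by positivity) (max_le one_lt_torsionRadius.le ?_) _
  rwa [div_le_iff₀ card_pos_real, mul_comm]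

theorem contraction_lt_one {r : ℝ} (hr : r < periodRadius F) : contraction F r < 1 := by
  rw [contraction, div_lt_one card_pos_real]
  conv_rhs => rw [← torsionRadius_pow]
  have := one_lt_card_sq (F := F)
  refine pow_lt_pow_left₀ (max_lt one_lt_torsionRadius ?_) (by positivity) (by omega)
  rwa [div_lt_iff₀ card_pos_real, mul_comm]

theorem expBound_mul_pow_le {k : ℕ} (hk : 1 ≤ k) {ρ r : ℝ} (h0 : 0 ≤ ρ) (hρ : ρ ≤ r)
    (hr : r ≤ periodRadius F) :
    expBound F k * ρ ^ (Fintype.card F ^ k) ≤ contraction F r * ρ := by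
  have hq := one_lt_card_real (F := F)
  have hq0 := card_pos_real (F := F)
  have hq2 := one_lt_card_sq (F := F)
  set t := ρ / Fintype.card F with ht
  set t₁ := max 1 (r / Fintype.card F) with ht₁
  have ht0 : 0 ≤ t := by positivity
  have htt : t ≤ t₁ := (div_le_div_of_nonneg_right hρ hq0.le).trans (le_max_right _ _)
  have h1 : 1 ≤ t₁ := le_max_left _ _
  have hrhs : contraction F r * ρ = t₁ ^ (Fintype.card F ^ 2 - 1) * t := by
    rw [contraction, ht, ht₁]; field_simp
  rw [hrhs, expBound_mul_pow]
  -- For k = 1, 2 the term is (ρ/q)^(q^k), and k = 2 is the critical case that determines the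
  -- contraction factor.
  by_cases hk2 : k ≤ 2
  · have hm : (k + 1) / 2 = 1 := by omega
    have hqk : 1 ≤ Fintype.card F ^ k := Nat.one_le_pow _ _ Fintype.card_pos
    rw [hm, pow_one, ← div_eq_mul_inv, ← ht]
    calc t ^ (Fintype.card F ^ k) = t ^ (Fintype.card F ^ k - 1) * t := by
          rw [← pow_succ, Nat.sub_add_cancel hqk]
      _ ≤ t₁ ^ (Fintype.card F ^ 2 - 1) * t := by
          refine mul_le_mul_of_nonneg_right ?_ ht0
          refine (pow_le_pow_left₀ ht0 htt _).trans (pow_le_pow_right₀ h1 ?_)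
          exact Nat.sub_le_sub_right (Nat.pow_le_pow_right Fintype.card_pos hk2) 1
  -- From k = 3 on there are at least two factors 1/q. Since ρ/q ≤ t ≤ q, the base ρ/q² is at most 1
  -- and the power only decreases it.
  · have hm : 2 ≤ (k + 1) / 2 := by omega
    have hinv : ((Fintype.card F : ℝ)⁻¹) ^ ((k + 1) / 2) ≤ ((Fintype.card F : ℝ)⁻¹) ^ 2 :=
      pow_le_pow_of_le_one (by positivity) (inv_le_one_of_one_le₀ hq.le) hm
    have htq : t / Fintype.card F ≤ 1 := by
      rw [div_le_one hq0]
      refine le_trans ?_ (torsionRadius_le_card (F := F))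
      rw [ht, div_le_iff₀ hq0, mul_comm]
      exact hρ.trans hr
    have hb : ρ * ((Fintype.card F : ℝ)⁻¹) ^ ((k + 1) / 2) ≤ t / Fintype.card F := by
      refine (mul_le_mul_of_nonneg_left hinv h0).trans (le_of_eq ?_)
      rw [ht]; field_simp
    calc _ ≤ (t / Fintype.card F) ^ (Fintype.card F ^ k) := pow_le_pow_left₀ (by positivity) hb _
      _ ≤ t / Fintype.card F := pow_le_of_le_one (by positivity) htq
          (pow_ne_zero _ Fintype.card_ne_zero)
      _ ≤ t := div_le_self ht0 hq.le
      _ ≤ _ := le_mul_of_one_le_left ht0 (one_le_pow₀ h1)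

theorem tendsto_expBound_mul_pow (r : ℝ) (hr : 0 ≤ r) :
    Tendsto (fun k => expBound F k * r ^ (Fintype.card F ^ k)) atTop (𝓝 0) := by
  have hq := one_lt_card_real (F := F)
  have h1 : Tendsto (fun k : ℕ => r * ((Fintype.card F : ℝ)⁻¹) ^ ((k + 1) / 2)) atTop (𝓝 0) := by
    rw [← mul_zero r]
    refine Tendsto.const_mul r ?_
    refine (tendsto_pow_atTop_nhds_zero_of_lt_one (by positivity)
      (inv_lt_one_of_one_lt₀ hq)).comp ?_
    refine tendsto_atTop.2 fun b => ?_
    filter_upwards [eventually_ge_atTop (2 * b)] with k hk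
    omega
  have h2 : ∀ᶠ k : ℕ in atTop, expBound F k * r ^ (Fintype.card F ^ k) ≤ (1 / 2 : ℝ) ^ k := by
    filter_upwards [h1.eventually (gt_mem_nhds (show (0 : ℝ) < 1 / 2 by norm_num))] with k hk
    rw [expBound_mul_pow]
    refine (pow_le_pow_left₀ (by positivity) hk.le _).trans ?_
    exact pow_le_pow_of_le_one (by norm_num) (by norm_num)
      (Nat.lt_pow_self Fintype.one_lt_card).le
  refine squeeze_zero' (Eventually.of_forall fun k => ?_) h2
    (tendsto_pow_atTop_nhds_zero_of_lt_one (by norm_num) (by norm_num))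
  have := expBound_nonneg (F := F) k
  positivity

end NormEstimates

/-! ### Coefficients and functional equation of the exponential -/

namespace Motive

variable {F : Type*} [Field F] [Fintype F] {n : ℕ}

theorem norm_theta_pow_sub {k : ℕ} (hk : 1 ≤ k) :
    ‖CInf.theta F ^ (Fintype.card F ^ k) - CInf.theta F‖
      = (Fintype.card F : ℝ) ^ (Fintype.card F ^ k) := by
  have hq := one_lt_card_real (F := F)
  have hlt : ‖CInf.theta F‖ < ‖CInf.theta F ^ (Fintype.card F ^ k)‖ := by
    rw [norm_pow, CInf.norm_theta]
    exact lt_self_pow₀ hq (Nat.one_lt_pow (by omega) Fintype.one_lt_card)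
  rw [sub_eq_add_neg, IsUltrametricDist.norm_add_eq_max_of_norm_ne_norm, norm_neg,
    max_eq_left hlt.le, norm_pow, CInf.norm_theta]
  rw [norm_neg]
  exact hlt.ne'

theorem theta_pow_sub_ne_zero {k : ℕ} (hk : 1 ≤ k) :
    CInf.theta F ^ (Fintype.card F ^ k) - CInf.theta F ≠ 0 := by
  have := card_pos_real (F := F)
  rw [← norm_pos_iff, norm_theta_pow_sub hk]
  positivity

/-- The coefficients of the exponential of `M(A)`. -/
def expCoeff (A : Matrix (Fin n) (Fin n) (CInf F)) : ℕ → Matrix (Fin n) (Fin n) (CInf F)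
  | 0 => 1
  | 1 => fun i j => (CInf.theta F ^ (Fintype.card F ^ 1) - CInf.theta F)⁻¹ * A i j
  | k + 2 => fun i j => (CInf.theta F ^ (Fintype.card F ^ (k + 2)) - CInf.theta F)⁻¹ *
      (∑ l, A i l * expCoeff A (k + 1) l j ^ Fintype.card F
        + expCoeff A k i j ^ (Fintype.card F ^ 2))

theorem expCoeff_one (A : Matrix (Fin n) (Fin n) (CInf F)) (i j : Fin n) :
    expCoeff A 1 i j = (CInf.theta F ^ (Fintype.card F ^ 1) - CInf.theta F)⁻¹ * A i j := rfl

theorem expCoeff_add_two (A : Matrix (Fin n) (Fin n) (CInf F)) (k : ℕ) (i j : Fin n) :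
    expCoeff A (k + 2) i j = (CInf.theta F ^ (Fintype.card F ^ (k + 2)) - CInf.theta F)⁻¹ *
      (∑ l, A i l * expCoeff A (k + 1) l j ^ Fintype.card F
        + expCoeff A k i j ^ (Fintype.card F ^ 2)) := rfl

variable {A : Matrix (Fin n) (Fin n) (CInf F)}

theorem norm_expCoeff_le (hA : ∀ i j, ‖A i j‖ ≤ 1) (k : ℕ) (i j : Fin n) :
    ‖expCoeff A k i j‖ ≤ expBound F k := by
  induction k using Nat.twoStepInduction generalizing i j with
  | zero =>
    simp only [expCoeff, expBound, Matrix.one_apply]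
    split_ifs <;> simp
  | one =>
    rw [expCoeff_one, norm_mul, norm_inv, norm_theta_pow_sub le_rfl, expBound]
    simpa using mul_le_of_le_one_right (by positivity) (hA i j)
  | more k ih ih' =>
    rw [expCoeff_add_two, norm_mul, norm_inv, norm_theta_pow_sub (by omega)]
    have hinv : 0 ≤ ((Fintype.card F : ℝ) ^ (Fintype.card F ^ (k + 2)))⁻¹ := by positivity
    have h1 : ‖∑ l, A i l * expCoeff A (k + 1) l j ^ Fintype.card F‖
        ≤ expBound F (k + 1) ^ Fintype.card F := by
      have := norm_pi_sum_mul_le Finset.univ (A i) (fun l => expCoeff A (k + 1) l j ^ Fintype.card F)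
        zero_le_one (pow_nonneg (expBound_nonneg (F := F) (k + 1)) (Fintype.card F))
        (fun l _ => hA i l) (fun l _ => by
          rw [norm_pow]; exact pow_le_pow_left₀ (norm_nonneg _) (ih' l j) _)
      simpa using this
    have h2 : ‖expCoeff A k i j ^ (Fintype.card F ^ 2)‖ ≤ expBound F k ^ (Fintype.card F ^ 2) := by
      rw [norm_pow]; exact pow_le_pow_left₀ (norm_nonneg _) (ih i j) _
    refine (mul_le_mul_of_nonneg_left (IsUltrametricDist.norm_add_le_max _ _) hinv).trans ?_
    rw [mul_max_of_nonneg _ _ hinv]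
    refine max_le ?_ ?_
    · exact (mul_le_mul_of_nonneg_left h1 hinv).trans (expBound_rec_succ_le k)
    · exact (mul_le_mul_of_nonneg_left h2 hinv).trans (expBound_rec k).le

/-- In the difference of the two recursions the A-term carries the factor ε directly, since it is
absent for A = 0. The other term is a q²-th power of an earlier difference and carries ε^(q²) ≤ ε.
-/
theorem norm_expCoeff_sub_le {ε : ℝ} (hε0 : 0 ≤ ε) (hε : ε ≤ 1) (hA : ∀ i j, ‖A i j‖ ≤ ε)
    (k : ℕ) (i j : Fin n) :
    ‖expCoeff A k i j - expCoeff 0 k i j‖ ≤ ε * expBound F k := by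
  have hA1 : ∀ i j, ‖A i j‖ ≤ 1 := fun i j => (hA i j).trans hε
  induction k using Nat.twoStepInduction generalizing i j with
  | zero =>
    simp only [expCoeff, sub_self, norm_zero]
    exact mul_nonneg hε0 (expBound_nonneg 0)
  | one =>
    rw [expCoeff_one, expCoeff_one, Matrix.zero_apply, mul_zero, sub_zero, norm_mul, norm_inv,
      norm_theta_pow_sub le_rfl, expBound, mul_comm]
    simpa using mul_le_mul_of_nonneg_right (hA i j) (by positivity)
  | more k ih _ =>
    have hfr : expCoeff A k i j ^ (Fintype.card F ^ 2) - expCoeff 0 k i j ^ (Fintype.card F ^ 2)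
        = (expCoeff A k i j - expCoeff 0 k i j) ^ (Fintype.card F ^ 2) :=
      (map_sub (CInf.frob (F := F) 2) _ _).symm
    have hD : expCoeff A (k + 2) i j - expCoeff 0 (k + 2) i j
        = (CInf.theta F ^ (Fintype.card F ^ (k + 2)) - CInf.theta F)⁻¹ *
          (∑ l, A i l * expCoeff A (k + 1) l j ^ Fintype.card F
            + (expCoeff A k i j - expCoeff 0 k i j) ^ (Fintype.card F ^ 2)) := by
      rw [← hfr, expCoeff_add_two, expCoeff_add_two]
      simp only [Matrix.zero_apply, zero_mul, Finset.sum_const_zero, zero_add]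
      ring
    rw [hD, norm_mul, norm_inv, norm_theta_pow_sub (by omega)]
    have hinv : 0 ≤ ((Fintype.card F : ℝ) ^ (Fintype.card F ^ (k + 2)))⁻¹ := by positivity
    have h1 : ‖∑ l, A i l * expCoeff A (k + 1) l j ^ Fintype.card F‖
        ≤ ε * expBound F (k + 1) ^ Fintype.card F :=
      norm_pi_sum_mul_le Finset.univ (A i) (fun l => expCoeff A (k + 1) l j ^ Fintype.card F)
        hε0 (pow_nonneg (expBound_nonneg (F := F) (k + 1)) (Fintype.card F))
        (fun l _ => hA i l) (fun l _ => by
          rw [norm_pow]; exact pow_le_pow_left₀ (norm_nonneg _) (norm_expCoeff_le hA1 _ l j) _)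
    have h2 : ‖(expCoeff A k i j - expCoeff 0 k i j) ^ (Fintype.card F ^ 2)‖
        ≤ ε * expBound F k ^ (Fintype.card F ^ 2) := by
      rw [norm_pow]
      refine (pow_le_pow_left₀ (norm_nonneg _) (ih i j) _).trans ?_
      rw [mul_pow]
      refine mul_le_mul_of_nonneg_right (pow_le_of_le_one hε0 hε ?_)
        (pow_nonneg (expBound_nonneg (F := F) k) _)
      exact pow_ne_zero _ Fintype.card_ne_zero
    refine (mul_le_mul_of_nonneg_left (IsUltrametricDist.norm_add_le_max _ _) hinv).trans ?_
    rw [mul_max_of_nonneg _ _ hinv]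
    refine max_le ?_ ?_
    · refine (mul_le_mul_of_nonneg_left h1 hinv).trans ?_
      rw [mul_left_comm]
      exact mul_le_mul_of_nonneg_left (expBound_rec_succ_le k) hε0
    · refine (mul_le_mul_of_nonneg_left h2 hinv).trans ?_
      rw [mul_left_comm]
      exact mul_le_mul_of_nonneg_left (expBound_rec k).le hε0

/-- The terms of the series `∑ₖ Cₖ z⁽ᵏ⁾`. -/
def seriesTerm (C : ℕ → Matrix (Fin n) (Fin n) (CInf F)) (z : Fin n → CInf F) (k : ℕ) :
    Fin n → CInf F := fun i => ∑ j, C k i j * z j ^ (Fintype.card F ^ k)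

theorem norm_seriesTerm_le {C : ℕ → Matrix (Fin n) (Fin n) (CInf F)} {k : ℕ} {b : ℝ} (hb : 0 ≤ b)
    (hC : ∀ i j, ‖C k i j‖ ≤ b) (z : Fin n → CInf F) :
    ‖seriesTerm C z k‖ ≤ b * ‖z‖ ^ (Fintype.card F ^ k) := by
  refine (pi_norm_le_iff_of_nonneg (by positivity)).2 fun i => ?_
  exact norm_pi_sum_mul_le Finset.univ (C k i) _ hb (by positivity) (fun j _ => hC i j)
    fun j _ => by rw [norm_pow]; exact pow_le_pow_left₀ (norm_nonneg _) (norm_le_pi_norm z j) _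

theorem seriesTerm_add (C : ℕ → Matrix (Fin n) (Fin n) (CInf F)) (z w : Fin n → CInf F) (k : ℕ) :
    seriesTerm C (z + w) k = seriesTerm C z k + seriesTerm C w k := by
  funext i
  simp only [seriesTerm, Pi.add_apply, CInf.add_pow_card_pow, mul_add, Finset.sum_add_distrib]

variable (A) in
/-- The exponential of `M(A)` in coordinates. -/
def expMap (z : Fin n → CInf F) : Fin n → CInf F := ∑' k, seriesTerm (expCoeff A) z k

theorem hasSum_expMap (hA : ∀ i j, ‖A i j‖ ≤ 1) (z : Fin n → CInf F) :
    HasSum (seriesTerm (expCoeff A) z) (expMap A z) := by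
  refine Summable.hasSum (NonarchimedeanAddGroup.summable_of_tendsto_cofinite_zero ?_)
  rw [Nat.cofinite_eq_atTop]
  exact squeeze_zero_norm (fun k => norm_seriesTerm_le (expBound_nonneg k) (norm_expCoeff_le hA k) z)
    (tendsto_expBound_mul_pow ‖z‖ (norm_nonneg z))

theorem expMap_add (hA : ∀ i j, ‖A i j‖ ≤ 1) (z w : Fin n → CInf F) :
    expMap A (z + w) = expMap A z + expMap A w := by
  refine (hasSum_expMap hA (z + w)).unique ?_
  rw [show seriesTerm (expCoeff A) (z + w) = _ from funext (seriesTerm_add _ z w)]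
  exact (hasSum_expMap hA z).add (hasSum_expMap hA w)

/-- The exponential as an additive map. -/
def expHom (hA : ∀ i j, ‖A i j‖ ≤ 1) : (Fin n → CInf F) →+ (Fin n → CInf F) :=
  AddMonoidHom.mk' (expMap A) (expMap_add hA)

theorem expMap_zero (hA : ∀ i j, ‖A i j‖ ≤ 1) : expMap A 0 = 0 := map_zero (expHom hA)

theorem expMap_sub (hA : ∀ i j, ‖A i j‖ ≤ 1) (z w : Fin n → CInf F) :
    expMap A (z - w) = expMap A z - expMap A w := map_sub (expHom hA) z w

theorem tAct_add (x y : Fin n → CInf F) : tAct A (x + y) = tAct A x + tAct A y := by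
  funext i
  have h := fun l => CInf.add_pow_card_pow (x l) (y l) 1
  simp only [pow_one] at h
  simp only [tAct, Pi.add_apply, CInf.add_pow_card_pow, h, mul_add, Finset.sum_add_distrib]
  ring

variable (A) in
/-- The action of `T` on `E(M(A))` as an additive map. -/
def tActHom : (Fin n → CInf F) →+ (Fin n → CInf F) := AddMonoidHom.mk' (tAct A) tAct_add

theorem tAct_zero : tAct A 0 = 0 := map_zero (tActHom A)

theorem tAct_sub (x y : Fin n → CInf F) : tAct A (x - y) = tAct A x - tAct A y :=
  map_sub (tActHom A) x y

theorem continuous_pow_card (l : Fin n) (m : ℕ) :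
    Continuous fun x : Fin n → CInf F => x l ^ m := (continuous_apply l).pow m

/-- The recursion for the coefficients is this functional equation compared term by term: θ^(q^k)
t_k = θ t_k + A t_{k-1}^(1) + t_{k-2}^(2). -/
theorem expMap_theta_smul (hA : ∀ i j, ‖A i j‖ ≤ 1) (z : Fin n → CInf F) :
    expMap A (CInf.theta F • z) = tAct A (expMap A z) := by
  set t := seriesTerm (expCoeff A) z with ht
  have hsum : HasSum t (expMap A z) := hasSum_expMap hA z
  set φ₁ : (Fin n → CInf F) →+ (Fin n → CInf F) := AddMonoidHom.mk'
    (fun x i => ∑ l, A i l * x l ^ Fintype.card F) (fun x y => by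
      funext i
      have h := fun l => CInf.add_pow_card_pow (x l) (y l) 1
      simp only [pow_one] at h
      simp only [Pi.add_apply, h, mul_add, Finset.sum_add_distrib]) with hφ₁
  set φ₂ : (Fin n → CInf F) →+ (Fin n → CInf F) := AddMonoidHom.mk'
    (fun x i => x i ^ (Fintype.card F ^ 2)) (fun x y => by
      funext i
      simp only [Pi.add_apply, CInf.add_pow_card_pow]) with hφ₂
  have h1 : HasSum (fun k => φ₁ (t k)) (φ₁ (expMap A z)) :=
    hsum.map φ₁ (show Continuous fun (x : Fin n → CInf F) i => ∑ l, A i l * x l ^ Fintype.card F from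
      continuous_pi fun i => continuous_finsetSum _ fun l _ =>
        continuous_const.mul (continuous_pow_card l _))
  have h2 : HasSum (fun k => φ₂ (t k)) (φ₂ (expMap A z)) :=
    hsum.map φ₂ (continuous_pi fun i => continuous_pow_card i _)
  -- Both Frobenius images are shifted, by one and by two places and padded with zeros, so that
  -- terms containing z^(k) stand at index k.
  set u₁ : ℕ → Fin n → CInf F := fun k => if k = 0 then 0 else φ₁ (t (k - 1)) with hu₁
  set u₂ : ℕ → Fin n → CInf F := fun k => if k ≤ 1 then 0 else φ₂ (t (k - 2)) with hu₂
  have h1' : HasSum u₁ (φ₁ (expMap A z)) := by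
    rw [← hasSum_nat_add_iff' 1]
    simpa [hu₁] using h1
  have h2' : HasSum u₂ (φ₂ (expMap A z)) := by
    rw [← hasSum_nat_add_iff' 2]
    simpa [hu₂, Finset.sum_range_succ] using h2
  have h3 := ((hsum.const_smul (CInf.theta F)).add h1').add h2'
  have hval : tAct A (expMap A z) = CInf.theta F • expMap A z + φ₁ (expMap A z) + φ₂ (expMap A z) :=
    rfl
  rw [hval]
  refine (hasSum_expMap hA (CInf.theta F • z)).unique ?_
  convert h3 using 1
  funext k i
  have hθ : seriesTerm (expCoeff A) (CInf.theta F • z) k i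
      = CInf.theta F ^ (Fintype.card F ^ k) * t k i := by
    rw [ht, seriesTerm, seriesTerm, Finset.mul_sum]
    refine Finset.sum_congr rfl fun j _ => ?_
    rw [Pi.smul_apply, smul_eq_mul, mul_pow]; ring
  rw [hθ]
  rcases k with _ | _ | k
  · simp [hu₁, hu₂]
  · have : u₁ 1 i = (CInf.theta F ^ (Fintype.card F ^ 1) - CInf.theta F) * t 1 i := by
      simp only [hu₁, one_ne_zero, if_false, Nat.sub_self, hφ₁, AddMonoidHom.mk'_apply, ht,
        seriesTerm, expCoeff_one, Finset.mul_sum]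
      refine Finset.sum_congr rfl fun j _ => ?_
      have hj : ∑ x, expCoeff A 0 j x * z x ^ Fintype.card F ^ 0 = z j := by
        simp [expCoeff, Matrix.one_apply]
      rw [hj, pow_one]
      have hne := theta_pow_sub_ne_zero (F := F) (k := 1) le_rfl
      rw [pow_one] at hne
      field_simp
    have h0 : u₂ 1 i = 0 := by simp [hu₂]
    simp only [Pi.add_apply, Pi.smul_apply, smul_eq_mul, zero_add, this, h0]
    ring
  · have e1 : u₁ (k + 2) i + u₂ (k + 2) i
        = (CInf.theta F ^ (Fintype.card F ^ (k + 2)) - CInf.theta F) * t (k + 2) i := by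
      have hne := theta_pow_sub_ne_zero (F := F) (k := k + 2) (by omega)
      have ha : u₁ (k + 2) i = ∑ j, (∑ l, A i l * expCoeff A (k + 1) l j ^ Fintype.card F)
          * z j ^ (Fintype.card F ^ (k + 2)) := by
        simp only [hu₁, hφ₁, ht]
        rw [if_neg (by omega), AddMonoidHom.mk'_apply]
        simp only [Finset.sum_mul]
        rw [Finset.sum_comm]
        refine Finset.sum_congr rfl fun l _ => ?_
        have hf := map_sum (CInf.frob (F := F) 1)
          (fun x => expCoeff A (k + 1) l x * z x ^ Fintype.card F ^ (k + 1)) Finset.univ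
        simp only [CInf.frob_apply, pow_one] at hf
        rw [show k + 2 - 1 = k + 1 from rfl, seriesTerm, hf, Finset.mul_sum]
        refine Finset.sum_congr rfl fun j _ => ?_
        rw [mul_pow, ← pow_mul, ← pow_succ, mul_assoc]
      have hb : u₂ (k + 2) i = ∑ j, expCoeff A k i j ^ (Fintype.card F ^ 2)
          * z j ^ (Fintype.card F ^ (k + 2)) := by
        simp only [hu₂, hφ₂, ht]
        rw [if_neg (by omega), AddMonoidHom.mk'_apply]
        have hf := map_sum (CInf.frob (F := F) 2)
          (fun x => expCoeff A k i x * z x ^ Fintype.card F ^ k) Finset.univ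
        simp only [CInf.frob_apply] at hf
        rw [show k + 2 - 2 = k from rfl, seriesTerm, hf]
        refine Finset.sum_congr rfl fun j _ => ?_
        rw [mul_pow, ← pow_mul, ← pow_add]
      rw [ha, hb, ← Finset.sum_add_distrib, ht, seriesTerm, Finset.mul_sum]
      refine Finset.sum_congr rfl fun j _ => ?_
      rw [expCoeff_add_two]
      field_simp
    simp only [Pi.add_apply, Pi.smul_apply, smul_eq_mul]
    rw [show k + 1 + 1 = k + 2 from rfl, add_assoc, e1]
    ring

end Motive


namespace Motive

variable {F : Type*} [Field F] [Fintype F] {n : ℕ} {A : Matrix (Fin n) (Fin n) (CInf F)}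

/-! ### The exponential on small balls -/

theorem norm_expMap_sub_le (hA : ∀ i j, ‖A i j‖ ≤ 1) {z : Fin n → CInf F} {r : ℝ} (hz : ‖z‖ ≤ r)
    (hr : r ≤ periodRadius F) : ‖expMap A z - z‖ ≤ contraction F r * ‖z‖ := by
  have h0 : seriesTerm (expCoeff A) z 0 = z := by
    funext i
    simp [seriesTerm, expCoeff, Matrix.one_apply]
  have h1 := (hasSum_nat_add_iff' 1).2 (hasSum_expMap hA z)
  rw [Finset.sum_range_one, h0] at h1
  rw [← h1.tsum_eq]
  refine IsUltrametricDist.norm_tsum_le_of_forall_le_of_nonneg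
    (mul_nonneg (contraction_nonneg r) (norm_nonneg z)) fun k => ?_
  exact (norm_seriesTerm_le (expBound_nonneg _) (norm_expCoeff_le hA _) z).trans
    (expBound_mul_pow_le (by omega) (norm_nonneg z) hz hr)

/-- The correction Exp z - z is strictly smaller than z, so the ultrametric inequality becomes an
equality. -/
theorem norm_expMap (hA : ∀ i j, ‖A i j‖ ≤ 1) {z : Fin n → CInf F} (hz : ‖z‖ < periodRadius F) :
    ‖expMap A z‖ = ‖z‖ := by
  rcases eq_or_ne z 0 with rfl | h0
  · rw [expMap_zero hA]
  · have hpos : 0 < ‖z‖ := norm_pos_iff.2 h0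
    have h1 : ‖expMap A z - z‖ < ‖z‖ := (norm_expMap_sub_le hA le_rfl hz.le).trans_lt
      (mul_lt_of_lt_one_left hpos (contraction_lt_one hz))
    have h2 : expMap A z = z + (expMap A z - z) := by abel
    rw [h2, IsUltrametricDist.norm_add_eq_max_of_norm_ne_norm h1.ne', max_eq_left h1.le]

theorem eq_zero_of_expMap_eq_zero (hA : ∀ i j, ‖A i j‖ ≤ 1) {z : Fin n → CInf F}
    (hz : ‖z‖ < periodRadius F) (h : expMap A z = 0) : z = 0 := by
  rw [← norm_eq_zero, ← norm_expMap hA hz, h, norm_zero]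

theorem exists_expMap_eq (hA : ∀ i j, ‖A i j‖ ≤ 1) {x : Fin n → CInf F}
    (hx : ‖x‖ < periodRadius F) : ∃ z, ‖z‖ = ‖x‖ ∧ expMap A z = x := by
  -- A fixed point of f solves Exp z = x. By additivity of Exp, the map f contracts the closed ball
  -- of radius ‖x‖ with factor `contraction F ‖x‖`, which is less than 1.
  set f : (Fin n → CInf F) → (Fin n → CInf F) := fun z => x - (expMap A z - z) with hf
  set B : Set (Fin n → CInf F) := Metric.closedBall 0 ‖x‖ with hB
  have hmaps : Set.MapsTo f B B := by
    intro z hz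
    rw [hB, mem_closedBall_zero_iff] at hz ⊢
    rw [hf]
    have h1 : ‖expMap A z - z‖ ≤ ‖x‖ := (norm_expMap_sub_le hA hz hx.le).trans
      ((mul_le_of_le_one_left (norm_nonneg z) (contraction_le_one hx.le)).trans hz)
    have h2 : x - (expMap A z - z) = x + -(expMap A z - z) := by abel
    simp only [h2]
    exact (IsUltrametricDist.norm_add_le_max _ _).trans (max_le le_rfl (by rwa [norm_neg]))
  have hcontr : ContractingWith ⟨contraction F ‖x‖, contraction_nonneg _⟩ (hmaps.restrict f B B) := by
    refine ⟨by exact_mod_cast contraction_lt_one hx, LipschitzWith.of_dist_le_mul ?_⟩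
    rintro ⟨z, hz⟩ ⟨w, hw⟩
    rw [hB, mem_closedBall_zero_iff] at hz hw
    rw [Subtype.dist_eq, Subtype.dist_eq, dist_eq_norm, dist_eq_norm]
    have h1 : (hmaps.restrict f B B ⟨z, mem_closedBall_zero_iff.2 hz⟩ : Fin n → CInf F)
        - hmaps.restrict f B B ⟨w, mem_closedBall_zero_iff.2 hw⟩
        = -(expMap A (z - w) - (z - w)) := by
      simp only [Set.MapsTo.val_restrict_apply, hf, expMap_sub hA]
      abel
    rw [h1, norm_neg]
    refine norm_expMap_sub_le hA ?_ hx.le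
    rw [sub_eq_add_neg]
    exact (IsUltrametricDist.norm_add_le_max _ _).trans (max_le hz (by rwa [norm_neg]))
  have h0 : (0 : Fin n → CInf F) ∈ B := by rw [hB, mem_closedBall_zero_iff, norm_zero]; positivity
  obtain ⟨z, hzB, hz, -⟩ := ContractingWith.exists_fixedPoint' Metric.isClosed_closedBall.isComplete
    hmaps hcontr h0 (edist_ne_top _ _)
  rw [hB, mem_closedBall_zero_iff] at hzB
  have hz' : expMap A z = x := by
    have : x - (expMap A z - z) = z := hz
    rw [sub_eq_iff_eq_add] at this
    rw [this]
    abel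
  exact ⟨z, by rw [← norm_expMap hA (hzB.trans_lt hx), hz'], hz'⟩

theorem norm_expMap_sub_expMap_zero_le {ε : ℝ} (hε0 : 0 ≤ ε) (hε : ε ≤ 1)
    (hA : ∀ i j, ‖A i j‖ ≤ ε) {z : Fin n → CInf F} (hz : ‖z‖ ≤ periodRadius F) :
    ‖expMap A z - expMap 0 z‖ ≤ ε * ‖z‖ := by
  have hA1 : ∀ i j, ‖A i j‖ ≤ 1 := fun i j => (hA i j).trans hε
  have h01 : ∀ i j, ‖(0 : Matrix (Fin n) (Fin n) (CInf F)) i j‖ ≤ 1 := by simp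
  have h := (hasSum_expMap hA1 z).sub (hasSum_expMap h01 z)
  rw [← h.tsum_eq]
  refine IsUltrametricDist.norm_tsum_le_of_forall_le_of_nonneg (by positivity) fun k => ?_
  have hk : seriesTerm (expCoeff A) z k - seriesTerm (expCoeff 0) z k
      = seriesTerm (fun k i j => expCoeff A k i j - expCoeff 0 k i j) z k := by
    funext i
    simp only [seriesTerm, Pi.sub_apply, sub_mul, Finset.sum_sub_distrib]
  rw [hk]
  -- The terms of index 0 cancel because both series begin with z. For k ≥ 1 the factor `contraction
  -- F R` ≤ 1 is enough, so the closed ball is allowed.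
  rcases Nat.eq_zero_or_pos k with rfl | hk1
  · have : seriesTerm (fun k i j => expCoeff A k i j - expCoeff 0 k i j) z 0 = 0 := by
      funext i
      simp [seriesTerm, expCoeff]
    rw [this, norm_zero]
    positivity
  · refine (norm_seriesTerm_le (mul_nonneg hε0 (expBound_nonneg k))
      (norm_expCoeff_sub_le hε0 hε hA k) z).trans ?_
    rw [mul_assoc]
    refine mul_le_mul_of_nonneg_left ?_ hε0
    exact (expBound_mul_pow_le hk1 (norm_nonneg z) hz le_rfl).trans
      (mul_le_of_le_one_left (norm_nonneg z) (contraction_le_one le_rfl))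

/-! ### Uniqueness of the exponential -/

theorem norm_tAct_le (hA : ∀ i j, ‖A i j‖ ≤ 1) {x : Fin n → CInf F} (hx : ‖x‖ ≤ 1) :
    ‖tAct A x‖ ≤ Fintype.card F * ‖x‖ := by
  have hq := one_lt_card_real (F := F)
  have hx1 : ‖x‖ ≤ Fintype.card F * ‖x‖ := le_mul_of_one_le_left (norm_nonneg x) hq.le
  have hpow : ∀ m : ℕ, m ≠ 0 → ∀ l, ‖x l ^ m‖ ≤ Fintype.card F * ‖x‖ := by
    intro m hm l
    rw [norm_pow]
    exact ((pow_le_pow_left₀ (norm_nonneg _) (norm_le_pi_norm x l) m).trans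
      (pow_le_of_le_one (norm_nonneg x) hx hm)).trans hx1
  refine (pi_norm_le_iff_of_nonneg (by positivity)).2 fun i => ?_
  refine (IsUltrametricDist.norm_add_le_max _ _).trans (max_le
    ((IsUltrametricDist.norm_add_le_max _ _).trans (max_le ?_ ?_)) ?_)
  · rw [norm_mul, CInf.norm_theta]
    exact mul_le_mul_of_nonneg_left (norm_le_pi_norm x i) (by positivity)
  · have := norm_pi_sum_mul_le Finset.univ (A i) (fun l => x l ^ Fintype.card F) zero_le_one
      (show 0 ≤ Fintype.card F * ‖x‖ by positivity) (fun l _ => hA i l)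
      (fun l _ => hpow _ Fintype.card_ne_zero l)
    rwa [one_mul] at this
  · exact hpow _ (pow_ne_zero _ Fintype.card_ne_zero) i

theorem theta_smul_inv_smul (z : Fin n → CInf F) :
    CInf.theta F • (CInf.theta F)⁻¹ • z = z := by
  rw [smul_smul, mul_inv_cancel₀ CInf.theta_ne_zero, one_smul]

theorem norm_theta_inv_smul (z : Fin n → CInf F) :
    ‖(CInf.theta F)⁻¹ • z‖ = ‖z‖ / Fintype.card F := by
  rw [norm_smul, norm_inv, CInf.norm_theta, inv_mul_eq_div]

/-- Induction along `z ↦ θ z`: a property of vectors that holds near `0` and is inherited by `θ z`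
from `z` holds everywhere. -/
theorem forall_of_theta_smul {p : (Fin n → CInf F) → Prop} {δ : ℝ} (hδ : 0 < δ)
    (h0 : ∀ z, ‖z‖ ≤ δ → p z) (h : ∀ z, p z → p (CInf.theta F • z)) (z : Fin n → CInf F) : p z := by
  have key : ∀ (N : ℕ) (z : Fin n → CInf F), ‖z‖ ≤ δ * (Fintype.card F : ℝ) ^ N → p z := by
    intro N
    induction N with
    | zero => intro z hz; exact h0 z (by simpa using hz)
    | succ N ih =>
      intro z hz
      rw [← theta_smul_inv_smul z]
      refine h _ (ih _ ?_)
      rw [norm_theta_inv_smul, div_le_iff₀ card_pos_real, mul_assoc, ← pow_succ]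
      exact hz
  obtain ⟨N, hN⟩ := pow_unbounded_of_one_lt (‖z‖ / δ) (one_lt_card_real (F := F))
  refine key N z ?_
  rw [div_lt_iff₀ hδ] at hN
  linarith

/-- Near 0 the action of T expands by at most q, whereas passing from z to z/θ divides the bound
B‖z‖^q by q^q. Writing f(z) as T applied to f(z/θ) therefore gains a factor q^(1-q) ≤ 1/q, and
iteration gives f = 0 near 0. Equivariance propagates this to all z. -/
theorem eq_zero_of_theta_equivariant (hA : ∀ i j, ‖A i j‖ ≤ 1)
    {f : (Fin n → CInf F) → (Fin n → CInf F)} {B : ℝ} (hB : 0 < B)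
    (hf : ∀ z, ‖z‖ ≤ 1 → ‖f z‖ ≤ B * ‖z‖ ^ Fintype.card F)
    (hθ : ∀ z, f (CInf.theta F • z) = tAct A (f z)) (z : Fin n → CInf F) : f z = 0 := by
  have hq := one_lt_card_real (F := F)
  have hq0 := card_pos_real (F := F)
  -- Chosen so that f takes values in the unit ball, where `norm_tAct_le` applies.
  set δ : ℝ := min 1 B⁻¹ with hδ
  have hδ0 : 0 < δ := lt_min one_pos (inv_pos.2 hB)
  refine forall_of_theta_smul (p := fun z => f z = 0) hδ0 (fun z hz => ?_)
    (fun z hz => by rw [hθ, hz, tAct_zero]) z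
  have hsmall : ∀ z, ‖z‖ ≤ δ → ‖f z‖ ≤ 1 := by
    intro z hz
    have hz1 : ‖z‖ ≤ 1 := hz.trans (min_le_left _ _)
    calc ‖f z‖ ≤ B * ‖z‖ ^ Fintype.card F := hf z hz1
      _ ≤ B * B⁻¹ := mul_le_mul_of_nonneg_left ((pow_le_of_le_one (norm_nonneg z) hz1
          Fintype.card_ne_zero).trans (hz.trans (min_le_right _ _))) hB.le
      _ = 1 := mul_inv_cancel₀ hB.ne'
  have key : ∀ (N : ℕ) (z : Fin n → CInf F), ‖z‖ ≤ δ →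
      ‖f z‖ ≤ B * ‖z‖ ^ Fintype.card F / (Fintype.card F : ℝ) ^ N := by
    intro N
    induction N with
    | zero => intro z hz; simpa using hf z (hz.trans (min_le_left _ _))
    | succ N ih =>
      intro z hz
      have hz' : ‖(CInf.theta F)⁻¹ • z‖ ≤ δ := by
        rw [norm_theta_inv_smul]
        exact (div_le_self (norm_nonneg z) hq.le).trans hz
      have h1 := norm_tAct_le hA (hsmall _ hz')
      rw [← hθ, theta_smul_inv_smul] at h1
      refine h1.trans ((mul_le_mul_of_nonneg_left (ih _ hz') hq0.le).trans ?_)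
      rw [norm_theta_inv_smul, div_pow]
      have h2 : (Fintype.card F : ℝ) ^ 2 ≤ (Fintype.card F : ℝ) ^ Fintype.card F :=
        pow_le_pow_right₀ hq.le CInf.card_ge_two
      have h3 : ‖z‖ ^ Fintype.card F / (Fintype.card F : ℝ) ^ Fintype.card F
          ≤ ‖z‖ ^ Fintype.card F / (Fintype.card F : ℝ) ^ 2 :=
        div_le_div_of_nonneg_left (by positivity) (by positivity) h2
      calc _ ≤ (Fintype.card F : ℝ) * (B * (‖z‖ ^ Fintype.card F / (Fintype.card F : ℝ) ^ 2)
            / (Fintype.card F : ℝ) ^ N) := by gcongr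
        _ = _ := by field_simp; ring
  have hlim : Tendsto (fun N : ℕ => B * ‖z‖ ^ Fintype.card F / (Fintype.card F : ℝ) ^ N) atTop
      (𝓝 0) := tendsto_const_nhds.div_atTop (tendsto_pow_atTop_atTop_of_one_lt hq)
  have := ge_of_tendsto' hlim fun N => key N z hz
  exact norm_le_zero_iff.1 this

/-- Coefficients of an everywhere convergent series are bounded. -/
theorem exists_bound_coeff {C : ℕ → Matrix (Fin n) (Fin n) (CInf F)}
    (hC : ∀ z : Fin n → CInf F, ∀ i, Summable fun k => seriesTerm C z k i) :
    ∃ B : ℝ, 0 < B ∧ ∀ k i j, ‖C k i j‖ ≤ B := by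
  have h1 : ∀ i j, ∃ B : ℝ, ∀ k, ‖C k i j‖ ≤ B := by
    intro i j
    -- At a standard basis vector the terms of the series are the coefficients themselves.
    have ht := (hC (Pi.single j 1) i).tendsto_atTop_zero
    have heq : (fun k => seriesTerm C (Pi.single j 1) k i) = fun k => C k i j := by
      funext k
      rw [seriesTerm, Finset.sum_eq_single j]
      · simp
      · intro l _ hl
        simp [hl, Fintype.card_ne_zero]
      · simp
    rw [heq] at ht
    obtain ⟨B, hB⟩ := (Metric.isBounded_range_of_tendsto _ ht).exists_norm_le
    exact ⟨B, fun k => hB _ ⟨k, rfl⟩⟩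
  choose b hb using h1
  refine ⟨∑ i, ∑ j, |b i j| + 1, by positivity, fun k i j => ?_⟩
  have h2 : |b i j| ≤ ∑ j, |b i j| :=
    Finset.single_le_sum (f := fun j => |b i j|) (fun _ _ => abs_nonneg _) (Finset.mem_univ j)
  have h3 : ∑ j, |b i j| ≤ ∑ i, ∑ j, |b i j| :=
    Finset.single_le_sum (f := fun i => ∑ j, |b i j|)
      (fun _ _ => Finset.sum_nonneg fun _ _ => abs_nonneg _) (Finset.mem_univ i)
  linarith [hb i j k, le_abs_self (b i j)]

theorem norm_sub_le_of_hasSum {C : ℕ → Matrix (Fin n) (Fin n) (CInf F)} (hC0 : C 0 = 1) {B : ℝ}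
    (hB : 0 < B) (hC : ∀ k i j, ‖C k i j‖ ≤ B) {z x : Fin n → CInf F} (hz : ‖z‖ ≤ 1)
    (hx : ∀ i, HasSum (fun k => seriesTerm C z k i) (x i)) :
    ‖x - z‖ ≤ B * ‖z‖ ^ Fintype.card F := by
  have hx' : HasSum (seriesTerm C z) x := Pi.hasSum.2 hx
  have h0 : seriesTerm C z 0 = z := by
    funext i
    simp [seriesTerm, hC0, Matrix.one_apply]
  have h1 := (hasSum_nat_add_iff' 1).2 hx'
  rw [Finset.sum_range_one, h0] at h1
  rw [← h1.tsum_eq]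
  refine IsUltrametricDist.norm_tsum_le_of_forall_le_of_nonneg (by positivity) fun k => ?_
  refine (norm_seriesTerm_le hB.le (hC _) z).trans (mul_le_mul_of_nonneg_left ?_ hB.le)
  refine pow_le_pow_of_le_one (norm_nonneg z) hz ?_
  exact Nat.le_self_pow (by omega) _

/-! ### The lattice of `M(A)` as the kernel of the exponential -/

theorem exists_isExponential (hA : ∀ i j, ‖A i j‖ ≤ 1) :
    ∃ Exp : TLie F (Motive A) → TPoints F (Motive A), IsExponential (e A) Exp ∧
      ∀ z i, (Exp z : Motive A →+ CInf F) (e A i)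
        = expMap A (fun j => (z : Motive A →+ CInf F) (e A j)) i := by
  choose P hP using exists_tPoints (A := A)
  refine ⟨fun z => P (expMap A fun j => (z : Motive A →+ CInf F) (e A j)), ⟨?_, ?_⟩, fun z i => hP _ i⟩
  · refine ⟨expCoeff A, rfl, fun z i => ?_⟩
    rw [hP]
    exact Pi.hasSum.1 (hasSum_expMap hA _) i
  · intro z
    refine tPoints_ext fun i => ?_
    rw [hP, tPoints_T_e]
    simp only [hP, tLie_T_e]
    exact congrFun (expMap_theta_smul hA _) i

theorem isExponential_apply (hA : ∀ i j, ‖A i j‖ ≤ 1)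
    {Exp : TLie F (Motive A) → TPoints F (Motive A)} (hExp : IsExponential (e A) Exp)
    (z : TLie F (Motive A)) (i : Fin n) :
    (Exp z : Motive A →+ CInf F) (e A i)
      = expMap A (fun j => (z : Motive A →+ CInf F) (e A j)) i := by
  obtain ⟨C, hC0, hC⟩ := hExp.series
  choose P hP using exists_tLie (A := A)
  set f : (Fin n → CInf F) → (Fin n → CInf F) := fun v i =>
    (Exp (P v) : Motive A →+ CInf F) (e A i) with hf
  have hsum : ∀ v i, HasSum (fun k => seriesTerm C v k i) (f v i) := by
    intro v i
    have := hC (P v) i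
    simp only [hP] at this
    exact this
  obtain ⟨B, hB, hCB⟩ := exists_bound_coeff fun z i => (hsum z i).summable
  obtain ⟨B', hB', hCB'⟩ := exists_bound_coeff fun z i =>
    (Pi.hasSum.1 (hasSum_expMap hA z) i).summable
  have hzero : f (fun j => (z : Motive A →+ CInf F) (e A j))
      - expMap A (fun j => (z : Motive A →+ CInf F) (e A j)) = 0 := by
    -- Both series have C₀ = 1, so their difference is of order ‖v‖^q near 0.
    refine eq_zero_of_theta_equivariant hA (f := fun v => f v - expMap A v) (lt_max_of_lt_left hB)
      (B := max B B') (fun v hv => ?_) (fun v => ?_) _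
    · have h1 := norm_sub_le_of_hasSum hC0 hB hCB hv (hsum v)
      have h2 := norm_sub_le_of_hasSum rfl hB' hCB' hv (Pi.hasSum.1 (hasSum_expMap hA v))
      have h3 : f v - expMap A v = (f v - v) + -(expMap A v - v) := by abel
      rw [h3, max_mul_of_nonneg _ _ (by positivity)]
      exact (IsUltrametricDist.norm_add_le_max _ _).trans (max_le_max h1 (by rwa [norm_neg]))
    · have hPθ : P (CInf.theta F • v) = TLie.T (P v) :=
        tLie_ext fun i => by rw [hP, tLie_T_e, hP]; rfl
      rw [tAct_sub, expMap_theta_smul hA]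
      congr 1
      funext i
      simp only [hf, hPθ, hExp.equivariant, tPoints_T_e]
  have hPz : P (fun j => (z : Motive A →+ CInf F) (e A j)) = z := tLie_ext fun i => hP _ i
  have := congrFun (sub_eq_zero.1 hzero) i
  simp only [hf, hPz] at this
  exact this

theorem mem_motiveLattice (hA : ∀ i j, ‖A i j‖ ≤ 1) {v : Fin n → CInf F} :
    v ∈ motiveLattice A ↔ expMap A v = 0 := by
  constructor
  · rintro ⟨Exp, hExp, z, hz, h0⟩
    funext i
    have h1 := isExponential_apply hA hExp z i
    rw [h0, show (fun j => (z : Motive A →+ CInf F) (e A j)) = v from funext hz] at h1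
    exact h1.symm
  · intro h
    obtain ⟨Exp, hExp, hE⟩ := exists_isExponential hA
    obtain ⟨z, hz⟩ := exists_tLie (A := A) v
    refine ⟨Exp, hExp, z, hz, tPoints_ext fun i => ?_⟩
    rw [hE, show (fun j => (z : Motive A →+ CInf F) (e A j)) = v from funext hz, h]
    rfl

/-- For ‖x‖ > t the q²-th power strictly dominates θx and Ax^(1) at a coordinate of maximal absolute
value, so it cannot cancel. -/
theorem norm_le_of_tAct_eq_zero (hA : ∀ i j, ‖A i j‖ ≤ 1) {x : Fin n → CInf F}
    (h : tAct A x = 0) : ‖x‖ ≤ torsionRadius F := by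
  by_contra! hx
  have hq := one_lt_card_real (F := F)
  have hq2 := one_lt_card_sq (F := F)
  have hx1 : 1 < ‖x‖ := one_lt_torsionRadius.trans hx
  have hpow : ∀ i, ‖x i‖ ^ (Fintype.card F ^ 2) ≤ max (Fintype.card F * ‖x‖) (‖x‖ ^ Fintype.card F) := by
    intro i
    have h1 : x i ^ (Fintype.card F ^ 2)
        = -(CInf.theta F * x i + ∑ l, A i l * x l ^ Fintype.card F) := by
      have := congrFun h i
      simp only [tAct, Pi.zero_apply] at this
      linear_combination this
    rw [← norm_pow, h1, norm_neg]
    refine (IsUltrametricDist.norm_add_le_max _ _).trans (max_le_max ?_ ?_)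
    · rw [norm_mul, CInf.norm_theta]
      exact mul_le_mul_of_nonneg_left (norm_le_pi_norm x i) (by positivity)
    · have := norm_pi_sum_mul_le Finset.univ (A i) (fun l => x l ^ Fintype.card F) zero_le_one
        (pow_nonneg (norm_nonneg x) (Fintype.card F)) (fun l _ => hA i l)
        (fun l _ => by rw [norm_pow]; exact pow_le_pow_left₀ (norm_nonneg _) (norm_le_pi_norm x l) _)
      rwa [one_mul] at this
  have hlt : max (Fintype.card F * ‖x‖) (‖x‖ ^ Fintype.card F) < ‖x‖ ^ (Fintype.card F ^ 2) := by
    refine max_lt ?_ ?_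
    · have h1 : (Fintype.card F : ℝ) < ‖x‖ ^ (Fintype.card F ^ 2 - 1) := by
        conv_lhs => rw [← torsionRadius_pow]
        exact pow_lt_pow_left₀ hx torsionRadius_nonneg (by omega)
      calc _ < ‖x‖ ^ (Fintype.card F ^ 2 - 1) * ‖x‖ := by gcongr
        _ = _ := by rw [← pow_succ, Nat.sub_add_cancel hq2.le]
    · exact pow_lt_pow_right₀ hx1 (lt_self_pow₀ Fintype.one_lt_card (by norm_num))
  rcases isEmpty_or_nonempty (Fin n) with hn | hn
  · rw [Subsingleton.elim x 0, norm_zero] at hx1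
    linarith
  · obtain ⟨i, hi⟩ := Finite.exists_max fun i => ‖x i‖
    have : ‖x‖ = ‖x i‖ := le_antisymm
      ((pi_norm_le_iff_of_nonneg (norm_nonneg _)).2 hi) (norm_le_pi_norm x i)
    exact absurd (hpow i) (not_le.2 (by rw [← this]; exact hlt))

/-- The kernel of the exponential is an additive group stable under `θ`. If its elements of absolute
value at most `periodRadius F` lie in a `θ`-stable additive group `N`, so do all its elements. -/
theorem mem_of_expMap_eq_zero (hA : ∀ i j, ‖A i j‖ ≤ 1) (N : AddSubgroup (Fin n → CInf F))
    (hN : ∀ v ∈ N, CInf.theta F • v ∈ N)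
    (h : ∀ v, expMap A v = 0 → ‖v‖ ≤ periodRadius F → v ∈ N)
    {v : Fin n → CInf F} (hv : expMap A v = 0) : v ∈ N := by
  have hq := one_lt_card_real (F := F)
  have hM := periodRadius_pos (F := F)
  have key : ∀ (m : ℕ) (v : Fin n → CInf F), ‖v‖ ≤ periodRadius F * (Fintype.card F : ℝ) ^ m →
      expMap A v = 0 → v ∈ N := by
    intro m
    induction m with
    | zero => intro v hv h0; exact h v h0 (by simpa using hv)
    | succ m ih =>
      intro v hv h0
      -- Dividing the period by θ gives a T-torsion point. Its small logarithm w splits v into θw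
      -- and θ times the period v/θ - w, to which the induction hypothesis applies.
      have htor : tAct A (expMap A ((CInf.theta F)⁻¹ • v)) = 0 := by
        rw [← expMap_theta_smul hA, theta_smul_inv_smul, h0]
      have hs := norm_le_of_tAct_eq_zero hA htor
      obtain ⟨w, hw, hwx⟩ := exists_expMap_eq hA (hs.trans_lt torsionRadius_lt_periodRadius)
      have h1 : CInf.theta F • w ∈ N := by
        refine h _ ?_ ?_
        · rw [expMap_theta_smul hA, hwx, htor]
        · rw [norm_smul, CInf.norm_theta, hw]
          exact mul_le_mul_of_nonneg_left hs (by positivity)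
      have h2 : (CInf.theta F)⁻¹ • v - w ∈ N := by
        refine ih _ ?_ ?_
        · rw [sub_eq_add_neg]
          refine (IsUltrametricDist.norm_add_le_max _ _).trans (max_le ?_ ?_)
          · rw [norm_theta_inv_smul, div_le_iff₀ card_pos_real, mul_assoc, ← pow_succ]
            exact hv
          · rw [norm_neg, hw]
            refine (hs.trans torsionRadius_lt_periodRadius.le).trans ?_
            exact le_mul_of_one_le_right hM.le (one_le_pow₀ hq.le)
        · rw [expMap_sub hA, hwx, sub_self]
      have h3 : v = CInf.theta F • ((CInf.theta F)⁻¹ • v - w) + CInf.theta F • w := by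
        rw [← smul_add, sub_add_cancel, theta_smul_inv_smul]
      rw [h3]
      exact add_mem (hN _ h2) h1
  obtain ⟨m, hm⟩ := pow_unbounded_of_one_lt (‖v‖ / periodRadius F) hq
  rw [div_lt_iff₀ hM] at hm
  exact key m v (by linarith) hv

end Motive


/-! ## Orthonormal families over nonarchimedean fields -/

section NormOrthonormal

variable {K : Type*} [NormedField K] {E : Type*} [NormedAddCommGroup E] [NormedSpace K E]
  {ι : Type*} [Fintype ι]

variable (K) in
/-- The family `b` is orthonormal in the nonarchimedean sense. -/
def IsNormOrthonormal (b : ι → E) : Prop := ∀ a : ι → K, ‖∑ i, a i • b i‖ = ‖a‖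

theorem IsNormOrthonormal.linearIndependent {b : ι → E} (hb : IsNormOrthonormal K b) :
    LinearIndependent K b := by
  rw [Fintype.linearIndependent_iff]
  intro g hg i
  have := hb g
  rw [hg, norm_zero] at this
  exact congrFun (norm_eq_zero.1 this.symm) i

theorem norm_sum_smul_le [IsUltrametricDist E] {a : ι → K} {d : ι → E} {α δ : ℝ} (hα : 0 ≤ α)
    (hδ : 0 ≤ δ) (ha : ∀ i, ‖a i‖ ≤ α) (hd : ∀ i, ‖d i‖ ≤ δ) : ‖∑ i, a i • d i‖ ≤ α * δ := by
  refine IsUltrametricDist.norm_sum_le_of_forall_le_of_nonneg (by positivity) fun i _ => ?_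
  rw [norm_smul]
  exact mul_le_mul (ha i) (hd i) (norm_nonneg _) hα

theorem exists_lt_one_of_forall_norm_lt_one {d : ι → E} (hd : ∀ i, ‖d i‖ < 1) :
    ∃ δ : ℝ, 0 ≤ δ ∧ δ < 1 ∧ ∀ i, ‖d i‖ ≤ δ :=
  ⟨‖d‖, norm_nonneg _, (pi_norm_lt_iff one_pos).2 hd, norm_le_pi_norm d⟩

/-- A small perturbation of an orthonormal family is orthonormal. -/
theorem IsNormOrthonormal.of_norm_sub_lt_one [IsUltrametricDist E] {b b' : ι → E}
    (hb : IsNormOrthonormal K b) (h : ∀ i, ‖b' i - b i‖ < 1) : IsNormOrthonormal K b' := by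
  intro a
  obtain ⟨δ, hδ0, hδ1, hδ⟩ := exists_lt_one_of_forall_norm_lt_one h
  have h1 : ∑ i, a i • b' i = ∑ i, a i • b i + ∑ i, a i • (b' i - b i) := by
    rw [← Finset.sum_add_distrib]
    exact Finset.sum_congr rfl fun i _ => by rw [← smul_add, add_sub_cancel]
  rcases eq_or_ne a 0 with rfl | ha
  · simp
  · have h2 : ‖∑ i, a i • (b' i - b i)‖ < ‖a‖ :=
      (norm_sum_smul_le (norm_nonneg a) hδ0 (norm_le_pi_norm a) hδ).trans_lt
        (mul_lt_of_lt_one_right (norm_pos_iff.2 ha) hδ1)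
    rw [h1, IsUltrametricDist.norm_add_eq_max_of_norm_ne_norm, hb a, max_eq_left h2.le]
    rw [hb a]
    exact h2.ne'

end NormOrthonormal

/-! ## Lattices close to `𝔏(ω Eₙ)` -/

section Lattice

variable {F : Type*} [Field F] [Fintype F] {n : ℕ}

/-! ### Comparison of scalars: F[θ] inside F((1/θ)) inside C∞ -/

theorem exists_algebraMap_eq_zInf (a : ZInf F) :
    ∃ a' : RInf F, algebraMap (RInf F) (CInf F) a' = a := by
  obtain ⟨a, ha⟩ := a
  induction ha using Algebra.adjoin_induction with
  | mem x hx => exact ⟨_, (Set.mem_singleton_iff.1 hx).symm⟩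
  | algebraMap c => exact ⟨_, (CInf.algebraMap_eq c).symm⟩
  | add x y hx hy ihx ihy =>
    obtain ⟨x', hx'⟩ := ihx
    obtain ⟨y', hy'⟩ := ihy
    exact ⟨x' + y', by rw [map_add, hx', hy']⟩
  | mul x y hx hy ihx ihy =>
    obtain ⟨x', hx'⟩ := ihx
    obtain ⟨y', hy'⟩ := ihy
    exact ⟨x' * y', by rw [map_mul, hx', hy']⟩

theorem rInf_smul_eq (a : RInf F) (v : Fin n → CInf F) :
    a • v = algebraMap (RInf F) (CInf F) a • v := (algebraMap_smul (CInf F) a v).symm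

theorem zInf_smul_eq (a : ZInf F) (v : Fin n → CInf F) : a • v = (a : CInf F) • v := rfl

theorem exists_rInf_smul_eq (a : ZInf F) :
    ∃ a' : RInf F, algebraMap (RInf F) (CInf F) a' = a ∧ ∀ v : Fin n → CInf F, a • v = a' • v := by
  obtain ⟨a', ha'⟩ := exists_algebraMap_eq_zInf a
  exact ⟨a', ha', fun v => by rw [rInf_smul_eq, ha', zInf_smul_eq]⟩

theorem linearIndependent_zInf {ι : Type*} [Fintype ι] {b : ι → Fin n → CInf F}
    (hb : LinearIndependent (RInf F) b) : LinearIndependent (ZInf F) b := by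
  rw [Fintype.linearIndependent_iff] at hb ⊢
  intro g hg i
  choose a ha ha' using fun i => exists_rInf_smul_eq (n := n) (g i)
  simp only [ha'] at hg
  have := ha i
  rw [hb a hg i, map_zero] at this
  exact Subtype.ext this.symm

theorem span_rInf_span_zInf (s : Set (Fin n → CInf F)) :
    Submodule.span (RInf F) (Submodule.span (ZInf F) s : Set (Fin n → CInf F))
      = Submodule.span (RInf F) s := by
  refine le_antisymm (Submodule.span_le.2 fun v hv => ?_) (Submodule.span_mono Submodule.subset_span)
  change v ∈ Submodule.span (ZInf F) s at hv
  change v ∈ Submodule.span (RInf F) s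
  induction hv using Submodule.span_induction with
  | mem x hx => exact Submodule.subset_span hx
  | zero => exact zero_mem _
  | add x y _ _ hx hy => exact add_mem hx hy
  | smul a x _ hx =>
    obtain ⟨a', -, ha'⟩ := exists_rInf_smul_eq (n := n) a
    rw [ha']
    exact Submodule.smul_mem _ _ hx

/-- The `F[θ]`-span of a family of `2n` vectors that is independent over `F((1/θ))` and generates
`C∞ⁿ` is a lattice. -/
theorem isLattice_span {b : Fin n ⊕ Fin n → Fin n → CInf F} (hb : LinearIndependent (RInf F) b)
    (hC : Submodule.span (CInf F) (Set.range b) = ⊤) :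
    IsLattice (2 * n) (Submodule.span (ZInf F) (Set.range b) : Set (Fin n → CInf F)) where
  free := by
    let σ : Fin (2 * n) ≃ Fin n ⊕ Fin n := (finCongr (two_mul n)).trans finSumFinEquiv.symm
    refine ⟨b ∘ σ, (linearIndependent_zInf hb).comp σ σ.injective, ?_⟩
    rw [Set.range_comp, σ.range_eq_univ, Set.image_univ]
  span_eq_top := by
    rw [eq_top_iff, ← hC]
    exact Submodule.span_mono Submodule.subset_span
  finrank_envelope := by
    rw [span_rInf_span_zInf, finrank_span_eq_card hb, Fintype.card_sum, Fintype.card_fin, two_mul]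

theorem span_range_eq_image {ι : Type*} (g : (Fin n → CInf F) ≃ₗ[CInf F] (Fin n → CInf F))
    (b : ι → Fin n → CInf F) :
    (Submodule.span (ZInf F) (Set.range fun i => g (b i)) : Set (Fin n → CInf F))
      = g '' (Submodule.span (ZInf F) (Set.range b) : Set (Fin n → CInf F)) := by
  have h := Submodule.map_span ((g : (Fin n → CInf F) →ₗ[CInf F] (Fin n → CInf F)).restrictScalars
    (ZInf F)) (Set.range b)
  rw [← Set.range_comp] at h
  have h' := congrArg (fun S : Submodule (ZInf F) (Fin n → CInf F) => (S : Set (Fin n → CInf F))) h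
  exact h'.symm

variable {ω : CInf F}

theorem siegelBasis_inl (Z : Matrix (Fin n) (Fin n) (CInf F)) (i : Fin n) :
    siegelBasis Z (Sum.inl i) = Pi.single i 1 := rfl

theorem siegelBasis_inr (Z : Matrix (Fin n) (Fin n) (CInf F)) (i : Fin n) :
    siegelBasis Z (Sum.inr i) = Z i := rfl

theorem omega_one_row (i : Fin n) :
    ((ω • (1 : Matrix (Fin n) (Fin n) (CInf F))) i : Fin n → CInf F) = ω • Pi.single i 1 := by
  funext j
  simp [Matrix.one_apply, Pi.single_apply, eq_comm]

theorem sum_smul_siegelBasis_omega (a : Fin n ⊕ Fin n → CInf F) (j : Fin n) :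
    (∑ i, a i • siegelBasis (ω • (1 : Matrix (Fin n) (Fin n) (CInf F))) i) j
      = a (Sum.inl j) + a (Sum.inr j) * ω := by
  simp only [Fintype.sum_sum_type, siegelBasis_inl, siegelBasis_inr, omega_one_row]
  simp [Finset.sum_apply, Pi.single_apply]

/-- The j-th coordinate of a combination only involves one pair a + bω, so the claim is the
orthogonality of 1, ω in each coordinate. -/
theorem isNormOrthonormal_siegelBasis_omega (hω : ω ^ (Fintype.card F ^ 2) = ω)
    (hω' : ω ^ Fintype.card F ≠ ω) :
    IsNormOrthonormal (RInf F) (siegelBasis (ω • (1 : Matrix (Fin n) (Fin n) (CInf F)))) := by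
  intro a
  have hj : ∀ j, ‖(∑ i, a i • siegelBasis (ω • (1 : Matrix (Fin n) (Fin n) (CInf F))) i) j‖
      = max ‖a (Sum.inl j)‖ ‖a (Sum.inr j)‖ := by
    intro j
    simp only [rInf_smul_eq]
    rw [sum_smul_siegelBasis_omega (fun i => algebraMap (RInf F) (CInf F) (a i)),
      CInf.norm_add_mul_omega hω hω']
  refine le_antisymm ((pi_norm_le_iff_of_nonneg (norm_nonneg _)).2 fun j => ?_)
    ((pi_norm_le_iff_of_nonneg (norm_nonneg _)).2 ?_)
  · rw [hj]
    exact max_le (norm_le_pi_norm a _) (norm_le_pi_norm a _)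
  · rintro (j | j)
    · exact ((le_max_left _ _).trans (hj j).ge).trans (norm_le_pi_norm _ j)
    · exact ((le_max_right _ _).trans (hj j).ge).trans (norm_le_pi_norm _ j)

theorem isNormOrthonormal_single :
    IsNormOrthonormal (CInf F) fun i : Fin n => (Pi.single i 1 : Fin n → CInf F) := by
  intro a
  congr 1
  funext j
  simp [Finset.sum_apply, Pi.single_apply]

theorem span_range_eq_top_of_linearIndependent {b : Fin n → Fin n → CInf F}
    (hb : LinearIndependent (CInf F) b) : Submodule.span (CInf F) (Set.range b) = ⊤ :=
  hb.span_eq_top_of_card_eq_finrank' (by simp)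

theorem norm_siegelBasis_omega (hω : ω ^ (Fintype.card F ^ 2) = ω)
    (hω' : ω ^ Fintype.card F ≠ ω) (i : Fin n ⊕ Fin n) :
    ‖siegelBasis (ω • (1 : Matrix (Fin n) (Fin n) (CInf F))) i‖ = 1 := by
  classical
  have h := isNormOrthonormal_siegelBasis_omega (n := n) hω hω' (Pi.single i 1)
  rw [Pi.norm_single, norm_one, Finset.sum_eq_single i] at h
  · simpa using h
  · intro j _ hj
    simp [hj]
  · simp

/-- Independence and generation for a family close to the standard basis of `𝔏(ω Eₙ)`. -/
theorem linearIndependent_of_near (hω : ω ^ (Fintype.card F ^ 2) = ω)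
    (hω' : ω ^ Fintype.card F ≠ ω) {b : Fin n ⊕ Fin n → Fin n → CInf F}
    (hb : ∀ i, ‖b i - siegelBasis (ω • (1 : Matrix (Fin n) (Fin n) (CInf F))) i‖ < 1) :
    LinearIndependent (RInf F) b ∧ IsNormOrthonormal (CInf F) (fun i => b (Sum.inl i)) :=
  ⟨((isNormOrthonormal_siegelBasis_omega hω hω').of_norm_sub_lt_one hb).linearIndependent,
    isNormOrthonormal_single.of_norm_sub_lt_one fun i => hb (Sum.inl i)⟩

theorem span_range_eq_top_of_near (hω : ω ^ (Fintype.card F ^ 2) = ω)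
    (hω' : ω ^ Fintype.card F ≠ ω) {b : Fin n ⊕ Fin n → Fin n → CInf F}
    (hb : ∀ i, ‖b i - siegelBasis (ω • (1 : Matrix (Fin n) (Fin n) (CInf F))) i‖ < 1) :
    Submodule.span (CInf F) (Set.range b) = ⊤ := by
  rw [eq_top_iff, ← span_range_eq_top_of_linearIndependent
    (linearIndependent_of_near hω hω' hb).2.linearIndependent]
  refine Submodule.span_mono ?_
  rintro _ ⟨i, rfl⟩
  exact ⟨Sum.inl i, rfl⟩

/-- The maximum of the absolute values of the entries of a matrix. -/
def maxNorm (A : Matrix (Fin n) (Fin n) (CInf F)) : ℝ :=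
  ‖(fun i j => A i j : Fin n → Fin n → CInf F)‖

theorem maxNorm_nonneg (A : Matrix (Fin n) (Fin n) (CInf F)) : 0 ≤ maxNorm A := norm_nonneg _

theorem norm_apply_le_maxNorm (A : Matrix (Fin n) (Fin n) (CInf F)) (i j : Fin n) :
    ‖A i j‖ ≤ maxNorm A :=
  (norm_le_pi_norm (A i) j).trans (norm_le_pi_norm (fun i j => A i j : Fin n → Fin n → CInf F) i)

theorem norm_row_le_maxNorm (A : Matrix (Fin n) (Fin n) (CInf F)) (i : Fin n) :
    ‖(A i : Fin n → CInf F)‖ ≤ maxNorm A :=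
  norm_le_pi_norm (fun i j => A i j : Fin n → Fin n → CInf F) i

theorem maxNorm_lt_one {A : Matrix (Fin n) (Fin n) (CInf F)}
    (h : ∀ i, ‖(A i : Fin n → CInf F)‖ < 1) : maxNorm A < 1 := (pi_norm_lt_iff one_pos).2 h

theorem maxNorm_zero : maxNorm (0 : Matrix (Fin n) (Fin n) (CInf F)) = 0 :=
  norm_zero (E := Fin n → Fin n → CInf F)

theorem continuous_maxNorm : Continuous (maxNorm (F := F) (n := n)) :=
  continuous_norm (E := Fin n → Fin n → CInf F)

theorem norm_siegelBasis_sub_lt_one {Z : Matrix (Fin n) (Fin n) (CInf F)}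
    (hZ : maxNorm (Z - ω • 1) < 1) (i : Fin n ⊕ Fin n) :
    ‖siegelBasis Z i - siegelBasis (ω • (1 : Matrix (Fin n) (Fin n) (CInf F))) i‖ < 1 := by
  rcases i with i | i
  · rw [siegelBasis_inl, siegelBasis_inl, sub_self, norm_zero]
    exact one_pos
  · exact (norm_row_le_maxNorm (Z - ω • 1) i).trans_lt hZ

theorem mem_siegelMatrices (hω : ω ^ (Fintype.card F ^ 2) = ω) (hω' : ω ^ Fintype.card F ≠ ω)
    {Z : Matrix (Fin n) (Fin n) (CInf F)} (hZ : maxNorm (Z - ω • 1) < 1) :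
    Z ∈ siegelMatrices F n := by
  have hb := norm_siegelBasis_sub_lt_one hZ
  have h := linearIndependent_of_near hω hω' hb
  refine ⟨_, siegelBasis Z, isLattice_span h.1 (span_range_eq_top_of_near hω hω' hb),
    ⟨linearIndependent_zInf h.1, rfl⟩, h.2.linearIndependent,
    span_range_eq_top_of_linearIndependent h.2.linearIndependent, fun i => ?_⟩
  funext j
  simp [siegelBasis, Finset.sum_apply, Pi.single_apply]

/-- A family close to the standard basis of `𝔏(ω Eₙ)` has a Siegel matrix, and this is close
to `ω Eₙ`. -/
theorem exists_isSiegelMatrixOf (hω : ω ^ (Fintype.card F ^ 2) = ω)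
    (hω' : ω ^ Fintype.card F ≠ ω) {b : Fin n ⊕ Fin n → Fin n → CInf F}
    (hb : ∀ i, ‖b i - siegelBasis (ω • (1 : Matrix (Fin n) (Fin n) (CInf F))) i‖ < 1) :
    ∃ Z : Matrix (Fin n) (Fin n) (CInf F), IsSiegelMatrixOf b Z ∧ maxNorm (Z - ω • 1) < 1 := by
  have h := (linearIndependent_of_near hω hω' hb).2
  have hli := h.linearIndependent
  have hspan := span_range_eq_top_of_linearIndependent hli
  have hex : ∀ i, ∃ c : Fin n → CInf F, ∑ j, c j • b (Sum.inl j) = b (Sum.inr i) := by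
    intro i
    rw [← Submodule.mem_span_range_iff_exists_fun, hspan]
    trivial
  choose Z hZ using hex
  refine ⟨Z, ⟨hli, hspan, fun i => (hZ i).symm⟩, maxNorm_lt_one fun i => ?_⟩
  set Y : Fin n → CInf F := fun j => Z i j - (ω • (Pi.single i 1 : Fin n → CInf F)) j with hY
  have hYrow : ((Matrix.of Z - ω • (1 : Matrix (Fin n) (Fin n) (CInf F))) i : Fin n → CInf F)
      = Y := by
    funext j
    rw [hY, ← omega_one_row]
    rfl
  -- The i-th row of Z - ωE_n is the coordinate vector of this difference in an orthonormal
  -- C∞-basis, so the norms agree.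
  have hrow : ‖Y‖ = ‖b (Sum.inr i) - ω • b (Sum.inl i)‖ := by
    rw [← h Y, hY]
    congr 1
    simp only [sub_smul, Finset.sum_sub_distrib, hZ]
    congr 1
    rw [Finset.sum_eq_single i]
    · simp
    · intro j _ hj
      simp [hj]
    · simp
  have hsplit : b (Sum.inr i) - ω • b (Sum.inl i)
      = (b (Sum.inr i) - siegelBasis (ω • (1 : Matrix (Fin n) (Fin n) (CInf F))) (Sum.inr i))
        + -(ω • (b (Sum.inl i)
          - siegelBasis (ω • (1 : Matrix (Fin n) (Fin n) (CInf F))) (Sum.inl i))) := by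
    rw [siegelBasis_inl, siegelBasis_inr, omega_one_row, smul_sub]
    abel
  change ‖((Matrix.of Z - ω • (1 : Matrix (Fin n) (Fin n) (CInf F))) i : Fin n → CInf F)‖ < 1
  rw [hYrow, hrow, hsplit]
  refine (IsUltrametricDist.norm_add_le_max _ _).trans_lt (max_lt (hb _) ?_)
  rw [norm_neg, norm_smul, CInf.norm_omega hω hω', one_mul]
  exact hb _

/-- The span of a family with Siegel matrix `Z` is equivalent to `𝔏(Z)`. -/
theorem latticeEquiv_siegelLattice {b : Fin n ⊕ Fin n → Fin n → CInf F}
    {Z : Matrix (Fin n) (Fin n) (CInf F)} (h : IsSiegelMatrixOf b Z) :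
    LatticeEquiv (Submodule.span (ZInf F) (Set.range b) : Set (Fin n → CInf F))
      (siegelLattice Z) := by
  obtain ⟨hli, hspan, hZ⟩ := h
  set B := Module.Basis.mk hli hspan.ge with hB
  refine ⟨B.equivFun, ?_⟩
  rw [← span_range_eq_image, siegelLattice]
  congr 2
  have hinl : ∀ i, B.equivFun (b (Sum.inl i)) = Pi.single i 1 := by
    intro i
    have : B i = b (Sum.inl i) := Module.Basis.mk_apply _ _ i
    funext j
    rw [← this, B.equivFun_self, Pi.single_apply]
    exact if_congr eq_comm rfl rfl
  congr 1
  funext i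
  rcases i with i | i
  · exact hinl i
  · rw [hZ, map_sum, siegelBasis_inr]
    simp only [map_smul, hinl]
    funext j
    simp [Finset.sum_apply, Pi.single_apply]

theorem IsSiegelMatrixOf.smul {b : Fin n ⊕ Fin n → Fin n → CInf F}
    {Z : Matrix (Fin n) (Fin n) (CInf F)} (h : IsSiegelMatrixOf b Z) {y : CInf F} (hy : y ≠ 0) :
    IsSiegelMatrixOf (fun i => y • b i) Z := by
  obtain ⟨hli, -, hZ⟩ := h
  have hli' : LinearIndependent (CInf F) fun i => y • b (Sum.inl i) :=
    hli.units_smul fun _ => Units.mk0 y hy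
  refine ⟨hli', span_range_eq_top_of_linearIndependent hli', fun i => ?_⟩
  simp only [hZ, Finset.smul_sum]
  exact Finset.sum_congr rfl fun j _ => smul_comm _ _ _

theorem smul_mem_span_smul_iff {ι : Type*} {b : ι → Fin n → CInf F} {y : CInf F} (hy : y ≠ 0)
    {v : Fin n → CInf F} :
    y • v ∈ Submodule.span (ZInf F) (Set.range fun i => y • b i)
      ↔ v ∈ Submodule.span (ZInf F) (Set.range b) := by
  have h := span_range_eq_image (LinearEquiv.smulOfNeZero (CInf F) (Fin n → CInf F) y hy) b
  rw [← SetLike.mem_coe, ← SetLike.mem_coe]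
  change y • v ∈ (Submodule.span (ZInf F) (Set.range fun i =>
    (LinearEquiv.smulOfNeZero (CInf F) (Fin n → CInf F) y hy) (b i)) : Set (Fin n → CInf F)) ↔ _
  rw [h]
  exact (LinearEquiv.smulOfNeZero (CInf F) (Fin n → CInf F) y hy).injective.mem_set_image (a := v)

end Lattice


namespace Motive

variable {F : Type*} [Field F] [Fintype F] {n : ℕ} {A : Matrix (Fin n) (Fin n) (CInf F)}

/-! ### The kernel of the exponential as an `F[θ]`-module -/

theorem expMap_smul_of_pow_eq (hA : ∀ i j, ‖A i j‖ ≤ 1) {a : CInf F}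
    (ha : ∀ k, expCoeff A k = 0 ∨ a ^ (Fintype.card F ^ k) = a) (z : Fin n → CInf F) :
    expMap A (a • z) = a • expMap A z := by
  refine (hasSum_expMap hA (a • z)).unique ?_
  convert (hasSum_expMap hA z).const_smul a using 1
  funext k i
  rcases ha k with h | h
  · simp [seriesTerm, h]
  · simp only [seriesTerm, Pi.smul_apply, smul_eq_mul, mul_pow, h, Finset.mul_sum]
    exact Finset.sum_congr rfl fun j _ => by ring

theorem expMap_algebraMap_smul (hA : ∀ i j, ‖A i j‖ ≤ 1) (c : F) (z : Fin n → CInf F) :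
    expMap A (algebraMap F (CInf F) c • z) = algebraMap F (CInf F) c • expMap A z :=
  expMap_smul_of_pow_eq hA (fun k => Or.inr (by rw [← map_pow, FiniteField.pow_card_pow])) z

/-- The kernel of the exponential. -/
def expKer (hA : ∀ i j, ‖A i j‖ ≤ 1) : Submodule (ZInf F) (Fin n → CInf F) where
  carrier := {v | expMap A v = 0}
  zero_mem' := expMap_zero hA
  add_mem' {v w} hv hw := by
    change expMap A (v + w) = 0
    rw [expMap_add hA, show expMap A v = 0 from hv, show expMap A w = 0 from hw, add_zero]
  smul_mem' := by
    rintro ⟨a, ha⟩ v hv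
    change expMap A v = 0 at hv
    change expMap A (a • v) = 0
    revert v
    induction ha using Algebra.adjoin_induction with
    | mem x hx =>
      intro v hv
      rw [Set.mem_singleton_iff.1 hx, expMap_theta_smul hA, hv, tAct_zero]
    | algebraMap c => intro v hv; rw [expMap_algebraMap_smul hA, hv, smul_zero]
    | add x y _ _ hx hy => intro v hv; rw [add_smul, expMap_add hA, hx hv, hy hv, add_zero]
    | mul x y _ _ hx hy => intro v hv; rw [mul_smul]; exact hx (hy hv)

theorem mem_expKer (hA : ∀ i j, ‖A i j‖ ≤ 1) {v : Fin n → CInf F} :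
    v ∈ expKer hA ↔ expMap A v = 0 := Iff.rfl

theorem motiveLattice_eq (hA : ∀ i j, ‖A i j‖ ≤ 1) : motiveLattice A = expKer hA :=
  Set.ext fun _ => mem_motiveLattice hA

/-! ### The lattice of `M(0)` -/

theorem norm_zero_apply_le (i j : Fin n) : ‖(0 : Matrix (Fin n) (Fin n) (CInf F)) i j‖ ≤ 1 := by
  simp

/-- M(0) is a direct sum of n copies of the one-dimensional motive. -/
theorem expCoeff_zero_apply (k : ℕ) (i j : Fin n) :
    expCoeff (0 : Matrix (Fin n) (Fin n) (CInf F)) k i j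
      = if i = j then expCoeff (0 : Matrix (Fin 1) (Fin 1) (CInf F)) k 0 0 else 0 := by
  induction k using Nat.twoStepInduction with
  | zero => simp [expCoeff, Matrix.one_apply]
  | one => simp [expCoeff_one]
  | more k ih _ =>
    rw [expCoeff_add_two, expCoeff_add_two, ih]
    by_cases h : i = j
    · simp [h]
    · simp [h, Fintype.card_ne_zero]

theorem expCoeff_zero_odd (k : ℕ) :
    expCoeff (0 : Matrix (Fin n) (Fin n) (CInf F)) (2 * k + 1) = 0 := by
  induction k with
  | zero => funext i j; simp [expCoeff_one]
  | succ k ih =>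
    funext i j
    rw [show 2 * (k + 1) + 1 = (2 * k + 1) + 2 by ring, expCoeff_add_two, ih]
    simp [Fintype.card_ne_zero]

theorem pow_card_pow_even {a : CInf F} (ha : a ^ (Fintype.card F ^ 2) = a) (k : ℕ) :
    a ^ (Fintype.card F ^ (2 * k)) = a := by
  induction k with
  | zero => simp
  | succ k ih => rw [mul_add, mul_one, pow_add, pow_mul, ih, ha]

/-- Only even powers of Frobenius occur for A = 0, and these fix the field with q² elements. -/
theorem expMap_zero_smul {a : CInf F} (ha : a ^ (Fintype.card F ^ 2) = a) (z : Fin n → CInf F) :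
    expMap 0 (a • z) = a • expMap 0 z := by
  refine expMap_smul_of_pow_eq norm_zero_apply_le (fun k => ?_) z
  obtain ⟨m, rfl | rfl⟩ := Nat.even_or_odd' k
  · exact Or.inr (pow_card_pow_even ha m)
  · exact Or.inl (expCoeff_zero_odd m)

/-- The exponential of `M(0)` in dimension one. -/
def scalarExp (z : CInf F) : CInf F :=
  expMap (0 : Matrix (Fin 1) (Fin 1) (CInf F)) (fun _ => z) 0

theorem expMap_zero_apply (z : Fin n → CInf F) (i : Fin n) :
    expMap 0 z i = scalarExp (z i) := by
  have hterm : (fun k => seriesTerm (expCoeff 0) z k i) = fun k =>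
      seriesTerm (expCoeff (0 : Matrix (Fin 1) (Fin 1) (CInf F))) (fun _ => z i) k 0 := by
    funext k
    have h1 : seriesTerm (expCoeff (0 : Matrix (Fin 1) (Fin 1) (CInf F))) (fun _ => z i) k 0
        = expCoeff (0 : Matrix (Fin 1) (Fin 1) (CInf F)) k 0 0 * z i ^ (Fintype.card F ^ k) :=
      Fin.sum_univ_one _
    rw [h1, seriesTerm, Finset.sum_eq_single i]
    · rw [expCoeff_zero_apply, if_pos rfl]
    · intro j _ hj
      rw [expCoeff_zero_apply, if_neg hj.symm, zero_mul]
    · simp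
  have h := Pi.hasSum.1 (hasSum_expMap norm_zero_apply_le z) i
  rw [hterm] at h
  exact h.unique (Pi.hasSum.1 (hasSum_expMap norm_zero_apply_le _) 0)

theorem scalarExp_zero : scalarExp (0 : CInf F) = 0 :=
  congrFun (expMap_zero (A := (0 : Matrix (Fin 1) (Fin 1) (CInf F))) norm_zero_apply_le) 0

theorem scalarExp_mul {a : CInf F} (ha : a ^ (Fintype.card F ^ 2) = a) (z : CInf F) :
    scalarExp (a * z) = a * scalarExp z :=
  congrFun (expMap_zero_smul (n := 1) ha fun _ => z) 0

theorem tAct_zero_apply (x : Fin n → CInf F) (i : Fin n) :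
    tAct 0 x i = CInf.theta F * x i + x i ^ (Fintype.card F ^ 2) := by
  simp [tAct]

/-- The construction of a number `y` with `L(M(0)) = y 𝔏(ω Eₙ)`: `y / θ` is mapped by the
exponential to a nonzero torsion point. -/
theorem exists_scalar_torsion : ∃ w l : CInf F, ‖w‖ = torsionRadius F ∧ scalarExp w = l ∧
    l ^ (Fintype.card F ^ 2 - 1) = -CInf.theta F := by
  obtain ⟨l, hl⟩ := CInf.exists_pow_eq_neg_theta (F := F)
  have hq2 := one_lt_card_sq (F := F)
  have hnl : ‖l‖ = torsionRadius F := by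
    refine (pow_left_inj₀ (n := Fintype.card F ^ 2 - 1) (norm_nonneg l) torsionRadius_nonneg
      (by omega)).1 ?_
    rw [← norm_pow, hl, norm_neg, CInf.norm_theta, torsionRadius_pow]
  have hconst : ‖(fun _ => l : Fin 1 → CInf F)‖ = torsionRadius F := by
    rw [pi_norm_const, hnl]
  obtain ⟨z, hz, hz'⟩ := exists_expMap_eq (A := (0 : Matrix (Fin 1) (Fin 1) (CInf F)))
    norm_zero_apply_le (hconst.trans_lt torsionRadius_lt_periodRadius)
  have hzc : (fun _ => z 0 : Fin 1 → CInf F) = z := by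
    funext i
    rw [Subsingleton.elim i 0]
  refine ⟨z 0, l, ?_, ?_, hl⟩
  · rw [← hconst, ← hz, ← hzc, pi_norm_const]
  · rw [scalarExp, hzc, hz']

theorem norm_le_one_of_pow_eq_self {a : CInf F} (ha : a ^ (Fintype.card F ^ 2) = a) : ‖a‖ ≤ 1 := by
  rcases eq_or_ne a 0 with rfl | h0
  · simp
  · exact (CInf.norm_eq_one_of_pow_eq_self one_lt_card_sq ha h0).le

variable {ω : CInf F}

theorem mem_siegelLattice_omega (hω : ω ^ (Fintype.card F ^ 2) = ω)
    (hω' : ω ^ Fintype.card F ≠ ω) {x : Fin n → CInf F}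
    (hx : ∀ i, x i ^ (Fintype.card F ^ 2) = x i) :
    x ∈ Submodule.span (ZInf F)
      (Set.range (siegelBasis (ω • (1 : Matrix (Fin n) (Fin n) (CInf F))))) := by
  choose a b hab using fun i => CInf.exists_eq_add_mul_omega hω hω' (hx i)
  rw [Submodule.mem_span_range_iff_exists_fun]
  refine ⟨Sum.elim (fun i => algebraMap F (ZInf F) (a i)) (fun i => algebraMap F (ZInf F) (b i)), ?_⟩
  funext j
  simp only [zInf_smul_eq]
  rw [sum_smul_siegelBasis_omega (fun i => ((Sum.elim (fun i => algebraMap F (ZInf F) (a i))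
    (fun i => algebraMap F (ZInf F) (b i)) i : ZInf F) : CInf F)) j, hab j]
  rfl

/-- Take y = θw, where w is a logarithm of a nonzero torsion point l of the one-dimensional module.
Every period of length at most R is y times a vector over the field with q² elements, because
torsion points have coordinates that are multiples of l by such constants. -/
theorem exists_normalization (hω : ω ^ (Fintype.card F ^ 2) = ω) (hω' : ω ^ Fintype.card F ≠ ω) :
    ∃ y : CInf F, ‖y‖ = periodRadius F ∧ IsNormalization n ω y := by
  obtain ⟨w, l, hw, hwl, hl⟩ := exists_scalar_torsion (F := F)
  have hq2 := one_lt_card_sq (F := F)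
  have hpow : ∀ x : CInf F, x ^ (Fintype.card F ^ 2) = x ^ (Fintype.card F ^ 2 - 1) * x :=
    fun x => by rw [← pow_succ, Nat.sub_add_cancel hq2.le]
  have hl0 : l ≠ 0 := by
    rintro rfl
    rw [zero_pow (by omega)] at hl
    exact CInf.theta_ne_zero (neg_eq_zero.1 hl.symm)
  set y := CInf.theta F * w with hy
  have hny : ‖y‖ = periodRadius F := by rw [hy, norm_mul, CInf.norm_theta, hw, periodRadius]
  have hy0 : y ≠ 0 := norm_pos_iff.1 (hny ▸ periodRadius_pos)
  set K := expKer (A := (0 : Matrix (Fin n) (Fin n) (CInf F))) norm_zero_apply_le with hK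
  set L := Submodule.span (ZInf F)
    (Set.range (siegelBasis (ω • (1 : Matrix (Fin n) (Fin n) (CInf F))))) with hL
  have hbasis : ∀ i, y • siegelBasis (ω • (1 : Matrix (Fin n) (Fin n) (CInf F))) i ∈ K := by
    have h1 : ∀ i : Fin n, expMap 0 (y • (Pi.single i 1 : Fin n → CInf F)) = 0 := by
      intro i
      rw [hy, mul_smul, expMap_theta_smul norm_zero_apply_le]
      funext j
      rw [tAct_zero_apply, expMap_zero_apply]
      by_cases h : j = i
      · subst h
        rw [Pi.smul_apply, Pi.single_eq_same, smul_eq_mul, mul_one, hwl, hpow, hl]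
        simp
      · rw [Pi.smul_apply, Pi.single_eq_of_ne h, smul_zero, scalarExp_zero]
        simp [Fintype.card_ne_zero]
    rintro (i | i)
    · exact h1 i
    · rw [siegelBasis_inr, omega_one_row, smul_comm, hK, mem_expKer, expMap_zero_smul hω, h1,
        smul_zero]
  have hle : ∀ v ∈ L, y • v ∈ K := by
    intro v hv
    induction hv using Submodule.span_induction with
    | mem x hx => obtain ⟨i, rfl⟩ := hx; exact hbasis i
    | zero => rw [smul_zero]; exact zero_mem K
    | add x x' _ _ hx hx' => rw [smul_add]; exact add_mem hx hx'
    | smul a x _ hx =>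
      rw [show y • a • x = a • y • x from by rw [zInf_smul_eq, zInf_smul_eq, smul_comm]]
      exact K.smul_mem a hx
  refine ⟨y, hny, hy0, Set.ext fun v => ?_⟩
  change y • v ∈ motiveLattice 0 ↔ v ∈ L
  rw [mem_motiveLattice norm_zero_apply_le]
  refine ⟨fun hv => ?_, hle v⟩
  let N : AddSubgroup (Fin n → CInf F) :=
    { carrier := {v | y⁻¹ • v ∈ L}
      zero_mem' := by
        change y⁻¹ • (0 : Fin n → CInf F) ∈ L
        rw [smul_zero]; exact zero_mem L
      add_mem' := fun {u v} hu hv => by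
        change y⁻¹ • (u + v) ∈ L
        rw [smul_add]; exact add_mem hu hv
      neg_mem' := fun {u} hu => by
        change y⁻¹ • (-u) ∈ L
        rw [smul_neg]; exact neg_mem hu }
  have hθ : ∀ u ∈ N, CInf.theta F • u ∈ N := by
    intro u hu
    change y⁻¹ • CInf.theta F • u ∈ L
    rw [smul_comm]
    exact L.smul_mem ⟨CInf.theta F, Algebra.subset_adjoin rfl⟩ hu
  have hmem : y • v ∈ N := by
    refine mem_of_expMap_eq_zero norm_zero_apply_le N hθ (fun u hu hun => ?_) hv
    set x := expMap 0 ((CInf.theta F)⁻¹ • u) with hx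
    have htor : tAct 0 x = 0 := by
      rw [hx, ← expMap_theta_smul norm_zero_apply_le, theta_smul_inv_smul, hu]
    -- Both x i and l solve X^(q²) = -θX, so their quotient is fixed by the q²-Frobenius.
    set ζ : Fin n → CInf F := fun i => x i / l with hζ
    have hζq : ∀ i, ζ i ^ (Fintype.card F ^ 2) = ζ i := by
      intro i
      have h1 := congrFun htor i
      rw [tAct_zero_apply, Pi.zero_apply] at h1
      have h2 : x i ^ (Fintype.card F ^ 2) = -CInf.theta F * x i := by linear_combination h1
      have h3 : l ^ (Fintype.card F ^ 2) = -CInf.theta F * l := by rw [hpow, hl]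
      simp only [hζ]
      rw [div_pow, h2, h3, mul_div_mul_left _ _ (neg_ne_zero.2 CInf.theta_ne_zero)]
    have hζx : expMap 0 (fun i => ζ i * w) = x := by
      funext i
      rw [expMap_zero_apply, scalarExp_mul (hζq i), hwl]
      exact div_mul_cancel₀ _ hl0
    -- Two logarithms of x of length at most t < R coincide.
    have hdiff : (CInf.theta F)⁻¹ • u - (fun i => ζ i * w) = 0 := by
      refine eq_zero_of_expMap_eq_zero (A := 0) norm_zero_apply_le ?_ ?_
      · refine lt_of_le_of_lt ?_ (torsionRadius_lt_periodRadius (F := F))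
        rw [sub_eq_add_neg]
        refine (IsUltrametricDist.norm_add_le_max _ _).trans (max_le ?_ ?_)
        · rw [norm_theta_inv_smul, div_le_iff₀ card_pos_real, mul_comm]
          exact hun
        · rw [norm_neg]
          refine (pi_norm_le_iff_of_nonneg torsionRadius_nonneg).2 fun i => ?_
          rw [norm_mul, hw]
          exact mul_le_of_le_one_left torsionRadius_nonneg (norm_le_one_of_pow_eq_self (hζq i))
      · rw [expMap_sub norm_zero_apply_le, hζx, sub_self]
    have hu' : y⁻¹ • u = ζ := by
      rw [← theta_smul_inv_smul u, sub_eq_zero.1 hdiff]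
      funext i
      simp only [Pi.smul_apply, smul_eq_mul]
      have hw0 : w ≠ 0 := by rintro h; rw [h, mul_zero] at hy; exact hy0 hy
      have hθ0 := CInf.theta_ne_zero (F := F)
      rw [hy]
      field_simp
    change y⁻¹ • u ∈ L
    rw [hu']
    exact mem_siegelLattice_omega hω hω' hζq
  have : y⁻¹ • y • v ∈ L := hmem
  rwa [smul_smul, inv_mul_cancel₀ hy0, one_smul] at this

/-- In positive dimension a normalization of the lattice of `M(0)` has the absolute value of the
shortest periods. -/
theorem norm_of_isNormalization (hω : ω ^ (Fintype.card F ^ 2) = ω)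
    (hω' : ω ^ Fintype.card F ≠ ω) {y : CInf F} (hy : IsNormalization n ω y) (i : Fin n) :
    ‖y‖ = periodRadius F := by
  obtain ⟨y₀, hny, hy₀, hlat₀⟩ := exists_normalization (n := n) hω hω'
  obtain ⟨hy0, hlat⟩ := hy
  set E₁ : Fin n → CInf F := Pi.single i 1 with hE₁
  have hE : ‖E₁‖ = 1 := by rw [hE₁, Pi.norm_single, norm_one]
  have hmemL : E₁ ∈ siegelLattice (ω • (1 : Matrix (Fin n) (Fin n) (CInf F))) :=
    Submodule.subset_span ⟨Sum.inl i, rfl⟩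
  have hker : ∀ {c : CInf F} {v : Fin n → CInf F},
      v ∈ scaledMotiveLattice c (0 : Matrix (Fin n) (Fin n) (CInf F)) → expMap 0 (c • v) = 0 :=
    fun h => (mem_motiveLattice norm_zero_apply_le).1 h
  refine le_antisymm ?_ ?_
  · by_contra! hlt
    have h1 : expMap 0 (y₀ • E₁) = 0 := hker (hlat₀ ▸ hmemL)
    -- If |y| > R, this is a vector of L₀ shorter than 1. The reference normalization y₀ turns it
    -- into a nonzero period shorter than R.
    set v := y⁻¹ • y₀ • E₁ with hv
    have hyv : y • v = y₀ • E₁ := by rw [hv, smul_smul, mul_inv_cancel₀ hy0, one_smul]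
    have hvL : v ∈ siegelLattice (ω • (1 : Matrix (Fin n) (Fin n) (CInf F))) := by
      rw [← hlat]
      refine (mem_motiveLattice norm_zero_apply_le).2 ?_
      rw [hyv, h1]
    have h2 : expMap 0 (y₀ • v) = 0 := hker (hlat₀ ▸ hvL)
    have hnv : ‖v‖ < 1 := by
      rw [hv, norm_smul, norm_smul, hE, mul_one, norm_inv, hny, inv_mul_eq_div,
        div_lt_one (norm_pos_iff.2 hy0)]
      exact hlt
    have h3 : y₀ • v = 0 := by
      refine eq_zero_of_expMap_eq_zero norm_zero_apply_le ?_ h2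
      rw [norm_smul, hny]
      exact mul_lt_of_lt_one_right periodRadius_pos hnv
    have hv0 : v = 0 := (smul_eq_zero.1 h3).resolve_left hy₀
    rw [hv0, smul_zero] at hyv
    have := (smul_eq_zero.1 hyv.symm).resolve_left hy₀
    rw [this, norm_zero] at hE
    exact zero_ne_one hE
  · by_contra! hlt
    have h1 : expMap 0 (y • E₁) = 0 := hker (hlat ▸ hmemL)
    have h2 := eq_zero_of_expMap_eq_zero norm_zero_apply_le
      (by rwa [norm_smul, hE, mul_one]) h1
    have := (smul_eq_zero.1 h2).resolve_left hy0
    rw [this, norm_zero] at hE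
    exact zero_ne_one hE

/-! ### The lattice of `M(A)` for `A` in the open unit polydisc -/

/-- The period y b of M(0) is almost a period of M(A): Exp_A(y b) has norm at most εR < R, with ε =
maxNorm A. A logarithm of the same norm corrects it. -/
theorem exists_near_basis (hω : ω ^ (Fintype.card F ^ 2) = ω) (hω' : ω ^ Fintype.card F ≠ ω)
    {y : CInf F} (hy : IsNormalization n ω y) (hA : maxNorm A < 1) (i : Fin n ⊕ Fin n) :
    ∃ l : Fin n → CInf F, expMap A (y • l) = 0 ∧
      ‖l - siegelBasis (ω • (1 : Matrix (Fin n) (Fin n) (CInf F))) i‖ ≤ maxNorm A := by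
  have hA1 : ∀ i j, ‖A i j‖ ≤ 1 := fun i j => (norm_apply_le_maxNorm A i j).trans hA.le
  set b := siegelBasis (ω • (1 : Matrix (Fin n) (Fin n) (CInf F))) i with hb
  -- The index i itself witnesses n > 0; in dimension 0 every nonzero y is a normalization.
  have hny : ‖y‖ = periodRadius F :=
    norm_of_isNormalization hω hω' hy (i.elim id id)
  have hyb : ‖y • b‖ = periodRadius F := by
    rw [norm_smul, hny, hb, norm_siegelBasis_omega hω hω', mul_one]
  have h0 : expMap 0 (y • b) = 0 := by
    have hbL : b ∈ siegelLattice (ω • (1 : Matrix (Fin n) (Fin n) (CInf F))) :=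
      Submodule.subset_span ⟨i, rfl⟩
    rw [← hy.2] at hbL
    exact (mem_motiveLattice norm_zero_apply_le).1 hbL
  have h1 : ‖-expMap A (y • b)‖ ≤ maxNorm A * periodRadius F := by
    have := norm_expMap_sub_expMap_zero_le (maxNorm_nonneg A) hA.le (norm_apply_le_maxNorm A) hyb.le
    rwa [h0, sub_zero, hyb, ← norm_neg] at this
  obtain ⟨u, hu, hu'⟩ := exists_expMap_eq hA1
    (h1.trans_lt (mul_lt_of_lt_one_left periodRadius_pos hA))
  have hy0 := hy.1
  refine ⟨b + y⁻¹ • u, ?_, ?_⟩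
  · rw [smul_add, smul_smul, mul_inv_cancel₀ hy0, one_smul, expMap_add hA1, hu', add_neg_cancel]
  · rw [add_sub_cancel_left, norm_smul, norm_inv, hny, hu, inv_mul_le_iff₀ periodRadius_pos, mul_comm]
    exact h1

/-- Kernel vectors close to the standard basis generate the kernel. -/
theorem expKer_eq_span (hω : ω ^ (Fintype.card F ^ 2) = ω) (hω' : ω ^ Fintype.card F ≠ ω)
    {y : CInf F} (hy : IsNormalization n ω y) (hA : maxNorm A < 1) (hA1 : ∀ i j, ‖A i j‖ ≤ 1)
    {l : Fin n ⊕ Fin n → Fin n → CInf F} (hl : ∀ i, expMap A (y • l i) = 0)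
    (hlb : ∀ i, ‖l i - siegelBasis (ω • (1 : Matrix (Fin n) (Fin n) (CInf F))) i‖ ≤ maxNorm A) :
    expKer hA1 = Submodule.span (ZInf F) (Set.range fun i => y • l i) := by
  have hy0 := hy.1
  set S := Submodule.span (ZInf F) (Set.range fun i => y • l i) with hS
  refine le_antisymm (fun v hv => ?_) (Submodule.span_le.2 ?_)
  swap
  · rintro _ ⟨i, rfl⟩
    exact hl i
  rcases isEmpty_or_nonempty (Fin n) with hn | ⟨⟨i₀⟩⟩
  · rw [Subsingleton.elim v 0]
    exact zero_mem S
  have hny : ‖y‖ = periodRadius F := norm_of_isNormalization hω hω' hy i₀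
  have hM := periodRadius_pos (F := F)
  refine mem_of_expMap_eq_zero hA1 S.toAddSubgroup
    (fun u hu => S.smul_mem ⟨CInf.theta F, Algebra.subset_adjoin rfl⟩ hu) (fun u hu hun => ?_) hv
  -- Conversely, a short period u of M(A) is almost a period of M(0): subtracting a small w makes u
  -- - w lie in yL₀.
  have h1 : ‖expMap 0 u‖ ≤ maxNorm A * periodRadius F := by
    have := norm_expMap_sub_expMap_zero_le (maxNorm_nonneg A) hA.le (norm_apply_le_maxNorm A) hun
    rw [hu, zero_sub, norm_neg] at this
    exact this.trans (mul_le_mul_of_nonneg_left hun (maxNorm_nonneg A))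
  obtain ⟨w, hw, hw'⟩ := exists_expMap_eq (A := (0 : Matrix (Fin n) (Fin n) (CInf F)))
    norm_zero_apply_le (h1.trans_lt (mul_lt_of_lt_one_left hM hA))
  have hwM : ‖w‖ < periodRadius F := hw ▸ h1.trans_lt (mul_lt_of_lt_one_left hM hA)
  have hmem : y⁻¹ • (u - w) ∈ siegelLattice (ω • (1 : Matrix (Fin n) (Fin n) (CInf F))) := by
    rw [← hy.2]
    refine (mem_motiveLattice norm_zero_apply_le).2 ?_
    rw [smul_smul, mul_inv_cancel₀ hy0, one_smul, expMap_sub norm_zero_apply_le, hw', sub_self]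
  obtain ⟨g, hg⟩ := (Submodule.mem_span_range_iff_exists_fun _).1 hmem
  choose a ha ha' using fun i => exists_rInf_smul_eq (n := n) (g i)
  -- Orthonormality bounds the coefficients by the length of (u - w)/y, which is at most 1.
  -- Replacing l_{0,i} by l_i therefore changes the combination by little.
  have hnorm : ‖a‖ ≤ 1 := by
    rw [← isNormOrthonormal_siegelBasis_omega (n := n) hω hω' a]
    simp only [← ha', hg]
    rw [norm_smul, norm_inv, hny, inv_mul_le_iff₀ hM, mul_one, sub_eq_add_neg]
    exact (IsUltrametricDist.norm_add_le_max _ _).trans (max_le hun (by rw [norm_neg]; exact hwM.le))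
  set s := ∑ i, g i • y • l i with hs
  have hsS : s ∈ S := sum_mem fun i _ => S.smul_mem _ (Submodule.subset_span ⟨i, rfl⟩)
  have hus : u - s = w + -(y • ∑ i, a i •
      (l i - siegelBasis (ω • (1 : Matrix (Fin n) (Fin n) (CInf F))) i)) := by
    have h2 : u = w + y • ∑ i, g i • siegelBasis (ω • (1 : Matrix (Fin n) (Fin n) (CInf F))) i := by
      rw [hg, smul_smul, mul_inv_cancel₀ hy0, one_smul, add_sub_cancel]
    have h3 : s = y • ∑ i, a i • l i := by
      rw [hs, Finset.smul_sum]
      refine Finset.sum_congr rfl fun i _ => ?_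
      rw [← ha', zInf_smul_eq, zInf_smul_eq, smul_comm]
    rw [h3]
    conv_lhs => rw [h2]
    simp only [ha', smul_sub, Finset.sum_sub_distrib]
    abel
  -- The difference u - s is a period of M(A) shorter than R.
  have hus0 : u - s = 0 := by
    refine eq_zero_of_expMap_eq_zero hA1 ?_ ?_
    · rw [hus]
      refine (IsUltrametricDist.norm_add_le_max _ _).trans_lt (max_lt hwM ?_)
      rw [norm_neg, norm_smul, hny]
      refine mul_lt_of_lt_one_right hM (lt_of_le_of_lt ?_ hA)
      simpa using norm_sum_smul_le zero_le_one (maxNorm_nonneg A)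
        (fun i => (norm_le_pi_norm a i).trans hnorm) hlb
    · have : s ∈ expKer hA1 := sum_mem fun i _ => (expKer hA1).smul_mem _ (hl i)
      rw [expMap_sub hA1, hu, (mem_expKer hA1).1 this, sub_zero]
  rw [sub_eq_zero.1 hus0]
  exact hsS

end Motive

end

/-! ### Assembly of the proposition -/

theorem linearIndependent_smul_of_ne_zero {F : Type*} [Field F] [Fintype F] {n : ℕ} {ι : Type*}
    {b : ι → Fin n → CInf F} (hb : LinearIndependent (RInf F) b) {y : CInf F} (hy : y ≠ 0) :
    LinearIndependent (RInf F) fun i => y • b i := by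
  refine hb.map_injOn (DistribSMul.toLinearMap (RInf F) (Fin n → CInf F) y) ?_
  exact (smul_right_injective _ hy).injOn

theorem proposition2p2 {F : Type*} [Field F] [Fintype F] (n : ℕ) (ω : CInf F)
    (hω : ω ^ (Fintype.card F ^ 2) = ω) (hω' : ω ^ Fintype.card F ≠ ω) :
    (∀ A : Matrix (Fin n) (Fin n) (CInf F), IsTMotive F n (2 * n) (Motive A)) ∧
    (∃ y : CInf F, IsNormalization n ω y) ∧
    ∀ y : CInf F, IsNormalization n ω y →
      ∃ (U₁ U₃ : Set (Matrix (Fin n) (Fin n) (CInf F))) (h₁ : 0 ∈ U₁) (μ₁₃ : U₁ → U₃),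
        IsOpen U₁ ∧ IsOpen U₃ ∧
        ω • (1 : Matrix (Fin n) (Fin n) (CInf F)) ∈ U₃ ∧ U₃ ⊆ siegelMatrices F n ∧
        (∀ A : U₁, IsLattice (2 * n) (motiveLattice A.1) ∧
          LatticeEquiv (motiveLattice A.1) (siegelLattice (μ₁₃ A).1)) ∧
        ∃ l : U₁ → Fin n ⊕ Fin n → Fin n → CInf F,
          (∀ A : U₁, IsZBasis (l A) (scaledMotiveLattice y A.1) ∧
            IsSiegelMatrixOf (l A) (μ₁₃ A).1) ∧
          (∃ ρ : ℝ, 0 < ρ ∧ ∀ (A : U₁) (i : Fin n ⊕ Fin n),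
            ‖l A i - siegelBasis (ω • 1) i‖ < ρ ∧
            ∀ v ∈ scaledMotiveLattice y A.1,
              ‖v - siegelBasis (ω • 1) i‖ < ρ → v = l A i) ∧
          ∀ i, Tendsto (fun A => l A i) (𝓝 (⟨0, h₁⟩ : U₁)) (𝓝 (siegelBasis (ω • 1) i)) := by
  refine ⟨Motive.isTMotive, ?_, fun y hy => ?_⟩
  · obtain ⟨y, -, hy⟩ := Motive.exists_normalization (n := n) hω hω'
    exact ⟨y, hy⟩
  have hy0 := hy.1
  have hlt : ∀ A : {A : Matrix (Fin n) (Fin n) (CInf F) | maxNorm A < 1}, maxNorm A.1 < 1 :=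
    fun A => A.2
  have hA1 : ∀ A : {A : Matrix (Fin n) (Fin n) (CInf F) | maxNorm A < 1}, ∀ i j, ‖A.1 i j‖ ≤ 1 :=
    fun A i j => (norm_apply_le_maxNorm A.1 i j).trans (hlt A).le
  choose l hl hlb using fun A : {A : Matrix (Fin n) (Fin n) (CInf F) | maxNorm A < 1} =>
    Motive.exists_near_basis hω hω' hy (hlt A)
  have hlb1 : ∀ A i, ‖l A i - siegelBasis (ω • 1) i‖ < 1 := fun A i => (hlb A i).trans_lt (hlt A)
  choose Z hZ hZ1 using fun A => exists_isSiegelMatrixOf hω hω' (hlb1 A)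
  have hker : ∀ A, motiveLattice A.1
      = (Submodule.span (ZInf F) (Set.range fun i => y • l A i) : Set (Fin n → CInf F)) := by
    intro A
    rw [Motive.motiveLattice_eq (hA1 A),
      Motive.expKer_eq_span hω hω' hy (hlt A) (hA1 A) (hl A) (hlb A)]
  have hscaled : ∀ A, (Submodule.span (ZInf F) (Set.range (l A)) : Set (Fin n → CInf F))
      = scaledMotiveLattice y A.1 := by
    intro A
    ext v
    change _ ↔ y • v ∈ motiveLattice A.1
    rw [hker A]
    exact (smul_mem_span_smul_iff hy0).symm
  have hli : ∀ A, LinearIndependent (RInf F) (l A) := fun A =>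
    (linearIndependent_of_near hω hω' (hlb1 A)).1
  -- Both neighbourhoods are open unit polydiscs and ρ = 1: distance 1 in the rescaled lattice
  -- corresponds to the shortest period length R when n > 0.
  refine ⟨{A | maxNorm A < 1}, {Z | maxNorm (Z - ω • 1) < 1}, ?_, fun A => ⟨Z A, hZ1 A⟩, ?_, ?_, ?_,
    ?_, ?_, l, ?_, ⟨1, one_pos, fun A i => ⟨hlb1 A i, fun v hv hvi => ?_⟩⟩, fun i => ?_⟩
  · change maxNorm 0 < 1
    rw [maxNorm_zero]
    exact one_pos
  · exact isOpen_lt continuous_maxNorm continuous_const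
  · exact isOpen_lt (continuous_maxNorm.comp (continuous_id.sub continuous_const)) continuous_const
  · change maxNorm (ω • 1 - ω • 1) < 1
    rw [sub_self, maxNorm_zero]
    exact one_pos
  · exact fun Z hZ => mem_siegelMatrices hω hω' hZ
  · intro A
    rw [hker A]
    refine ⟨isLattice_span ?_ ?_, latticeEquiv_siegelLattice ((hZ A).smul hy0)⟩
    · exact linearIndependent_smul_of_ne_zero (hli A) hy0
    · rw [eq_top_iff, ← ((hZ A).smul hy0).2.1]
      refine Submodule.span_mono ?_
      rintro _ ⟨i, rfl⟩
      exact ⟨Sum.inl i, rfl⟩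
  · exact fun A => ⟨⟨linearIndependent_zInf (hli A), hscaled A⟩, hZ A⟩
  -- Both v and l_i(A) lie within 1 of l_{0,i}, so y(v - l_i(A)) is a period shorter than R and
  -- vanishes.
  · have hny := Motive.norm_of_isNormalization hω hω' hy (i.elim id id)
    have hv' : Motive.expMap A.1 (y • v) = 0 := (Motive.mem_motiveLattice (hA1 A)).1 hv
    have hdiff : y • (v - l A i) = 0 := by
      refine Motive.eq_zero_of_expMap_eq_zero (hA1 A) ?_ ?_
      · rw [norm_smul, hny]
        refine mul_lt_of_lt_one_right periodRadius_pos ?_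
        rw [← sub_sub_sub_cancel_right v (l A i) (siegelBasis (ω • 1) i), sub_eq_add_neg]
        refine (IsUltrametricDist.norm_add_le_max _ _).trans_lt (max_lt hvi ?_)
        rw [norm_neg]
        exact hlb1 A i
      · rw [smul_sub, Motive.expMap_sub (hA1 A), hv', hl, sub_zero]
    exact sub_eq_zero.1 ((smul_eq_zero.1 hdiff).resolve_left hy0)
  -- The distance to l_{0,i} is at most `maxNorm A`, which is continuous and vanishes at A = 0.
  · rw [tendsto_iff_norm_sub_tendsto_zero]
    refine squeeze_zero (fun _ => norm_nonneg _) (fun A => hlb A i) ?_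
    have h := (continuous_maxNorm (F := F) (n := n)).comp
      (continuous_subtype_val (p := fun A => maxNorm A < 1))
    exact (h.tendsto ⟨0, by rw [maxNorm_zero]; exact one_pos⟩).mono_right
      (congrArg 𝓝 maxNorm_zero).le
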